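/- Let $d\ge 1$, $\Omega=[0,1]^d$, $1<p<\infty$, $\Psi(x)=|x|^{p-2}x$ (with $\Psi(0)=0$), and $0<T_0\le\infty$; write $J=[0,T_0]$ if $T_0<\infty$ and $J=[0,\infty[$ if $T_0=\infty$. Let $g:\Omega\to\mathbb R$ and let $f:\Omega\times J\to\mathbb R$ be measurable, such that at least one of the following holds, where $f\in L^1(J;L^q(\Omega))$ means $\int_J\|f(\cdot,t)\|_{L^q(\Omega)}\,dt<\infty$: (a) $p<2$, $g\in L^2(\Omega)$, $f\in L^1(J;L^2(\Omega))$; (b) $p\ge 2$, $g\in L^{2(p-1)}(\Omega)$, $f\in L^1(J;L^{2(p-1)}(\Omega))$; (c) $g\in L^\infty(\Omega)$, $f\in L^1(J;L^\infty(\Omega))$. A kernel $K$ is a measurable, nonnegative, symmetric function on $\Omega^2$ with $\|K\|_{L^{\infty,2}(\Omega^2)}=\sup_{x}\|K(x,\cdot)\|_{L^2(\Omega)}<\infty$ (properties and supremum up to null sets). For $0<T<\infty$ with $T\le T_0$, a solution on $[0,T]$ of problem $(\mathcal P)$ with kernel $K$ and data $(f,g)$ is a function $u\in C([0,T];L^1(\Omega))\cap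 W^{1,1}(]0,T[;L^1(\Omega))$ with $u(\cdot,0)=g$ a.e. such that for almost every $t\in\,]0,T[$ the function $(x,y)\mapsto K(x,y)\Psi(u(y,t)-u(x,t))$ is integrable on $\Omega^2$ and, for a.e. $x\in\Omega$, $$\partial_t u(x,t)=\int_\Omega K(x,y)\Psi(u(y,t)-u(x,t))\,dy+f(x,t).$$ Functions that agree a.e. in $\Omega$ for every $t\in[0,T]$ are identified. For $n\ge 1$ and increasing nodes $0=x^{(k)}_0<\dots<x^{(k)}_n=1$ on each axis $k$, let $\Omega_i=\prod_k\,]x^{(k)}_{i_k-1},x^{(k)}_{i_k}]$ for $i\in\{1,\dots,n\}^d$, $h_i=|\Omega_i|$, and let $\delta_n$ be the largest side length of a cell. Put $(P_nw)_i=h_i^{-1}\int_{\Omega_i}w$, $(P_nK)_{ij}=(h_ih_j)^{-1}\int_{\Omega_i\times\Omega_j}K$, and let $I_n$ map a vector (matrix) to the function that is constant on each cell $\Omega_i$ (each $\Omega_i\times\Omega_j$) with the corresponding value. The semi-discrete problem is $$\mathbf u_i'(t)=\sum_jh_j(P_nK)_{ij}\Psi(\mathbf u_j(t)-\mathbf u_i(t))+(P_nf(\cdot,t))_i\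 \text{ for a.e. } t\in\,]0,T[,\qquad \mathbf u(0)=P_ng,$$ with $\mathbf u$ absolutely continuous on $[0,T]$. Put $u_n(\cdot,t)=I_n\mathbf u(t)$ and $f_n(\cdot,t)=I_nP_nf(\cdot,t)$. Then the following hold. (i) For every kernel $K$ and every finite $T\in\,]0,T_0]$, $(\mathcal P)$ with kernel $K$ and data $(f,g)$ has a unique solution $u$ on $[0,T]$. For every mesh the semi-discrete problem has a solution, and for any such solution $\mathbf u$ the function $u_n$ is the unique solution of $(\mathcal P)$ with kernel $I_nP_nK$ and data $(f_n,I_nP_ng)$. (ii) There is a constant $C>0$ depending only on $p$, $g$ and $f$ such that, for all kernels $K$, all finite $T\in\,]0,T_0]$ and all meshes, $u_n-u\in C([0,T];L^2(\Omega))$ and $$\|u_n-u\|_{C([0,T];L^2(\Omega))}\le\|I_nP_ng-g\|_{L^2(\Omega)}+\|f_n-f\|_{L^1([0,T];L^2(\Omega))}+CT\,\kappa,$$ where $\kappa=\|I_nP_nK-K\|_{L^{\infty,2}(\Omega^2)}$ under (a) or (b), and $\kappa=\|I_nP_nK-K\|_{L^2(\Omega^2)}$ under (c). (iii) For $s\in\,]0,1]$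 and $S\subset\mathbb R^N$ let $|F|_{\mathrm{Lip}(s,L^2(S))}=\sup_{h>0}h^{-s}\sup_{|z|<h}\big(\int_{x,x+z\in S}|F(x+z)-F(x)|^2dx\big)^{1/2}$, and let $\mathrm{Lip}(s,L^2(S))$ be the set of $F\in L^2(S)$ for which this is finite. Suppose in addition that $g\in L^\infty(\Omega)\cap\mathrm{Lip}(s,L^2(\Omega))$, $K\in\mathrm{Lip}(s,L^2(\Omega^2))$, $f\in L^1(J;L^\infty(\Omega))$ and $\int_J|f(\cdot,t)|_{\mathrm{Lip}(s,L^2(\Omega))}\,dt<\infty$. Then there is a constant $C>0$ depending only on $d$, $p$, $g$, $f$, $K$ and $s$ such that, for all finite $T\in\,]0,T_0]$ and all meshes, $$\|u_n-u\|_{C([0,T];L^2(\Omega))}\le C(1+T)\,\delta_n^{\,s}.$$ -/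

import Mathlib

open MeasureTheory Set Filter Topology
open scoped ENNReal

noncomputable section

namespace NonlocalPLaplacian

/-- The unit cube `[0,1]^ι`. -/
def cube (ι : Type*) : Set (ι → ℝ) := Icc 0 1

/-- Lebesgue measure on `Ω = [0,1]^d`. -/
def μΩ (d : ℕ) : Measure (Fin d → ℝ) := volume.restrict (cube (Fin d))

/-- `Ψ(x) = |x|^(p-2) x`, with value `0` at `x = 0`. -/
def Psi (p x : ℝ) : ℝ := |x| ^ (p - 2) * x

/-! ### Function spaces and norms -/

/-- The norm of `L^{∞,q}(Ω²)`: the (essential) supremum over `x` of the `L^q` norm of `F(x,·)`. -/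
def normLinfLq (d : ℕ) (q : ℝ≥0∞) (F : (Fin d → ℝ) → (Fin d → ℝ) → ℝ) : ℝ≥0∞ :=
  essSup (fun x => eLpNorm (F x) q (μΩ d)) (μΩ d)

/-- The norm of `L^q(Ω²)`. -/
def normLqSq (d : ℕ) (q : ℝ≥0∞) (F : (Fin d → ℝ) → (Fin d → ℝ) → ℝ) : ℝ≥0∞ :=
  eLpNorm (Function.uncurry F) q ((μΩ d).prod (μΩ d))

/-- The norm of `L^1(J; L^q(Ω))`, for a set `J` of times. -/
def normL1Lq {d : ℕ} (J : Set ℝ) (q : ℝ≥0∞) (f : ℝ → (Fin d → ℝ) → ℝ) : ℝ≥0∞ :=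
  ∫⁻ t in J, eLpNorm (f t) q (μΩ d)

/-- `f ∈ L^1(J; L^q(Ω))`. -/
def MemL1Lq {d : ℕ} (J : Set ℝ) (q : ℝ≥0∞) (f : ℝ → (Fin d → ℝ) → ℝ) : Prop :=
  AEStronglyMeasurable (Function.uncurry f) ((volume.restrict J).prod (μΩ d)) ∧
    normL1Lq J q f < ∞

/-- `w ∈ C([0,T]; L^q(Ω))`. -/
def MemC {d : ℕ} (T : ℝ) (q : ℝ≥0∞) (w : ℝ → (Fin d → ℝ) → ℝ) : Prop :=
  (∀ t ∈ Icc 0 T, MemLp (w t) q (μΩ d)) ∧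
    ∀ t ∈ Icc 0 T, Tendsto (fun τ => eLpNorm (w τ - w t) q (μΩ d)) (𝓝[Icc 0 T] t) (𝓝 0)

/-- The norm of `C([0,T]; L^q(Ω))`. -/
def normC {d : ℕ} (T : ℝ) (q : ℝ≥0∞) (w : ℝ → (Fin d → ℝ) → ℝ) : ℝ≥0∞ :=
  ⨆ t ∈ Icc 0 T, eLpNorm (w t) q (μΩ d)

/-- The `L^q(S)` modulus of smoothness `ω(F,h)_q`; `‖WithLp.toLp 2 z‖` is the Euclidean norm. -/
def modulus {ι : Type*} [Fintype ι] (S : Set (ι → ℝ)) (q : ℝ≥0∞) (F : (ι → ℝ) → ℝ) (h : ℝ) :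
    ℝ≥0∞ :=
  ⨆ z : ι → ℝ, ⨆ _ : ‖WithLp.toLp 2 z‖ < h,
    eLpNorm (fun x => F (x + z) - F x) q (volume.restrict {x | x ∈ S ∧ x + z ∈ S})

/-- The seminorm `|F|_{Lip(s, L^q(S))}`. -/
def lipSeminorm {ι : Type*} [Fintype ι] (s : ℝ) (q : ℝ≥0∞) (S : Set (ι → ℝ))
    (F : (ι → ℝ) → ℝ) : ℝ≥0∞ :=
  ⨆ h : ℝ, ⨆ _ : 0 < h, ENNReal.ofReal (h ^ (-s)) * modulus S q F h

/-- `F ∈ Lip(s, L^q(S))`. -/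
def MemLip {ι : Type*} [Fintype ι] (s : ℝ) (q : ℝ≥0∞) (S : Set (ι → ℝ))
    (F : (ι → ℝ) → ℝ) : Prop :=
  MemLp F q (volume.restrict S) ∧ lipSeminorm s q S F < ∞

/-- A function of two variables on `ℝ^d` as a function on `ℝ^(2d)`. -/
def joined {d : ℕ} (F : (Fin d → ℝ) → (Fin d → ℝ) → ℝ) : (Fin d ⊕ Fin d → ℝ) → ℝ :=
  fun z => F (fun k => z (Sum.inl k)) (fun k => z (Sum.inr k))

/-! ### The continuum problem -/

/-- Nonnegative symmetric measurable kernels in `L^{∞,2}(Ω²)`. -/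
structure IsKernel (d : ℕ) (K : (Fin d → ℝ) → (Fin d → ℝ) → ℝ) : Prop where
  measurable : AEStronglyMeasurable (Function.uncurry K) ((μΩ d).prod (μΩ d))
  nonneg : ∀ᵐ z ∂((μΩ d).prod (μΩ d)), 0 ≤ K z.1 z.2
  symm : ∀ᵐ z ∂((μΩ d).prod (μΩ d)), K z.1 z.2 = K z.2 z.1
  bounded : normLinfLq d 2 K < ∞

/-- The nonlocal `p`-Laplacian with kernel `K`. -/
def pLap {d : ℕ} (p : ℝ) (K : (Fin d → ℝ) → (Fin d → ℝ) → ℝ) (u : (Fin d → ℝ) → ℝ) :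
    (Fin d → ℝ) → ℝ :=
  fun x => -∫ y, K x y * Psi p (u y - u x) ∂(μΩ d)

/-- The function `u` lies in the domain of the nonlocal `p`-Laplacian: the integrals that
define it converge absolutely and give an element of `L^1(Ω)`. -/
def InDomain {d : ℕ} (p : ℝ) (K : (Fin d → ℝ) → (Fin d → ℝ) → ℝ) (u : (Fin d → ℝ) → ℝ) : Prop :=
  Integrable (fun z : (Fin d → ℝ) × (Fin d → ℝ) => K z.1 z.2 * Psi p (u z.2 - u z.1))
    ((μΩ d).prod (μΩ d))

/-- `u` is a (strong) solution on `[0,T]` of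
`∂u/∂t = ∫ K(x,y) Ψ(u(y,t) - u(x,t)) dy + f(x,t)`, `u(x,0) = g(x)`.
The space `C([0,T]; L^1) ∩ W^{1,1}(]0,T[; L^1)` consists of the absolutely continuous maps
`U : [0,T] → L^1(Ω)` that are differentiable almost everywhere. -/
def IsSolution {d : ℕ} (p T : ℝ) (K : (Fin d → ℝ) → (Fin d → ℝ) → ℝ)
    (f : ℝ → (Fin d → ℝ) → ℝ) (g : (Fin d → ℝ) → ℝ) (u : ℝ → (Fin d → ℝ) → ℝ) : Prop :=
  ∃ U : ℝ → Lp ℝ 1 (μΩ d),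
    (∀ t ∈ Icc 0 T, u t =ᵐ[μΩ d] U t) ∧
    AbsolutelyContinuousOnInterval U 0 T ∧
    u 0 =ᵐ[μΩ d] g ∧
    ∀ᵐ t ∂(volume.restrict (Ioo 0 T)), InDomain p K (u t) ∧
      ∃ V : Lp ℝ 1 (μΩ d), HasDerivAt U V t ∧
        V =ᵐ[μΩ d] fun x => -pLap p K (u t) x + f t x

/-- `u` is the unique solution on `[0,T]`, as a curve of almost everywhere classes. -/
def IsUniqueSolution {d : ℕ} (p T : ℝ) (K : (Fin d → ℝ) → (Fin d → ℝ) → ℝ)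
    (f : ℝ → (Fin d → ℝ) → ℝ) (g : (Fin d → ℝ) → ℝ) (u : ℝ → (Fin d → ℝ) → ℝ) : Prop :=
  IsSolution p T K f g u ∧
    ∀ v, IsSolution p T K f g v → ∀ t ∈ Icc 0 T, v t =ᵐ[μΩ d] u t

/-! ### Space discretization -/

/-- A partition of `[0,1]^d` into `n^d` boxes, given by `n + 1` increasing nodes on each axis. -/
structure Mesh (d n : ℕ) where
  node : Fin d → Fin (n + 1) → ℝ
  strictMono : ∀ k, StrictMono (node k)
  first : ∀ k, node k 0 = 0
  last : ∀ k, node k (Fin.last n) = 1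

namespace Mesh

variable {d n : ℕ}

/-- The cell `∏ₖ ]x_{iₖ-1}, x_{iₖ}]`. -/
def cell (M : Mesh d n) (i : Fin d → Fin n) : Set (Fin d → ℝ) :=
  {x | ∀ k, x k ∈ Ioc (M.node k (i k).castSucc) (M.node k (i k).succ)}

/-- The volume `h_i` of a cell. -/
def vol (M : Mesh d n) (i : Fin d → Fin n) : ℝ := (volume (M.cell i)).toReal

/-- The maximal mesh size `δ_n`. -/
def size (M : Mesh d n) : ℝ :=
  ⨆ k : Fin d, ⨆ j : Fin n, |M.node k j.succ - M.node k j.castSucc|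

/-- The projector `P_n` on functions on `Ω`. -/
def proj (M : Mesh d n) (u : (Fin d → ℝ) → ℝ) : (Fin d → Fin n) → ℝ :=
  fun i => (M.vol i)⁻¹ * ∫ x in M.cell i, u x

/-- The projector `P_n` on functions on `Ω²`. -/
def proj₂ (M : Mesh d n) (K : (Fin d → ℝ) → (Fin d → ℝ) → ℝ) :
    (Fin d → Fin n) → (Fin d → Fin n) → ℝ :=
  fun i j => (M.vol i * M.vol j)⁻¹ * ∫ z in M.cell i ×ˢ M.cell j, K z.1 z.2

/-- The piecewise constant injector `I_n` on vectors. -/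
def inj (M : Mesh d n) (v : (Fin d → Fin n) → ℝ) : (Fin d → ℝ) → ℝ :=
  fun x => ∑ i, (M.cell i).indicator (fun _ => v i) x

/-- The piecewise constant injector `I_n` on matrices. -/
def inj₂ (M : Mesh d n) (B : (Fin d → Fin n) → (Fin d → Fin n) → ℝ) :
    (Fin d → ℝ) → (Fin d → ℝ) → ℝ :=
  fun x y => ∑ i, ∑ j, (M.cell i ×ˢ M.cell j).indicator (fun _ => B i j) (x, y)

/-- The discrete `p`-Laplacian with kernel `B`. -/
def pLapDisc (M : Mesh d n) (p : ℝ) (B : (Fin d → Fin n) → (Fin d → Fin n) → ℝ)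
    (v : (Fin d → Fin n) → ℝ) : (Fin d → Fin n) → ℝ :=
  fun i => -∑ j, M.vol j * B i j * Psi p (v j - v i)

/-- `v` solves on `[0,T]` the system `v' = -Δ v + b(t)`, `v(0) = a`, where `Δ` is the discrete
`p`-Laplacian with kernel `B`. The source is only integrable in time, so `v` is absolutely
continuous and the equation holds for almost every time. -/
def IsSemidiscreteSolution (M : Mesh d n) (p T : ℝ)
    (B : (Fin d → Fin n) → (Fin d → Fin n) → ℝ) (b : ℝ → (Fin d → Fin n) → ℝ)
    (a : (Fin d → Fin n) → ℝ) (v : ℝ → (Fin d → Fin n) → ℝ) : Prop :=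
  AbsolutelyContinuousOnInterval v 0 T ∧ v 0 = a ∧
    ∀ᵐ t ∂(volume.restrict (Ioo 0 T)), HasDerivAt v (-M.pLapDisc p B (v t) + b t) t

end Mesh

/-! ### Assumptions on the data -/

/-- The set of times `t ≥ 0` with `t ≤ T₀`, where `T₀ = ∞` is allowed. -/
def timeSet (T₀ : ℝ≥0∞) : Set ℝ := {t | 0 ≤ t ∧ ENNReal.ofReal t ≤ T₀}

/-- `g ∈ L^q(Ω)` and `f ∈ L^1(J; L^q(Ω))`. -/
def DataIn {d : ℕ} (J : Set ℝ) (q : ℝ≥0∞) (f : ℝ → (Fin d → ℝ) → ℝ) (g : (Fin d → ℝ) → ℝ) :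
    Prop :=
  MemLp g q (μΩ d) ∧ MemL1Lq J q f

/-- Assumption (a) or (b): `L^2` data if `1 < p < 2`, and `L^{2(p-1)}` data if `p ≥ 2`. -/
def CondAB {d : ℕ} (p : ℝ) (J : Set ℝ) (f : ℝ → (Fin d → ℝ) → ℝ) (g : (Fin d → ℝ) → ℝ) : Prop :=
  (p < 2 ∧ DataIn J 2 f g) ∨ (2 ≤ p ∧ DataIn J (ENNReal.ofReal (2 * (p - 1))) f g)

/-- Assumption (c): `L^∞` data. -/
def CondC {d : ℕ} (J : Set ℝ) (f : ℝ → (Fin d → ℝ) → ℝ) (g : (Fin d → ℝ) → ℝ) : Prop :=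
  DataIn J ∞ f g

end NonlocalPLaplacian

end

open NonlocalPLaplacian

set_option linter.unusedSectionVars false

/-! The nonlocal operator `u ↦ ∫ K(x,y) Ψ(u(y) - u(x)) dy` is dissipative in a strong sense. Since
`K` is symmetric and nonnegative and `Ψ` is odd and monotone, exchanging `x` and `y` shows that the
difference of its values at `u` and `v`, tested against `j(u - v)` with `j` monotone and bounded,
has integral at most zero (`SymmKernel.integral_nonlocalOp_sub_nonpos`). Hence, if a curve `U'`
satisfies the equation of `U` up to a defect `F`, then `‖U - U'‖_q` grows at most at the rate
`‖F‖_q` (`IsCurveSolution.eLpNorm_sub_le`). The size of the kernel does not enter this bound.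

Solutions are only absolutely continuous in `L¹`, so the `L^q` norm cannot be differentiated
directly. It is replaced by the integral of `truncPow`, a convex function of linear growth that
gives a Lipschitz functional on `L¹`; Fatou's lemma removes the truncation
(`eLpNorm_le_of_dissipative`).

This stability estimate is used several times. Comparison with the zero solution bounds `u` in every
`L^q`, and `q → ∞` gives `L^∞`. The case `q = 1` gives uniqueness, and also existence: `Ψ` is
approximated by Lipschitz monotone odd functions, the approximate problems are solved by Picard
iteration in `L¹`, and their solutions are Cauchy because the approximation error is small relative
to `1 + |s|^r` and the solutions are bounded in `L^r` (`exists_isCurveSolution`). The same theorem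
on the finite set of cells, weighted by volume, solves the semi-discrete system.

The case `q = 2` gives the error estimate. The function `u_n` solves the problem with kernel `K_n =
I_n P_n K`, and the defect of `u` in that problem is the operator with kernel `K_n - K` at `u`, plus
`f_n - f`. The first part is bounded by Cauchy–Schwarz in `y` when `|u|^(p-1)` is in `L²`, which is
where the exponent `2(p-1)` comes from, and by the `L²(Ω²)` norm of `K_n - K` when `u` is bounded.
The bounds on `u` depend only on `p`, `g` and `f`, so the constant is uniform in `T`, `K` and the
mesh.

For the rate, a cell average is the best constant in `L²` on the cell, so it may be compared with
translates of the function; this bounds the projection error by the modulus of smoothness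
(`sum_lintegral_sub_average_le_modulus`). -/

noncomputable section

namespace NonlocalPLaplacian

section

/-! ### The nonlinearity -/

/-- Continuous, monotone and odd functions. -/
structure Flux (φ : ℝ → ℝ) : Prop where
  continuous : Continuous φ
  monotone : Monotone φ
  odd : ∀ s, φ (-s) = -φ s

/-- Powers of the positive and negative parts make continuity and monotonicity visible also for `p <
2`, where the factor `|x| ^ (p - 2)` is singular at `0`. -/
lemma Psi_eq {p : ℝ} (hp : 1 < p) (x : ℝ) :
    Psi p x = (max x 0) ^ (p - 1) - (max (-x) 0) ^ (p - 1) := by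
  have h0 : (0 : ℝ) ^ (p - 1) = 0 := Real.zero_rpow (by linarith)
  rcases lt_trichotomy x 0 with h | h | h
  · rw [max_eq_right h.le, max_eq_left (by linarith), h0, Psi, abs_of_neg h,
      show p - 1 = (p - 2) + 1 by ring, Real.rpow_add_one (by linarith)]
    ring
  · subst h; simp [Psi]
  · rw [max_eq_left h.le, max_eq_right (by linarith), h0, Psi, abs_of_pos h,
      show p - 1 = (p - 2) + 1 by ring, Real.rpow_add_one (by linarith)]
    ring

lemma flux_Psi {p : ℝ} (hp : 1 < p) : Flux (Psi p) where
  continuous := by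
    have : Psi p = fun x => (max x 0) ^ (p - 1) - (max (-x) 0) ^ (p - 1) := funext (Psi_eq hp)
    rw [this]
    exact ((continuous_id.max continuous_const).rpow_const fun _ => Or.inr (by linarith)).sub
      ((continuous_neg.max continuous_const).rpow_const fun _ => Or.inr (by linarith))
  monotone := by
    intro x y hxy
    rw [Psi_eq hp, Psi_eq hp]
    have h1 : (max x 0) ^ (p - 1) ≤ (max y 0) ^ (p - 1) :=
      Real.rpow_le_rpow (le_max_right _ _) (max_le_max hxy le_rfl) (by linarith)
    have h2 : (max (-y) 0) ^ (p - 1) ≤ (max (-x) 0) ^ (p - 1) :=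
      Real.rpow_le_rpow (le_max_right _ _) (max_le_max (by linarith) le_rfl) (by linarith)
    linarith
  odd := fun s => by simp [Psi]

lemma Psi_of_nonneg {p : ℝ} (hp : 1 < p) {x : ℝ} (hx : 0 ≤ x) : Psi p x = x ^ (p - 1) := by
  rw [Psi_eq hp, max_eq_left hx, max_eq_right (by linarith), Real.zero_rpow (by linarith), sub_zero]

lemma abs_Psi {p : ℝ} (hp : 1 < p) (x : ℝ) : |Psi p x| = |x| ^ (p - 1) := by
  rcases le_total 0 x with h | h
  · rw [Psi_of_nonneg hp h, abs_of_nonneg h, abs_of_nonneg (Real.rpow_nonneg h _)]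
  · have h' : 0 ≤ -x := by linarith
    rw [← neg_neg x, (flux_Psi hp).odd, abs_neg, abs_neg, Psi_of_nonneg hp h', abs_of_nonneg h',
      abs_of_nonneg (Real.rpow_nonneg h' _)]

lemma abs_sub_rpow_le {q : ℝ} (hq : 0 ≤ q) (a b : ℝ) :
    |b - a| ^ q ≤ 2 ^ q * (|b| ^ q + |a| ^ q) := by
  have h1 : |b - a| ≤ 2 * max |b| |a| := by
    have := abs_sub b a
    have := le_max_left |b| |a|
    have := le_max_right |b| |a|
    linarith
  calc |b - a| ^ q ≤ (2 * max |b| |a|) ^ q := Real.rpow_le_rpow (abs_nonneg _) h1 hq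
    _ = 2 ^ q * (max |b| |a|) ^ q := Real.mul_rpow (by norm_num) (by positivity)
    _ ≤ 2 ^ q * (|b| ^ q + |a| ^ q) := by
        gcongr
        have := Real.rpow_nonneg (abs_nonneg a) q
        have := Real.rpow_nonneg (abs_nonneg b) q
        rcases max_choice |b| |a| with h | h <;> rw [h] <;> linarith

/-- Lipschitz approximations of `Psi p`. -/
def PsiApprox (p : ℝ) (k : ℕ) (s : ℝ) : ℝ :=
  Psi p (max ((k : ℝ) + 1)⁻¹ (min s (k + 1))) - Psi p (max ((k : ℝ) + 1)⁻¹ (min (-s) (k + 1)))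

lemma flux_PsiApprox {p : ℝ} (hp : 1 < p) (k : ℕ) : Flux (PsiApprox p k) where
  continuous := by
    have := (flux_Psi hp).continuous
    unfold PsiApprox
    fun_prop
  monotone := by
    intro x y hxy
    have h := (flux_Psi hp).monotone
    exact sub_le_sub (h (max_le_max le_rfl (min_le_min hxy le_rfl)))
      (h (max_le_max le_rfl (min_le_min (by linarith) le_rfl)))
  odd := fun s => by simp [PsiApprox]

/-- The clamp keeps the argument of the power in `[1/(k+1), k+1]`, where it is `C¹`: away from `0`,
where the derivative blows up if `p < 2`, and from infinity, where it does if `p > 2`. -/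
lemma exists_lipschitzWith_PsiApprox {p : ℝ} (hp : 1 < p) (k : ℕ) :
    ∃ L, LipschitzWith L (PsiApprox p k) := by
  have hk : (0 : ℝ) < ((k : ℝ) + 1)⁻¹ := by positivity
  have hk1 : ((k : ℝ) + 1)⁻¹ ≤ k + 1 := by
    have : (1 : ℝ) ≤ k + 1 := by linarith [Nat.cast_nonneg (α := ℝ) k]
    exact (inv_le_one_of_one_le₀ this).trans this
  have hC : ContDiffOn ℝ 1 (Psi p) (Icc ((k : ℝ) + 1)⁻¹ (k + 1)) := by
    have : ContDiffOn ℝ 1 (fun x : ℝ => x ^ (p - 1)) (Icc ((k : ℝ) + 1)⁻¹ (k + 1)) := fun x hx =>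
      (Real.contDiffAt_rpow_const_of_ne (by linarith [hx.1])).contDiffWithinAt
    exact this.congr fun x hx => Psi_of_nonneg hp (hk.le.trans hx.1)
  obtain ⟨L, hL⟩ := hC.exists_lipschitzOnWith one_ne_zero (convex_Icc _ _) isCompact_Icc
  have hmem : ∀ s : ℝ, max ((k : ℝ) + 1)⁻¹ (min s (k + 1)) ∈ Icc ((k : ℝ) + 1)⁻¹ (k + 1) :=
    fun s => ⟨le_max_left _ _, max_le hk1 (min_le_right _ _)⟩
  have hclamp : LipschitzWith 1 fun s : ℝ => max ((k : ℝ) + 1)⁻¹ (min s (k + 1)) :=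
    (LipschitzWith.id.min_const _).const_max _
  have h1 : LipschitzWith (L * 1) fun s : ℝ => Psi p (max ((k : ℝ) + 1)⁻¹ (min s (k + 1))) := by
    rw [← lipschitzOnWith_univ]
    exact hL.comp (hclamp.lipschitzOnWith) fun s _ => hmem s
  refine ⟨_, h1.sub ((h1.comp (LipschitzWith.id.neg)))⟩

/-- The distance between `Psi p` and `PsiApprox p k`, relative to `1 + |s| ^ r`. -/
def approxErr (p r : ℝ) (k : ℕ) : ℝ :=
  ((k : ℝ) + 1) ^ (-(p - 1)) + ((k : ℝ) + 1) ^ (-(r - (p - 1)))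

lemma approxErr_nonneg (p r : ℝ) (k : ℕ) : 0 ≤ approxErr p r k := by
  unfold approxErr; positivity

lemma tendsto_approxErr {p r : ℝ} (hp : 1 < p) (hr : p - 1 < r) :
    Tendsto (approxErr p r) atTop (𝓝 0) := by
  have h : Tendsto (fun k : ℕ => (k : ℝ) + 1) atTop atTop :=
    tendsto_atTop_add_const_right _ _ tendsto_natCast_atTop_atTop
  have := ((tendsto_rpow_neg_atTop (y := p - 1) (by linarith)).comp h).add
    ((tendsto_rpow_neg_atTop (y := r - (p - 1)) (by linarith)).comp h)
  rwa [add_zero] at this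

/-- By oddness `s ≥ 0`, and then the subtracted term of `PsiApprox` is the constant `(k+1) ^
(-(p-1))`, the first part of the error. Clamping at `k + 1` matters only for `s ≥ k + 1`, where `s ^
(p-1)` is at most `(k+1) ^ (-(r-(p-1)))` times `s ^ r`. -/
lemma abs_PsiApprox_sub_le {p r : ℝ} (hp : 1 < p) (hr : p - 1 < r) (k : ℕ) (s : ℝ) :
    |PsiApprox p k s - Psi p s| ≤ approxErr p r k * (1 + |s| ^ r) := by
  wlog hs : 0 ≤ s generalizing s
  · have := this (-s) (by linarith)
    rw [(flux_Psi hp).odd, (flux_PsiApprox hp k).odd, abs_neg] at this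
    rwa [← abs_neg, show -(PsiApprox p k s - Psi p s) = -PsiApprox p k s - -Psi p s by ring]
  have hk0 : (0 : ℝ) < (k : ℝ) + 1 := by positivity
  have hk : (0 : ℝ) < ((k : ℝ) + 1)⁻¹ := by positivity
  have h1k : (1 : ℝ) ≤ k + 1 := by linarith [Nat.cast_nonneg (α := ℝ) k]
  have hk1 : ((k : ℝ) + 1)⁻¹ ≤ k + 1 := (inv_le_one_of_one_le₀ h1k).trans h1k
  have hA : 0 ≤ ((k : ℝ) + 1) ^ (-(p - 1)) := by positivity
  have hB : 0 ≤ ((k : ℝ) + 1) ^ (-(r - (p - 1))) := by positivity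
  have hsr : 0 ≤ s ^ r := Real.rpow_nonneg hs _
  have hinv : Psi p ((k : ℝ) + 1)⁻¹ = ((k : ℝ) + 1) ^ (-(p - 1)) := by
    rw [Psi_of_nonneg hp hk.le, Real.inv_rpow hk0.le, Real.rpow_neg hk0.le]
  have hmono := (flux_Psi hp).monotone
  have hP0 : 0 ≤ Psi p s := by rw [Psi_of_nonneg hp hs]; positivity
  have hval : PsiApprox p k s
      = Psi p (max ((k : ℝ) + 1)⁻¹ (min s (k + 1))) - ((k : ℝ) + 1) ^ (-(p - 1)) := by
    rw [PsiApprox, ← hinv, min_eq_left (by linarith : -s ≤ (k : ℝ) + 1),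
      max_eq_left (by linarith : -s ≤ ((k : ℝ) + 1)⁻¹)]
  rw [hval, abs_of_nonneg hs, approxErr]
  have key : |Psi p (max ((k : ℝ) + 1)⁻¹ (min s (k + 1))) - ((k : ℝ) + 1) ^ (-(p - 1)) - Psi p s|
      ≤ ((k : ℝ) + 1) ^ (-(p - 1)) + ((k : ℝ) + 1) ^ (-(r - (p - 1))) * s ^ r := by
    rcases le_total s ((k : ℝ) + 1) with h | h
    · rw [min_eq_left h]
      rcases le_total ((k : ℝ) + 1)⁻¹ s with h' | h'
      · rw [max_eq_right h', abs_le]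
        constructor <;> nlinarith
      · rw [max_eq_left h', hinv, abs_le]
        have := hmono h'
        rw [hinv] at this
        constructor <;> nlinarith
    · rw [min_eq_right h, max_eq_right hk1]
      have h1 := hmono h
      have h2 : Psi p s ≤ ((k : ℝ) + 1) ^ (-(r - (p - 1))) * s ^ r := by
        have hspos : 0 < s := hk0.trans_le h
        rw [Psi_of_nonneg hp hs]
        have : s ^ (p - 1) = s ^ (-(r - (p - 1))) * s ^ r := by
          rw [← Real.rpow_add hspos]; congr 1; ring
        rw [this]
        exact mul_le_mul_of_nonneg_right (Real.rpow_le_rpow_of_nonpos hk0 h (by linarith)) hsr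
      have h3 : 0 ≤ Psi p ((k : ℝ) + 1) := by
        rw [Psi_of_nonneg hp hk0.le]; positivity
      rw [abs_le]
      constructor <;> linarith
  nlinarith

/-! ### Truncated powers -/

/-- The convex function that equals `|x| ^ q` for `|x| ≤ k` and is affine on `[k, ∞[`. -/
def truncPow (q k x : ℝ) : ℝ := q * (min |x| k) ^ (q - 1) * |x| - (q - 1) * (min |x| k) ^ q

/-- The derivative of `truncPow q k`, divided by `q`. -/
def truncDual (q k x : ℝ) : ℝ := Real.sign x * (min |x| k) ^ (q - 1)

lemma rpow_mul_self_sub_one {q x : ℝ} (hq : 1 ≤ q) (hx : 0 ≤ x) : x ^ (q - 1) * x = x ^ q := by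
  rcases hx.eq_or_lt with rfl | hx
  · rw [mul_zero, Real.zero_rpow (by linarith)]
  · rw [← Real.rpow_add_one hx.ne']; congr 1; ring

/-- The left side is the tangent of `x ^ q` at `m`; the inequality is Young's for `x` and `m ^ (q -
1)`. -/
lemma tangent_rpow_le {q m x : ℝ} (hq : 1 ≤ q) (hm : 0 ≤ m) (hx : 0 ≤ x) :
    q * m ^ (q - 1) * x - (q - 1) * m ^ q ≤ x ^ q := by
  rcases hq.eq_or_lt with rfl | hq
  · simp
  have hc : Real.HolderConjugate q (q / (q - 1)) := Real.HolderConjugate.conjExponent hq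
  have h := Real.young_inequality_of_nonneg hx (Real.rpow_nonneg hm (q - 1)) hc
  rw [← Real.rpow_mul hm, show (q - 1) * (q / (q - 1)) = q by
    field_simp [show q - 1 ≠ 0 by linarith]] at h
  have h2 : m ^ q / (q / (q - 1)) = (q - 1) / q * m ^ q := by field_simp
  rw [h2] at h
  have h3 : q * (x * m ^ (q - 1)) ≤ q * (x ^ q / q + (q - 1) / q * m ^ q) := by gcongr
  have h4 : q * (x ^ q / q + (q - 1) / q * m ^ q) = x ^ q + (q - 1) * m ^ q := by
    field_simp
  linarith

/-- For `|x| ≤ k` this is convexity of the power. Beyond `k`, `truncPow` is the tangent at `k`,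
which dominates the tangent at `m` at the point `k` and has the larger slope. -/
lemma tangent_le_truncPow {q k m x : ℝ} (hq : 1 ≤ q) (hm : 0 ≤ m) (hmk : m ≤ k) :
    q * m ^ (q - 1) * |x| - (q - 1) * m ^ q ≤ truncPow q k x := by
  unfold truncPow
  rcases le_total |x| k with h | h
  · rw [min_eq_left h]
    have := tangent_rpow_le hq hm (abs_nonneg x)
    have h2 := rpow_mul_self_sub_one hq (abs_nonneg x)
    nlinarith
  · rw [min_eq_right h]
    have hk := hm.trans hmk
    have h1 := tangent_rpow_le hq hm hk
    have h2 := rpow_mul_self_sub_one hq hk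
    have h3 : m ^ (q - 1) ≤ k ^ (q - 1) := Real.rpow_le_rpow hm hmk (by linarith)
    nlinarith [mul_nonneg (mul_nonneg (by linarith : 0 ≤ q) (sub_nonneg.2 h3)) (sub_nonneg.2 h)]

lemma truncDual_bound {q k : ℝ} (hq : 1 ≤ q) (hk : 0 ≤ k) (x : ℝ) :
    |truncDual q k x| ≤ k ^ (q - 1) := by
  unfold truncDual
  have h : 0 ≤ min |x| k := le_min (abs_nonneg x) hk
  rw [abs_mul, abs_of_nonneg (Real.rpow_nonneg h _)]
  have h1 : |Real.sign x| ≤ 1 := by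
    rcases Real.sign_apply_eq x with h | h | h <;> simp [h]
  calc _ ≤ 1 * (min |x| k) ^ (q - 1) := by gcongr
    _ ≤ _ := by rw [one_mul]; exact Real.rpow_le_rpow h (min_le_right _ _) (by linarith)

lemma truncDual_abs_le {q k : ℝ} (hk : 0 ≤ k) (x : ℝ) :
    |truncDual q k x| ≤ (min |x| k) ^ (q - 1) := by
  unfold truncDual
  have h : 0 ≤ min |x| k := le_min (abs_nonneg x) hk
  rw [abs_mul, abs_of_nonneg (Real.rpow_nonneg h _)]
  have h1 : |Real.sign x| ≤ 1 := by
    rcases Real.sign_apply_eq x with h | h | h <;> simp [h]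
  calc _ ≤ 1 * (min |x| k) ^ (q - 1) := by gcongr
    _ = _ := one_mul _

lemma truncDual_neg (q k x : ℝ) : truncDual q k (-x) = -truncDual q k x := by
  simp [truncDual, Real.sign_neg]

lemma truncDual_monotone {q k : ℝ} (hq : 1 ≤ q) (hk : 0 ≤ k) : Monotone (truncDual q k) := by
  have hpos : ∀ x, 0 < x → truncDual q k x = (min x k) ^ (q - 1) := fun x hx => by
    rw [truncDual, Real.sign_of_pos hx, abs_of_pos hx, one_mul]
  have hnn : ∀ x, 0 ≤ x → 0 ≤ truncDual q k x := fun x hx => by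
    rcases hx.eq_or_lt with rfl | hx
    · simp [truncDual]
    · rw [hpos x hx]; exact Real.rpow_nonneg (le_min hx.le hk) _
  have hmono : ∀ x y, 0 ≤ x → x ≤ y → truncDual q k x ≤ truncDual q k y := fun x y hx hxy => by
    rcases hx.eq_or_lt with rfl | hx
    · simpa [truncDual] using hnn y hxy
    · rw [hpos x hx, hpos y (hx.trans_le hxy)]
      exact Real.rpow_le_rpow (le_min hx.le hk) (min_le_min hxy le_rfl) (by linarith)
  intro x y hxy
  rcases le_total 0 x with hx | hx
  · exact hmono x y hx hxy
  · rcases le_total 0 y with hy | hy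
    · have := hnn (-x) (by linarith)
      rw [truncDual_neg] at this
      linarith [hnn y hy]
    · have := hmono (-y) (-x) (by linarith) (by linarith)
      rw [truncDual_neg, truncDual_neg] at this
      linarith

/-- The tangent at `min |a| k` agrees with `truncPow` at `|a|`, and `sign a * b ≤ |b|`. A
subgradient is used in place of a derivative because for `q = 1` there is a kink at `0`. -/
lemma truncPow_subgradient {q k : ℝ} (hq : 1 ≤ q) (hk : 0 ≤ k) (a b : ℝ) :
    truncPow q k a + q * truncDual q k a * (b - a) ≤ truncPow q k b := by
  have h := tangent_le_truncPow (x := b) hq (le_min (abs_nonneg a) hk) (min_le_right |a| k)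
  have h1 : Real.sign a * a = |a| := by
    rcases lt_trichotomy a 0 with h | h | h
    · rw [Real.sign_of_neg h, abs_of_neg h]; ring
    · simp [h]
    · rw [Real.sign_of_pos h, abs_of_pos h]; ring
  have h2 : Real.sign a * b ≤ |b| := by
    have := neg_abs_le b
    have := le_abs_self b
    rcases Real.sign_apply_eq a with h | h | h <;> rw [h] <;> linarith [abs_nonneg b]
  have h3 : 0 ≤ q * (min |a| k) ^ (q - 1) :=
    mul_nonneg (by linarith) (Real.rpow_nonneg (le_min (abs_nonneg a) hk) _)
  have h4 : q * truncDual q k a * (b - a)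
      = q * (min |a| k) ^ (q - 1) * (Real.sign a * b)
        - q * (min |a| k) ^ (q - 1) * (Real.sign a * a) := by
    rw [truncDual]; ring
  rw [h4, h1]
  have h5 := mul_le_mul_of_nonneg_left h2 h3
  have h6 : truncPow q k a = q * (min |a| k) ^ (q - 1) * |a| - (q - 1) * (min |a| k) ^ q := rfl
  linarith

/-- The purpose of the truncation: with this bound `∫ truncPow q k (W t)` is absolutely continuous
in `t` as soon as `W` is absolutely continuous in `L¹`. -/
lemma abs_truncPow_sub_le {q k : ℝ} (hq : 1 ≤ q) (hk : 0 ≤ k) (a b : ℝ) :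
    |truncPow q k a - truncPow q k b| ≤ q * k ^ (q - 1) * |a - b| := by
  have h : ∀ a b, truncPow q k a - truncPow q k b ≤ q * k ^ (q - 1) * |a - b| := fun a b => by
    have h1 := truncPow_subgradient hq hk a b
    have h2 : truncDual q k a * (a - b) ≤ k ^ (q - 1) * |a - b| := by
      refine (le_abs_self _).trans ?_
      rw [abs_mul]
      gcongr
      exact truncDual_bound hq hk a
    nlinarith
  rw [abs_le]
  constructor
  · have := h b a
    rw [abs_sub_comm] at this
    linarith
  · exact h a b

lemma truncPow_zero {q : ℝ} (hq : 1 ≤ q) {k : ℝ} (hk : 0 ≤ k) : truncPow q k 0 = 0 := by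
  simp [truncPow, hk, Real.zero_rpow (by linarith : q ≠ 0)]

lemma min_rpow_le_truncPow {q k : ℝ} (hq : 1 ≤ q) (hk : 0 ≤ k) (x : ℝ) :
    (min |x| k) ^ q ≤ truncPow q k x := by
  have h0 : 0 ≤ min |x| k := le_min (abs_nonneg x) hk
  have h := rpow_mul_self_sub_one hq h0
  have h2 : (min |x| k) ^ (q - 1) * min |x| k ≤ (min |x| k) ^ (q - 1) * |x| :=
    mul_le_mul_of_nonneg_left (min_le_left _ _) (Real.rpow_nonneg h0 _)
  unfold truncPow
  nlinarith

lemma truncPow_nonneg {q k : ℝ} (hq : 1 ≤ q) (hk : 0 ≤ k) (x : ℝ) : 0 ≤ truncPow q k x :=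
  (Real.rpow_nonneg (le_min (abs_nonneg x) hk) _).trans (min_rpow_le_truncPow hq hk x)

lemma truncPow_le {q k : ℝ} (hq : 1 ≤ q) (hk : 0 ≤ k) (x : ℝ) : truncPow q k x ≤ |x| ^ q :=
  tangent_rpow_le hq (le_min (abs_nonneg x) hk) (abs_nonneg x)

lemma continuous_truncPow {q k : ℝ} (hq : 1 ≤ q) (hk : 0 ≤ k) : Continuous (truncPow q k) :=
  (LipschitzWith.of_dist_le_mul (K := ⟨q * k ^ (q - 1), by positivity⟩) fun a b => by
    rw [Real.dist_eq, Real.dist_eq]; exact abs_truncPow_sub_le hq hk a b).continuous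

end

section

/-! ### Nonlocal operators on a finite measure space -/

/-- Nonnegative symmetric kernels whose marginals are bounded by `C`. -/
structure SymmKernel {X : Type*} [MeasurableSpace X] (μ : Measure X) (C : NNReal)
    (K : X → X → ℝ) : Prop where
  measurable : AEStronglyMeasurable (Function.uncurry K) (μ.prod μ)
  nonneg : ∀ᵐ z ∂(μ.prod μ), 0 ≤ K z.1 z.2
  symm : ∀ᵐ z ∂(μ.prod μ), K z.1 z.2 = K z.2 z.1
  bounded : ∀ᵐ x ∂μ, ∫⁻ y, ‖K x y‖ₑ ∂μ ≤ C

/-- The integrand of the nonlocal operator with nonlinearity `φ`. -/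
def integrand {X : Type*} (φ : ℝ → ℝ) (K : X → X → ℝ) (u : X → ℝ) (z : X × X) : ℝ :=
  K z.1 z.2 * φ (u z.2 - u z.1)

/-- The nonlocal operator with nonlinearity `φ`. -/
def nonlocalOp {X : Type*} [MeasurableSpace X] (μ : Measure X) (φ : ℝ → ℝ) (K : X → X → ℝ)
    (u : X → ℝ) (x : X) : ℝ :=
  ∫ y, K x y * φ (u y - u x) ∂μ

variable {X : Type*} [MeasurableSpace X] {μ : Measure X} [IsFiniteMeasure μ]

lemma integrand_congr {φ : ℝ → ℝ} {K : X → X → ℝ} {u v : X → ℝ} (h : u =ᵐ[μ] v) :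
    integrand φ K u =ᵐ[μ.prod μ] integrand φ K v := by
  filter_upwards [Measure.quasiMeasurePreserving_fst.ae_eq_comp h,
    Measure.quasiMeasurePreserving_snd.ae_eq_comp h] with z h1 h2
  simp only [Function.comp_apply] at h1 h2
  simp [integrand, h1, h2]

lemma nonlocalOp_congr {φ : ℝ → ℝ} {K : X → X → ℝ} {u v : X → ℝ} (h : u =ᵐ[μ] v) :
    nonlocalOp μ φ K u =ᵐ[μ] nonlocalOp μ φ K v := by
  filter_upwards [h] with x hx
  refine integral_congr_ae ?_
  filter_upwards [h] with y hy
  rw [hx, hy]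

lemma SymmKernel.aestronglyMeasurable_integrand {C : NNReal} {K : X → X → ℝ}
    (hK : SymmKernel μ C K) {φ : ℝ → ℝ} (hφ : Continuous φ) {u : X → ℝ}
    (hu : AEStronglyMeasurable u μ) :
    AEStronglyMeasurable (integrand φ K u) (μ.prod μ) :=
  hK.measurable.mul (hφ.comp_aestronglyMeasurable (hu.comp_snd.sub hu.comp_fst))

lemma SymmKernel.aemeasurable_enorm {C : NNReal} {K : X → X → ℝ} (hK : SymmKernel μ C K) :
    AEMeasurable (fun z : X × X => ‖K z.1 z.2‖ₑ) (μ.prod μ) :=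
  hK.measurable.enorm

lemma SymmKernel.lintegral_fst_le {C : NNReal} {K : X → X → ℝ} (hK : SymmKernel μ C K)
    {A : X → ℝ≥0∞} (hA : AEMeasurable A μ) :
    ∫⁻ z, ‖K z.1 z.2‖ₑ * A z.1 ∂(μ.prod μ) ≤ C * ∫⁻ x, A x ∂μ := by
  rw [lintegral_prod (fun z => ‖K z.1 z.2‖ₑ * A z.1) (hK.aemeasurable_enorm.mul hA.comp_fst), ← lintegral_const_mul' _ _ (by simp)]
  refine lintegral_mono_ae ?_
  filter_upwards [hK.bounded, hK.measurable.prodMk_left] with x hx hx'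
  have hm : AEMeasurable (fun y => ‖K x y‖ₑ) μ := hx'.enorm
  rw [lintegral_mul_const'' _ hm]
  gcongr

lemma SymmKernel.lintegral_snd_le {C : NNReal} {K : X → X → ℝ} (hK : SymmKernel μ C K)
    {A : X → ℝ≥0∞} (hA : AEMeasurable A μ) :
    ∫⁻ z, ‖K z.1 z.2‖ₑ * A z.2 ∂(μ.prod μ) ≤ C * ∫⁻ x, A x ∂μ := by
  refine le_trans (le_of_eq ?_) (hK.lintegral_fst_le hA)
  rw [← lintegral_prod_swap]
  refine lintegral_congr_ae ?_
  filter_upwards [hK.symm] with z hz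
  simp [hz]

/-- Once `F` is dominated by a sum of functions of one variable, Tonelli and the marginal bound
suffice; symmetry of `K` supplies the bound for the other variable. -/
lemma SymmKernel.lintegral_mul_le {C : NNReal} {K : X → X → ℝ} (hK : SymmKernel μ C K)
    {A : X → ℝ≥0∞} (hA : AEMeasurable A μ) {F : X × X → ℝ} (hF : ∀ z, ‖F z‖ₑ ≤ A z.1 + A z.2) :
    ∫⁻ z, ‖K z.1 z.2 * F z‖ₑ ∂(μ.prod μ) ≤ 2 * C * ∫⁻ x, A x ∂μ := by
  calc ∫⁻ z, ‖K z.1 z.2 * F z‖ₑ ∂(μ.prod μ)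
      ≤ ∫⁻ z, (‖K z.1 z.2‖ₑ * A z.1 + ‖K z.1 z.2‖ₑ * A z.2) ∂(μ.prod μ) := by
        refine lintegral_mono fun z => ?_
        rw [enorm_mul, ← mul_add]
        gcongr
        exact hF z
    _ ≤ C * ∫⁻ x, A x ∂μ + C * ∫⁻ x, A x ∂μ := by
        rw [lintegral_add_left' (f := fun z : X × X => ‖K z.1 z.2‖ₑ * A z.1)
          (hK.aemeasurable_enorm.mul hA.comp_fst)]
        exact add_le_add (hK.lintegral_fst_le hA) (hK.lintegral_snd_le hA)
    _ = _ := by ring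

lemma SymmKernel.integrable_integrand {C : NNReal} {K : X → X → ℝ} (hK : SymmKernel μ C K)
    {φ : ℝ → ℝ} (hφ : Continuous φ) {u : X → ℝ} (hu : AEStronglyMeasurable u μ)
    {A : X → ℝ≥0∞} (hA : AEMeasurable A μ) (hA' : ∫⁻ x, A x ∂μ ≠ ∞)
    (hF : ∀ x y, ‖φ (u y - u x)‖ₑ ≤ A x + A y) :
    Integrable (integrand φ K u) (μ.prod μ) := by
  refine ⟨hK.aestronglyMeasurable_integrand hφ hu, ?_⟩
  refine (hK.lintegral_mul_le hA (F := fun z => φ (u z.2 - u z.1)) fun z => hF _ _).trans_lt ?_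
  exact ENNReal.mul_lt_top (by finiteness) hA'.lt_top

lemma enorm_rpow_growth {φ : ℝ → ℝ} {c r : ℝ} (hr : 0 ≤ r) (hc : 0 ≤ c)
    (hφ : ∀ s, |φ s| ≤ c * (1 + |s| ^ r)) (a b : ℝ) :
    ‖φ (b - a)‖ₑ ≤ ENNReal.ofReal (c * (1 + 2 ^ r * |a| ^ r))
      + ENNReal.ofReal (c * (1 + 2 ^ r * |b| ^ r)) := by
  rw [Real.enorm_eq_ofReal_abs, ← ENNReal.ofReal_add (by positivity) (by positivity)]
  refine ENNReal.ofReal_le_ofReal ((hφ _).trans ?_)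
  have := abs_sub_rpow_le hr a b
  nlinarith

lemma lintegral_growth_le {c r : ℝ} (hr : 0 < r) (hc : 0 ≤ c) {u : X → ℝ}
    {M : ℝ≥0∞} (hM : eLpNorm u (ENNReal.ofReal r) μ ≤ M) :
    ∫⁻ x, ENNReal.ofReal (c * (1 + 2 ^ r * |u x| ^ r)) ∂μ
      ≤ ENNReal.ofReal c * (μ univ + ENNReal.ofReal (2 ^ r) * M ^ r) := by
  have h1 : ∀ x, ENNReal.ofReal (c * (1 + 2 ^ r * |u x| ^ r))
      = ENNReal.ofReal c * (1 + ENNReal.ofReal (2 ^ r) * ‖u x‖ₑ ^ r) := fun x => by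
    rw [ENNReal.ofReal_mul hc, ENNReal.ofReal_add (by norm_num) (by positivity),
      ENNReal.ofReal_mul (by positivity), ENNReal.ofReal_one, Real.enorm_eq_ofReal_abs,
      ENNReal.ofReal_rpow_of_nonneg (abs_nonneg _) hr.le]
  simp_rw [h1]
  rw [lintegral_const_mul' _ _ (by simp), lintegral_add_left (by fun_prop),
    lintegral_const_mul' _ _ (by simp), lintegral_const, one_mul]
  gcongr
  rw [eLpNorm_eq_lintegral_rpow_enorm_toReal (by simpa using hr) (by simp),
    ENNReal.toReal_ofReal hr.le] at hM
  rw [← ENNReal.rpow_le_rpow_iff (z := 1 / r) (by positivity), ← ENNReal.rpow_mul,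
    mul_one_div_cancel hr.ne', ENNReal.rpow_one]
  exact hM

lemma SymmKernel.integrable_integrand_of_growth {C : NNReal} {K : X → X → ℝ}
    (hK : SymmKernel μ C K) {φ : ℝ → ℝ} (hφ : Continuous φ) {c r : ℝ} (hr : 0 < r) (hc : 0 ≤ c)
    (hφ' : ∀ s, |φ s| ≤ c * (1 + |s| ^ r)) {u : X → ℝ} (hu : MemLp u (ENNReal.ofReal r) μ) :
    Integrable (integrand φ K u) (μ.prod μ) := by
  refine hK.integrable_integrand hφ hu.1 (A := fun x => ENNReal.ofReal (c * (1 + 2 ^ r * |u x| ^ r)))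
    ?_ ?_ fun x y => enorm_rpow_growth hr.le hc hφ' _ _
  · have : AEMeasurable u μ := hu.1.aemeasurable
    fun_prop
  · refine ((lintegral_growth_le hr hc le_rfl).trans_lt ?_).ne
    have := hu.2
    finiteness

lemma SymmKernel.integrable_integrand_of_lipschitz {C : NNReal} {K : X → X → ℝ}
    (hK : SymmKernel μ C K) {φ : ℝ → ℝ} (hφ : Flux φ) {L : NNReal} (hL : LipschitzWith L φ)
    {u : X → ℝ} (hu : Integrable u μ) :
    Integrable (integrand φ K u) (μ.prod μ) := by
  refine hK.integrable_integrand hφ.continuous hu.1 (A := fun x => L * ‖u x‖ₑ)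
    (hu.1.enorm.const_mul _) ?_ fun x y => ?_
  · rw [lintegral_const_mul' _ _ (by simp)]
    exact ENNReal.mul_ne_top (by simp) hu.2.ne
  · have h0 : φ 0 = 0 := by
      have := hφ.odd 0
      rw [neg_zero] at this
      linarith
    have h := hL (u y - u x) 0
    rw [h0, edist_zero_right, edist_zero_right] at h
    refine h.trans ?_
    rw [← mul_add, add_comm]
    gcongr
    exact enorm_sub_le

/-- The nonlocal operator as a map on `L¹`. -/
def nonlocalL1 (μ : Measure X) [IsFiniteMeasure μ] (φ : ℝ → ℝ) (K : X → X → ℝ) (u : Lp ℝ 1 μ) :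
    Lp ℝ 1 μ :=
  open Classical in
  if h : Integrable (integrand φ K u) (μ.prod μ) then
    Integrable.toL1 (nonlocalOp μ φ K u) h.integral_prod_left
  else 0

lemma coeFn_nonlocalL1 {φ : ℝ → ℝ} {K : X → X → ℝ} {u : Lp ℝ 1 μ}
    (h : Integrable (integrand φ K u) (μ.prod μ)) :
    nonlocalL1 μ φ K u =ᵐ[μ] nonlocalOp μ φ K u := by
  rw [nonlocalL1, dif_pos h]
  exact Integrable.coeFn_toL1 _

lemma eLpNorm_nonlocalOp_sub_le {φ φ' : ℝ → ℝ} {K : X → X → ℝ} {u v : X → ℝ}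
    (hu : Integrable (integrand φ K u) (μ.prod μ))
    (hv : Integrable (integrand φ' K v) (μ.prod μ)) :
    eLpNorm (fun x => nonlocalOp μ φ K u x - nonlocalOp μ φ' K v x) 1 μ
      ≤ ∫⁻ z, ‖K z.1 z.2 * (φ (u z.2 - u z.1) - φ' (v z.2 - v z.1))‖ₑ ∂(μ.prod μ) := by
  have hm : AEStronglyMeasurable
      (fun z : X × X => K z.1 z.2 * (φ (u z.2 - u z.1) - φ' (v z.2 - v z.1))) (μ.prod μ) := by
    refine (hu.sub hv).1.congr (ae_of_all _ fun z => ?_)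
    simp [integrand, mul_sub]
  rw [eLpNorm_one_eq_lintegral_enorm, lintegral_prod _ hm.enorm]
  refine lintegral_mono_ae ?_
  filter_upwards [hu.prod_right_ae, hv.prod_right_ae] with x h1 h2
  have h3 : nonlocalOp μ φ K u x - nonlocalOp μ φ' K v x
      = ∫ y, K x y * (φ (u y - u x) - φ' (v y - v x)) ∂μ := by
    simp_rw [mul_sub]
    exact (integral_sub h1 h2).symm
  rw [h3]
  exact enorm_integral_le_lintegral_enorm _

lemma enorm_nonlocalL1_sub_le {φ φ' : ℝ → ℝ} {K : X → X → ℝ} {u v : Lp ℝ 1 μ}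
    (hu : Integrable (integrand φ K u) (μ.prod μ))
    (hv : Integrable (integrand φ' K v) (μ.prod μ)) :
    ‖nonlocalL1 μ φ K u - nonlocalL1 μ φ' K v‖ₑ
      ≤ ∫⁻ z, ‖K z.1 z.2 * (φ (u z.2 - u z.1) - φ' (v z.2 - v z.1))‖ₑ ∂(μ.prod μ) := by
  refine le_trans (le_of_eq ?_) (eLpNorm_nonlocalOp_sub_le hu hv)
  rw [Lp.enorm_def]
  refine eLpNorm_congr_ae ((Lp.coeFn_sub _ _).trans ?_)
  exact (coeFn_nonlocalL1 hu).sub (coeFn_nonlocalL1 hv)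

lemma SymmKernel.lipschitzWith_nonlocalL1 {C : NNReal} {K : X → X → ℝ}
    (hK : SymmKernel μ C K) {φ : ℝ → ℝ} (hφ : Flux φ) {L : NNReal} (hL : LipschitzWith L φ) :
    LipschitzWith (2 * C * L) (nonlocalL1 μ φ K) := by
  intro u v
  rw [edist_eq_enorm_sub, edist_eq_enorm_sub]
  have hu := hK.integrable_integrand_of_lipschitz hφ hL (L1.integrable_coeFn u)
  have hv := hK.integrable_integrand_of_lipschitz hφ hL (L1.integrable_coeFn v)
  refine (enorm_nonlocalL1_sub_le hu hv).trans ?_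
  have hw := (L1.integrable_coeFn u).sub (L1.integrable_coeFn v)
  refine (hK.lintegral_mul_le (A := fun x => L * ‖u x - v x‖ₑ) (hw.1.enorm.const_mul _)
    fun z => ?_).trans (le_of_eq ?_)
  · rw [← edist_eq_enorm_sub, ← mul_add]
    refine (hL _ _).trans ?_
    gcongr
    rw [edist_eq_enorm_sub, show u z.2 - u z.1 - (v z.2 - v z.1)
      = (u z.2 - v z.2) - (u z.1 - v z.1) by ring, add_comm]
    exact enorm_sub_le
  · rw [lintegral_const_mul' _ _ (by simp), Lp.enorm_def, eLpNorm_one_eq_lintegral_enorm,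
      ← mul_assoc]
    simp only [ENNReal.coe_mul, ENNReal.coe_ofNat]
    congr 1
    refine lintegral_congr_ae ?_
    filter_upwards [Lp.coeFn_sub u v] with x hx
    rw [hx, Pi.sub_apply]

lemma SymmKernel.lintegral_integrand_sub_le {C : NNReal} {K : X → X → ℝ}
    (hK : SymmKernel μ C K) {φ φ' : ℝ → ℝ} {e r : ℝ} (hr : 0 < r) (he : 0 ≤ e)
    (h : ∀ s, |φ s - φ' s| ≤ e * (1 + |s| ^ r)) {u : X → ℝ} (hu : AEStronglyMeasurable u μ)
    {M : ℝ≥0∞} (hM : eLpNorm u (ENNReal.ofReal r) μ ≤ M) :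
    ∫⁻ z, ‖K z.1 z.2 * (φ (u z.2 - u z.1) - φ' (u z.2 - u z.1))‖ₑ ∂(μ.prod μ)
      ≤ 2 * C * (ENNReal.ofReal e * (μ univ + ENNReal.ofReal (2 ^ r) * M ^ r)) := by
  refine (hK.lintegral_mul_le (A := fun x => ENNReal.ofReal (e * (1 + 2 ^ r * |u x| ^ r))) ?_
    fun z => ?_).trans ?_
  · have : AEMeasurable u μ := hu.aemeasurable
    fun_prop
  · exact enorm_rpow_growth (φ := fun s => φ s - φ' s) hr.le he h _ _
  · gcongr
    exact lintegral_growth_le hr he hM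

/-- The nonlocal operator is completely accretive. -/
lemma SymmKernel.integral_nonlocalOp_sub_nonpos {C : NNReal} {K : X → X → ℝ}
    (hK : SymmKernel μ C K) {φ : ℝ → ℝ} (hφ : Flux φ) {u v : X → ℝ}
    (hu : Integrable (integrand φ K u) (μ.prod μ))
    (hv : Integrable (integrand φ K v) (μ.prod μ)) (hw : AEStronglyMeasurable (fun x => u x - v x) μ)
    {j : ℝ → ℝ} (hj : Monotone j) {B : ℝ} (hB : ∀ s, |j s| ≤ B) :
    ∫ x, j (u x - v x) * (nonlocalOp μ φ K u x - nonlocalOp μ φ K v x) ∂μ ≤ 0 := by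
  set w : X → ℝ := fun x => u x - v x with hwdef
  set I : X × X → ℝ := fun z => integrand φ K u z - integrand φ K v z with hI
  have hIint : Integrable I (μ.prod μ) := hu.sub hv
  have hjw : AEStronglyMeasurable (fun x => j (w x)) μ :=
    (hj.measurable.comp_aemeasurable hw.aemeasurable).aestronglyMeasurable
  have hI1 : Integrable (fun z : X × X => j (w z.1) * I z) (μ.prod μ) :=
    hIint.bdd_mul hjw.comp_fst (ae_of_all _ fun z => (Real.norm_eq_abs _).trans_le (hB _))
  have hI2 : Integrable (fun z : X × X => j (w z.2) * I z) (μ.prod μ) :=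
    hIint.bdd_mul hjw.comp_snd (ae_of_all _ fun z => (Real.norm_eq_abs _).trans_le (hB _))
  have h1 : ∫ x, j (w x) * (nonlocalOp μ φ K u x - nonlocalOp μ φ K v x) ∂μ
      = ∫ z, j (w z.1) * I z ∂(μ.prod μ) := by
    rw [integral_prod _ hI1]
    refine integral_congr_ae ?_
    filter_upwards [hu.prod_right_ae, hv.prod_right_ae] with x hx1 hx2
    rw [integral_const_mul]
    congr 1
    exact (integral_sub hx1 hx2).symm
  -- Exchanging the variables changes the sign of `I`, because `K` is symmetric and `φ` is odd.
  -- Hence twice the integral in question is the integral of `(j(w(x)) - j(w(y))) I(x,y)`.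
  have hsym : ∀ᵐ z ∂(μ.prod μ), j (w z.2) * I z.swap = -(j (w z.2) * I z) := by
    filter_upwards [hK.symm] with z hz
    have e1 : u z.1 - u z.2 = -(u z.2 - u z.1) := by ring
    have e2 : v z.1 - v z.2 = -(v z.2 - v z.1) := by ring
    simp only [hI, integrand, Prod.fst_swap, Prod.snd_swap]
    rw [e1, e2, hφ.odd, hφ.odd, hz]
    ring
  have h2 : ∫ z, j (w z.1) * I z ∂(μ.prod μ) = -∫ z, j (w z.2) * I z ∂(μ.prod μ) := by
    rw [← integral_neg, ← integral_prod_swap]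
    exact integral_congr_ae hsym
  -- As `w(y) - w(x)` is the difference of `u(y) - u(x)` and `v(y) - v(x)`, monotonicity of `j` and
  -- `φ` gives both increments the same sign.
  have h3 : ∫ z, (j (w z.1) * I z - j (w z.2) * I z) ∂(μ.prod μ) ≤ 0 := by
    refine integral_nonpos_of_ae ?_
    filter_upwards [hK.nonneg] with z hz
    have : j (w z.1) * I z - j (w z.2) * I z
        = -(K z.1 z.2 * ((j (w z.2) - j (w z.1)) *
          (φ (u z.2 - u z.1) - φ (v z.2 - v z.1)))) := by
      simp only [hI, integrand]; ring
    rw [this]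
    refine neg_nonpos.2 (mul_nonneg hz ?_)
    rcases le_total (w z.1) (w z.2) with hle | hle
    · refine mul_nonneg (sub_nonneg.2 (hj hle)) (sub_nonneg.2 (hφ.monotone ?_))
      simp only [hwdef] at hle
      linarith
    · refine mul_nonneg_of_nonpos_of_nonpos (sub_nonpos.2 (hj hle))
        (sub_nonpos.2 (hφ.monotone ?_))
      simp only [hwdef] at hle
      linarith
  rw [integral_sub hI1 hI2] at h3
  rw [h1]
  linarith

end

section

/-! ### Estimates for absolutely continuous curves in `L¹` -/

lemma absolutelyContinuousOnInterval_of_dist_le {E F : Type*} [PseudoMetricSpace E]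
    [PseudoMetricSpace F] {f : ℝ → E} {g : ℝ → F} {a b C : ℝ} (hC : 0 ≤ C)
    (hf : AbsolutelyContinuousOnInterval f a b)
    (h : ∀ x ∈ uIcc a b, ∀ y ∈ uIcc a b, dist (g x) (g y) ≤ C * dist (f x) (f y)) :
    AbsolutelyContinuousOnInterval g a b := by
  rw [absolutelyContinuousOnInterval_iff] at hf ⊢
  intro ε hε
  obtain ⟨δ, hδ, H⟩ := hf (ε / (C + 1)) (by positivity)
  refine ⟨δ, hδ, fun I hI hI' => ?_⟩
  calc ∑ i ∈ Finset.range I.1, dist (g (I.2 i).1) (g (I.2 i).2)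
      ≤ ∑ i ∈ Finset.range I.1, C * dist (f (I.2 i).1) (f (I.2 i).2) :=
        Finset.sum_le_sum fun i hi => h _ (hI.1 i hi).1 _ (hI.1 i hi).2
    _ = C * ∑ i ∈ Finset.range I.1, dist (f (I.2 i).1) (f (I.2 i).2) := by rw [Finset.mul_sum]
    _ ≤ C * (ε / (C + 1)) := by gcongr; exact (H I hI hI').le
    _ < (C + 1) * (ε / (C + 1)) := by gcongr; linarith
    _ = ε := by field_simp

/-- The shift by `ε` keeps the argument away from `0`, where `x ^ (1 / q)` fails to be Lipschitz for
`q > 1`. -/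
lemma AbsolutelyContinuousOnInterval_rpow {N : ℝ → ℝ} {a b ε s : ℝ}
    (hN : AbsolutelyContinuousOnInterval N a b) (h0 : ∀ t, 0 ≤ N t) (hε : 0 < ε) :
    AbsolutelyContinuousOnInterval (fun t => (N t + ε) ^ s) a b := by
  obtain ⟨B, hB⟩ := hN.exists_bound
  have hC : ContDiffOn ℝ 1 (fun x : ℝ => x ^ s) (Icc ε (B + ε)) := fun x hx =>
    (Real.contDiffAt_rpow_const_of_ne (by linarith [hx.1])).contDiffWithinAt
  obtain ⟨L, hL⟩ := hC.exists_lipschitzOnWith one_ne_zero (convex_Icc _ _) isCompact_Icc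
  refine absolutelyContinuousOnInterval_of_dist_le L.2 hN fun x hx y hy => ?_
  have hm : ∀ t ∈ uIcc a b, N t + ε ∈ Icc ε (B + ε) := fun t ht =>
    ⟨by linarith [h0 t], by linarith [(le_abs_self _).trans (hB t ht)]⟩
  refine (hL.dist_le_mul _ (hm x hx) _ (hm y hy)).trans (le_of_eq ?_)
  simp [Real.dist_eq]

lemma ofReal_integral_le_lintegral {α : Type*} [MeasurableSpace α] {ν : Measure α} {h : α → ℝ}
    (hi : Integrable h ν) : ENNReal.ofReal (∫ x, h x ∂ν) ≤ ∫⁻ x, ENNReal.ofReal (h x) ∂ν := by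
  calc ENNReal.ofReal (∫ x, h x ∂ν) ≤ ENNReal.ofReal (∫ x, max (h x) 0 ∂ν) :=
        ENNReal.ofReal_le_ofReal (integral_mono hi hi.pos_part fun x => le_max_left _ _)
    _ = ∫⁻ x, ENNReal.ofReal (max (h x) 0) ∂ν :=
        ofReal_integral_eq_lintegral_ofReal hi.pos_part (ae_of_all _ fun x => le_max_right _ _)
    _ = _ := by simp [ENNReal.ofReal_max]

variable {X : Type*} [MeasurableSpace X] {μ : Measure X} [IsFiniteMeasure μ]

lemma exists_pairing {j : X → ℝ} (hj : AEStronglyMeasurable j μ) {B : ℝ} (hB : ∀ x, |j x| ≤ B) :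
    ∃ ℓ : Lp ℝ 1 μ →L[ℝ] ℝ, ∀ u, ℓ u = ∫ x, j x * u x ∂μ := by
  have hint : ∀ u : Lp ℝ 1 μ, Integrable (fun x => j x * u x) μ := fun u =>
    (L1.integrable_coeFn u).bdd_mul hj (ae_of_all _ fun x => (Real.norm_eq_abs _).trans_le (hB x))
  refine ⟨LinearMap.mkContinuous
    { toFun := fun u => ∫ x, j x * u x ∂μ
      map_add' := fun u v => ?_
      map_smul' := fun c u => ?_ } B fun u => ?_, fun u => rfl⟩
  · rw [← integral_add (hint u) (hint v)]
    refine integral_congr_ae ?_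
    filter_upwards [Lp.coeFn_add u v] with x hx
    rw [hx, Pi.add_apply, mul_add]
  · rw [RingHom.id_apply, smul_eq_mul, ← integral_const_mul]
    refine integral_congr_ae ?_
    filter_upwards [Lp.coeFn_smul c u] with x hx
    rw [hx, Pi.smul_apply, smul_eq_mul]
    ring
  · simp only [LinearMap.coe_mk, AddHom.coe_mk]
    rw [L1.norm_eq_integral_norm, ← integral_const_mul]
    refine (norm_integral_le_integral_norm _).trans ?_
    refine integral_mono (hint u).norm ((L1.integrable_coeFn u).norm.const_mul _) fun x => ?_
    simp only [norm_mul, Real.norm_eq_abs]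
    gcongr
    exact hB x

lemma integrable_truncPow {q k : ℝ} (hq : 1 ≤ q) (hk : 0 ≤ k) {u : X → ℝ} (hu : Integrable u μ) :
    Integrable (fun x => truncPow q k (u x)) μ := by
  refine (hu.norm.const_mul (q * k ^ (q - 1))).mono'
    ((continuous_truncPow hq hk).comp_aestronglyMeasurable hu.1) (ae_of_all _ fun x => ?_)
  have := abs_truncPow_sub_le hq hk (u x) 0
  simpa [truncPow_zero hq hk] using this

lemma dist_integral_truncPow_le {q k : ℝ} (hq : 1 ≤ q) (hk : 0 ≤ k) (u v : Lp ℝ 1 μ) :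
    dist (∫ x, truncPow q k (u x) ∂μ) (∫ x, truncPow q k (v x) ∂μ)
      ≤ q * k ^ (q - 1) * dist u v := by
  have hu := L1.integrable_coeFn u
  have hv := L1.integrable_coeFn v
  rw [dist_eq_norm, dist_eq_norm, ← integral_sub (integrable_truncPow hq hk hu)
    (integrable_truncPow hq hk hv), L1.norm_eq_integral_norm, ← integral_const_mul]
  refine (norm_integral_le_integral_norm _).trans ?_
  refine integral_mono_ae ((integrable_truncPow hq hk hu).sub (integrable_truncPow hq hk hv)).norm
    ((L1.integrable_coeFn (u - v)).norm.const_mul _) ?_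
  filter_upwards [Lp.coeFn_sub u v] with x hx
  rw [hx]
  exact abs_truncPow_sub_le hq hk _ _

/-- No differentiation under the integral is needed: the functional minus its supporting linear
functional at `W t`, evaluated along the curve, has a minimum at time `t`, so its derivative
vanishes there. Differentiability of the functional along the curve comes later, almost everywhere,
from absolute continuity. -/
lemma hasDerivAt_integral_truncPow {q k : ℝ} (hq : 1 ≤ q) (hk : 0 ≤ k) {W : ℝ → Lp ℝ 1 μ}
    {V : Lp ℝ 1 μ} {t : ℝ} (hW : HasDerivAt W V t)
    (hN : DifferentiableAt ℝ (fun τ => ∫ x, truncPow q k (W τ x) ∂μ) t) :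
    HasDerivAt (fun τ => ∫ x, truncPow q k (W τ x) ∂μ)
      (q * ∫ x, truncDual q k (W t x) * V x ∂μ) t := by
  have hWt := L1.integrable_coeFn (W t)
  have hjm : AEStronglyMeasurable (fun x => truncDual q k (W t x)) μ :=
    ((truncDual_monotone hq hk).measurable.comp_aemeasurable hWt.1.aemeasurable).aestronglyMeasurable
  obtain ⟨ℓ, hℓ⟩ := exists_pairing hjm fun x => truncDual_bound hq hk (W t x)
  have hd : HasDerivAt (fun τ => q * ℓ (W τ)) (q * ℓ V) t :=
    (ℓ.hasFDerivAt.comp_hasDerivAt t hW).const_mul q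
  have hmin : IsLocalMin (fun τ => (∫ x, truncPow q k (W τ x) ∂μ) - q * ℓ (W τ)) t := by
    refine Eventually.of_forall fun τ => ?_
    have hWτ := L1.integrable_coeFn (W τ)
    have hb : ∀ u : Lp ℝ 1 μ, Integrable (fun x => truncDual q k (W t x) * u x) μ := fun u =>
      (L1.integrable_coeFn u).bdd_mul hjm
        (ae_of_all _ fun x => (Real.norm_eq_abs _).trans_le (truncDual_bound hq hk (W t x)))
    simp only [hℓ]
    rw [← integral_const_mul, ← integral_const_mul,
      ← integral_sub (integrable_truncPow hq hk hWt) ((hb _).const_mul q),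
      ← integral_sub (integrable_truncPow hq hk hWτ) ((hb _).const_mul q)]
    refine integral_mono ((integrable_truncPow hq hk hWt).sub ((hb _).const_mul q))
      ((integrable_truncPow hq hk hWτ).sub ((hb _).const_mul q)) fun x => ?_
    have := truncPow_subgradient hq hk (W t x) (W τ x)
    simp only
    linarith
  have h0 := hmin.hasDerivAt_eq_zero (hN.hasDerivAt.sub hd)
  have h1 := hN.hasDerivAt
  rw [sub_eq_zero.1 h0, hℓ] at h1
  exact h1

/-- Hölder's inequality, with `|truncDual| ^ (q / (q - 1)) ≤ (min |w| k) ^ q ≤ truncPow`. The case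
`q = 1` is separate because the conjugate exponent is infinite. -/
lemma lintegral_truncDual_mul_le {q k : ℝ} (hq : 1 ≤ q) (hk : 0 ≤ k) {w F : X → ℝ}
    (hw : Integrable w μ) (hF : AEStronglyMeasurable F μ) :
    ∫⁻ x, ‖truncDual q k (w x) * F x‖ₑ ∂μ
      ≤ ENNReal.ofReal (∫ x, truncPow q k (w x) ∂μ) ^ (1 - 1 / q)
        * eLpNorm F (ENNReal.ofReal q) μ := by
  have hq0 : 0 < q := by linarith
  have hF' : eLpNorm F (ENNReal.ofReal q) μ = (∫⁻ x, ‖F x‖ₑ ^ q ∂μ) ^ (1 / q) := by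
    rw [eLpNorm_eq_lintegral_rpow_enorm_toReal (by simpa using hq0) (by simp),
      ENNReal.toReal_ofReal hq0.le]
  have hpt : ∀ x, ‖truncDual q k (w x)‖ₑ ≤ ENNReal.ofReal ((min |w x| k) ^ (q - 1)) := fun x => by
    rw [Real.enorm_eq_ofReal_abs]
    exact ENNReal.ofReal_le_ofReal (truncDual_abs_le hk _)
  rcases hq.eq_or_lt with rfl | hq1
  · rw [hF']
    simp only [div_one, sub_self, ENNReal.rpow_zero, one_mul, ENNReal.rpow_one]
    refine lintegral_mono fun x => ?_
    rw [enorm_mul]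
    refine (mul_le_mul_left (hpt x) _).trans (le_of_eq ?_)
    simp
  have hconj : (q / (q - 1)).HolderConjugate q := (Real.HolderConjugate.conjExponent hq1).symm
  have hjm : AEMeasurable (fun x => ‖truncDual q k (w x)‖ₑ) μ :=
    ((truncDual_monotone hq hk).measurable.comp_aemeasurable hw.1.aemeasurable).enorm
  have h := ENNReal.lintegral_mul_le_Lp_mul_Lq μ hconj hjm hF.enorm
  simp only [Pi.mul_apply] at h
  simp_rw [enorm_mul]
  rw [hF']
  refine h.trans ?_
  have he : 1 / (q / (q - 1)) = 1 - 1 / q := by field_simp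
  rw [he, ofReal_integral_eq_lintegral_ofReal (integrable_truncPow hq hk hw)
    (ae_of_all _ fun x => truncPow_nonneg hq hk _)]
  gcongr with x
  · rw [sub_nonneg, div_le_one hq0]; exact hq
  · have h0 : 0 ≤ min |w x| k := le_min (abs_nonneg _) hk
    have hqq : 0 ≤ q / (q - 1) := div_nonneg hq0.le (by linarith)
    calc ‖truncDual q k (w x)‖ₑ ^ (q / (q - 1))
        ≤ ENNReal.ofReal ((min |w x| k) ^ (q - 1)) ^ (q / (q - 1)) :=
          ENNReal.rpow_le_rpow (hpt x) hqq
      _ = ENNReal.ofReal ((min |w x| k) ^ q) := by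
          rw [ENNReal.ofReal_rpow_of_nonneg (by positivity) hqq, ← Real.rpow_mul h0,
            mul_div_cancel₀ _ (by linarith : q - 1 ≠ 0)]
      _ ≤ _ := ENNReal.ofReal_le_ofReal (min_rpow_le_truncPow hq hk _)

/-- The curve `W` has at time `t` a derivative `D + F` with `D` dissipative at `W t` and `F` of
`L^q` norm at most `B`. -/
def DissipativeAt (μ : Measure X) (q : ℝ) (W : ℝ → Lp ℝ 1 μ) (B : ℝ≥0∞) (t : ℝ) : Prop :=
  ∃ (V : Lp ℝ 1 μ) (D F : X → ℝ), HasDerivAt W V t ∧ (V =ᵐ[μ] fun x => D x + F x) ∧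
    Integrable D μ ∧
    (∀ j : ℝ → ℝ, Monotone j → (∃ b, ∀ s, |j s| ≤ b) → ∫ x, j (W t x) * D x ∂μ ≤ 0) ∧
    eLpNorm F (ENNReal.ofReal q) μ ≤ B

/-- With `N` the integral of `truncPow`, the dissipative part contributes nonpositively to `N'`, so
`N' ≤ q N ^ (1 - 1/q) ‖F‖_q`. The chain rule factor `(1/q) (N + ε) ^ (1/q - 1)` cancels all but
`‖F‖_q`. -/
lemma DissipativeAt.ofReal_deriv_le {q k ε : ℝ} (hq : 1 ≤ q) (hk : 0 ≤ k) (hε : 0 < ε)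
    {W : ℝ → Lp ℝ 1 μ} {B : ℝ≥0∞} {t : ℝ} (h : DissipativeAt μ q W B t)
    (hN : DifferentiableAt ℝ (fun τ => ∫ x, truncPow q k (W τ x) ∂μ) t) :
    ENNReal.ofReal (deriv (fun τ => ((∫ x, truncPow q k (W τ x) ∂μ) + ε) ^ (1 / q)) t) ≤ B := by
  obtain ⟨V, D, F, hV, hVeq, hD, hj, hF⟩ := h
  have hq0 : 0 < q := by linarith
  set N := fun τ => ∫ x, truncPow q k (W τ x) ∂μ with hNdef
  have hN0 : ∀ τ, 0 ≤ N τ := fun τ => integral_nonneg fun x => truncPow_nonneg hq hk _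
  have hpos : 0 < N t + ε := by linarith [hN0 t]
  have hWt := L1.integrable_coeFn (W t)
  have hFm : Integrable F μ := ((L1.integrable_coeFn V).sub hD).congr (by
    filter_upwards [hVeq] with x hx
    simp [hx])
  have hjm : AEStronglyMeasurable (fun x => truncDual q k (W t x)) μ :=
    ((truncDual_monotone hq hk).measurable.comp_aemeasurable hWt.1.aemeasurable).aestronglyMeasurable
  have hb : ∀ u : X → ℝ, Integrable u μ → Integrable (fun x => truncDual q k (W t x) * u x) μ :=
    fun u hu => hu.bdd_mul hjm
      (ae_of_all _ fun x => (Real.norm_eq_abs _).trans_le (truncDual_bound hq hk (W t x)))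
  have hder := ((hasDerivAt_integral_truncPow hq hk hV hN).add_const ε).rpow_const (p := 1 / q)
    (Or.inl hpos.ne')
  rw [hder.deriv]
  have hle : ∫ x, truncDual q k (W t x) * V x ∂μ ≤ ∫ x, truncDual q k (W t x) * F x ∂μ := by
    have h1 : ∫ x, truncDual q k (W t x) * V x ∂μ
        = ∫ x, truncDual q k (W t x) * D x ∂μ + ∫ x, truncDual q k (W t x) * F x ∂μ := by
      rw [← integral_add (hb D hD) (hb F hFm)]
      refine integral_congr_ae ?_
      filter_upwards [hVeq] with x hx
      rw [hx, mul_add]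
    have h2 := hj _ (truncDual_monotone hq hk) ⟨_, truncDual_bound hq hk⟩
    linarith
  have hc : 0 ≤ (N t + ε) ^ (1 / q - 1) := by positivity
  have h3 : q * (∫ x, truncDual q k (W t x) * V x ∂μ) * (1 / q) * (N t + ε) ^ (1 / q - 1)
      ≤ (N t + ε) ^ (1 / q - 1) * ∫ x, truncDual q k (W t x) * F x ∂μ := by
    have : q * (∫ x, truncDual q k (W t x) * V x ∂μ) * (1 / q) * (N t + ε) ^ (1 / q - 1)
      = (N t + ε) ^ (1 / q - 1) * ∫ x, truncDual q k (W t x) * V x ∂μ := by field_simp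
    rw [this]
    gcongr
  refine (ENNReal.ofReal_le_ofReal h3).trans ?_
  have hθ : 0 ≤ 1 - 1 / q := by rw [sub_nonneg, div_le_one hq0]; exact hq
  rw [ENNReal.ofReal_mul hc]
  calc ENNReal.ofReal ((N t + ε) ^ (1 / q - 1))
        * ENNReal.ofReal (∫ x, truncDual q k (W t x) * F x ∂μ)
      ≤ ENNReal.ofReal ((N t + ε) ^ (1 / q - 1))
        * (ENNReal.ofReal (N t) ^ (1 - 1 / q) * eLpNorm F (ENNReal.ofReal q) μ) := by
        gcongr
        refine le_trans ?_ (lintegral_truncDual_mul_le hq hk hWt hFm.1)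
        refine (ofReal_integral_le_lintegral (hb F hFm)).trans (lintegral_mono fun x => ?_)
        exact Real.ofReal_le_enorm _
    _ ≤ ENNReal.ofReal ((N t + ε) ^ (1 / q - 1))
        * (ENNReal.ofReal ((N t + ε) ^ (1 - 1 / q)) * eLpNorm F (ENNReal.ofReal q) μ) := by
        rw [ENNReal.ofReal_rpow_of_nonneg (hN0 t) hθ]
        gcongr
        · exact hN0 t
        · linarith
    _ = eLpNorm F (ENNReal.ofReal q) μ := by
        rw [← mul_assoc, ← ENNReal.ofReal_mul hc, ← Real.rpow_add hpos]
        simp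
    _ ≤ B := hF

/-- The derivative bound for `(N + ε) ^ (1/q)` is integrated with the fundamental theorem for
absolutely continuous functions, and then `ε → 0`. -/
lemma truncated_estimate {q k : ℝ} (hq : 1 ≤ q) (hk : 0 ≤ k) {a b : ℝ} (hab : a ≤ b)
    {W : ℝ → Lp ℝ 1 μ} (hW : AbsolutelyContinuousOnInterval W a b) {Φ : ℝ → ℝ≥0∞}
    (h : ∀ᵐ t ∂(volume.restrict (Ioo a b)), DissipativeAt μ q W (Φ t) t) :
    ENNReal.ofReal (∫ x, truncPow q k (W b x) ∂μ) ^ (1 / q)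
      ≤ ENNReal.ofReal (∫ x, truncPow q k (W a x) ∂μ) ^ (1 / q) + ∫⁻ t in Ioo a b, Φ t := by
  have hq0 : 0 < q := by linarith
  set N := fun τ => ∫ x, truncPow q k (W τ x) ∂μ with hNdef
  have hN0 : ∀ τ, 0 ≤ N τ := fun τ => integral_nonneg fun x => truncPow_nonneg hq hk _
  have hNac : AbsolutelyContinuousOnInterval N a b :=
    absolutelyContinuousOnInterval_of_dist_le (by positivity) hW fun x _ y _ =>
      dist_integral_truncPow_le hq hk _ _
  have key : ∀ ε : ℝ, 0 < ε → ENNReal.ofReal (N b + ε) ^ (1 / q)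
      ≤ ENNReal.ofReal (N a + ε) ^ (1 / q) + ∫⁻ t in Ioo a b, Φ t := by
    intro ε hε
    have hZ : AbsolutelyContinuousOnInterval (fun t => (N t + ε) ^ (1 / q)) a b :=
      AbsolutelyContinuousOnInterval_rpow hNac hN0 hε
    have hFTC := hZ.integral_deriv_eq_sub
    have hint := hZ.intervalIntegrable_deriv
    rw [intervalIntegral.integral_of_le hab, integral_Ioc_eq_integral_Ioo] at hFTC
    rw [intervalIntegrable_iff_integrableOn_Ioo_of_le hab] at hint
    have h1 : ENNReal.ofReal ((N b + ε) ^ (1 / q) - (N a + ε) ^ (1 / q))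
        ≤ ∫⁻ t in Ioo a b, Φ t := by
      rw [← hFTC]
      refine (ofReal_integral_le_lintegral hint).trans (lintegral_mono_ae ?_)
      have hdiff : ∀ᵐ t ∂(volume.restrict (Ioo a b)), DifferentiableAt ℝ N t := by
        rw [ae_restrict_iff' measurableSet_Ioo]
        filter_upwards [hNac.ae_differentiableAt] with t ht hmem
        exact ht (by rw [uIcc_of_le hab]; exact Ioo_subset_Icc_self hmem)
      filter_upwards [h, hdiff] with t ht hd
      exact ht.ofReal_deriv_le hq hk hε hd
    have hb0 : 0 ≤ N b + ε := by linarith [hN0 b]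
    have ha0 : 0 ≤ N a + ε := by linarith [hN0 a]
    rw [ENNReal.ofReal_rpow_of_nonneg hb0 (by positivity),
      ENNReal.ofReal_rpow_of_nonneg ha0 (by positivity)]
    calc ENNReal.ofReal ((N b + ε) ^ (1 / q))
        = ENNReal.ofReal ((N a + ε) ^ (1 / q) + ((N b + ε) ^ (1 / q) - (N a + ε) ^ (1 / q))) := by
          congr 1; ring
      _ ≤ _ := ENNReal.ofReal_add_le
      _ ≤ _ := by gcongr
  have hlim : ∀ c : ℝ, Tendsto (fun ε : ℝ => ENNReal.ofReal (c + ε) ^ (1 / q)) (𝓝[>] 0)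
      (𝓝 (ENNReal.ofReal c ^ (1 / q))) := fun c => by
    have : Continuous fun ε : ℝ => ENNReal.ofReal (c + ε) ^ (1 / q) :=
      ENNReal.continuous_rpow_const.comp
        (ENNReal.continuous_ofReal.comp (continuous_const.add continuous_id))
    have h2 := (this.tendsto 0).mono_left (nhdsWithin_le_nhds (s := Ioi 0))
    simpa using h2
  exact le_of_tendsto_of_tendsto (hlim _) ((hlim _).add_const _)
    (eventually_nhdsWithin_of_forall fun ε hε => key ε hε)

/-- Growth of the `L^q` norm along an absolutely continuous curve in `L¹`. -/
theorem eLpNorm_le_of_dissipative {q : ℝ} (hq : 1 ≤ q) {a b : ℝ} (hab : a ≤ b)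
    {W : ℝ → Lp ℝ 1 μ} (hW : AbsolutelyContinuousOnInterval W a b) {Φ : ℝ → ℝ≥0∞}
    (h : ∀ᵐ t ∂(volume.restrict (Ioo a b)), DissipativeAt μ q W (Φ t) t) :
    eLpNorm (W b) (ENNReal.ofReal q) μ
      ≤ eLpNorm (W a) (ENNReal.ofReal q) μ + ∫⁻ t in Ioo a b, Φ t := by
  have hq0 : 0 < q := by linarith
  have hnorm : ∀ u : X → ℝ, eLpNorm u (ENNReal.ofReal q) μ = (∫⁻ x, ‖u x‖ₑ ^ q ∂μ) ^ (1 / q) :=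
    fun u => by
    rw [eLpNorm_eq_lintegral_rpow_enorm_toReal (by simpa using hq0) (by simp),
      ENNReal.toReal_ofReal hq0.le]
  set R := eLpNorm (W a) (ENNReal.ofReal q) μ + ∫⁻ t in Ioo a b, Φ t with hR
  -- The bounds `(min |x| k) ^ q ≤ truncPow q k x ≤ |x| ^ q` turn the truncated estimate into one
  -- whose right side no longer depends on `k`.
  have hk : ∀ k : ℕ, ∫⁻ x, ENNReal.ofReal ((min |W b x| k) ^ q) ∂μ ≤ R ^ q := by
    intro k
    have hk0 : (0 : ℝ) ≤ k := Nat.cast_nonneg k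
    have h1 := truncated_estimate hq hk0 hab hW h
    have h2 : ENNReal.ofReal (∫ x, truncPow q k (W a x) ∂μ) ^ (1 / q)
        ≤ eLpNorm (W a) (ENNReal.ofReal q) μ := by
      rw [hnorm, ofReal_integral_eq_lintegral_ofReal
        (integrable_truncPow hq hk0 (L1.integrable_coeFn _))
        (ae_of_all _ fun x => truncPow_nonneg hq hk0 _)]
      gcongr with x
      rw [Real.enorm_eq_ofReal_abs, ENNReal.ofReal_rpow_of_nonneg (abs_nonneg _) hq0.le]
      exact ENNReal.ofReal_le_ofReal (truncPow_le hq hk0 _)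
    have h3 : ENNReal.ofReal (∫ x, truncPow q k (W b x) ∂μ) ≤ R ^ q := by
      have h4 := ENNReal.rpow_le_rpow (h1.trans (add_le_add_left h2 _)) hq0.le
      rwa [← ENNReal.rpow_mul, one_div_mul_cancel hq0.ne', ENNReal.rpow_one] at h4
    refine le_trans ?_ h3
    rw [ofReal_integral_eq_lintegral_ofReal
      (integrable_truncPow hq hk0 (L1.integrable_coeFn _))
      (ae_of_all _ fun x => truncPow_nonneg hq hk0 _)]
    exact lintegral_mono fun x => ENNReal.ofReal_le_ofReal (min_rpow_le_truncPow hq hk0 _)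
  -- Fatou's lemma as `k → ∞`: for each `x` the minimum is eventually `|W b x|`. Finiteness of the
  -- `L^q` norm is a conclusion here, not an assumption.
  have hfin : ∫⁻ x, ‖W b x‖ₑ ^ q ∂μ ≤ R ^ q := by
    have hm : ∀ k : ℕ, AEMeasurable (fun x => ENNReal.ofReal ((min |W b x| k) ^ q)) μ := fun k => by
      have : AEMeasurable (W b) μ := (L1.integrable_coeFn (W b)).1.aemeasurable
      have h2 : AEMeasurable (fun x => |W b x|) μ := this.abs
      exact ((h2.min aemeasurable_const).pow_const q).ennreal_ofReal
    calc ∫⁻ x, ‖W b x‖ₑ ^ q ∂μ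
        ≤ ∫⁻ x, liminf (fun k : ℕ => ENNReal.ofReal ((min |W b x| k) ^ q)) atTop ∂μ := by
          refine lintegral_mono fun x => ?_
          rw [Real.enorm_eq_ofReal_abs, ENNReal.ofReal_rpow_of_nonneg (abs_nonneg _) hq0.le]
          refine le_liminf_of_le ⟨⊤, by simp⟩ ?_
          obtain ⟨m, hm⟩ := exists_nat_ge |W b x|
          filter_upwards [eventually_ge_atTop m] with k hkm
          rw [min_eq_left (hm.trans (by exact_mod_cast hkm))]
      _ ≤ liminf (fun k : ℕ => ∫⁻ x, ENNReal.ofReal ((min |W b x| k) ^ q) ∂μ) atTop :=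
          lintegral_liminf_le' hm
      _ ≤ R ^ q := liminf_le_of_le (by isBoundedDefault) fun c hc => by
          obtain ⟨k, hk'⟩ := hc.exists
          exact hk'.trans (hk k)
  rw [hnorm]
  calc (∫⁻ x, ‖W b x‖ₑ ^ q ∂μ) ^ (1 / q) ≤ (R ^ q) ^ (1 / q) := by gcongr
    _ = R := by rw [← ENNReal.rpow_mul, mul_one_div_cancel hq0.ne', ENNReal.rpow_one]

end

section

/-! ### Ordinary differential equations with an integrable source -/

section ODE

variable {E : Type*} [NormedAddCommGroup E] [NormedSpace ℝ E] [CompleteSpace E]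

/-- Picard iteration on `C([0,T], E)`. The `n`-th iterate has Lipschitz constant `(LT)^n / n!`, so
some iterate is a contraction whatever the length of the interval. The integral form is used because
`h` is only integrable in time. -/
lemma exists_integral_equation {B : E → E} {L : NNReal} (hB : LipschitzWith L B) {T : ℝ}
    (hT : 0 ≤ T) {h : ℝ → E} (hh : IntervalIntegrable h volume 0 T) (g : E) :
    ∃ U : ℝ → E, ContinuousOn U (Icc 0 T) ∧
      ∀ t ∈ Icc 0 T, U t = g + ∫ s in (0 : ℝ)..t, (B (U s) + h s) := by
  let ext : C(Icc (0 : ℝ) T, E) → ℝ → E := fun α s => α (projIcc 0 T hT s)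
  have hext : ∀ α, Continuous (ext α) := fun α => α.continuous.comp continuous_projIcc
  have hBext : ∀ α, Continuous fun s => B (ext α s) := fun α => hB.continuous.comp (hext α)
  have hint : ∀ α, IntervalIntegrable (fun s => B (ext α s) + h s) volume 0 T := fun α =>
    ((hBext α).intervalIntegrable _ _).add hh
  have hcont : ∀ α, ContinuousOn (fun t => g + ∫ s in (0 : ℝ)..t, (B (ext α s) + h s))
      (Icc 0 T) := fun α => by
    refine continuousOn_const.add ?_
    have := intervalIntegral.continuousOn_primitive_interval (a := 0) (b := T)
      (by rw [uIcc_of_le hT]; exact (intervalIntegrable_iff_integrableOn_Icc_of_le hT).1 (hint α))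
    rwa [uIcc_of_le hT] at this
  let next : C(Icc (0 : ℝ) T, E) → C(Icc (0 : ℝ) T, E) := fun α =>
    ⟨fun t => g + ∫ s in (0 : ℝ)..t, (B (ext α s) + h s),
      (continuousOn_iff_continuous_domRestrict.1 (hcont α))⟩
  have hnext : ∀ α (t : Icc (0 : ℝ) T), next α t = g + ∫ s in (0 : ℝ)..t, (B (ext α s) + h s) :=
    fun _ _ => rfl
  -- The bound has to be pointwise in `t`: the factorial arises from integrating `s ^ n`.
  have hiter : ∀ (n : ℕ) (α β : C(Icc (0 : ℝ) T, E)) (t : Icc (0 : ℝ) T),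
      dist (next^[n] α t) (next^[n] β t) ≤ (L * t) ^ n / n.factorial * dist α β := by
    intro n α β
    induction n with
    | zero => intro t; simpa using ContinuousMap.dist_apply_le_dist t
    | succ n ih =>
      intro t
      rw [Function.iterate_succ_apply', Function.iterate_succ_apply', hnext, hnext, dist_add_left,
        dist_eq_norm]
      have hsub : uIcc 0 (t : ℝ) ⊆ uIcc 0 T := by
        rw [uIcc_of_le t.2.1, uIcc_of_le hT]; exact Icc_subset_Icc_right t.2.2
      rw [← intervalIntegral.integral_sub ((hint _).mono_set hsub) ((hint _).mono_set hsub)]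
      have hbd : ∀ s ∈ Icc 0 (t : ℝ), ‖(B (ext (next^[n] α) s) + h s)
          - (B (ext (next^[n] β) s) + h s)‖ ≤ L * ((L * s) ^ n / n.factorial * dist α β) := by
        intro s hs
        rw [add_sub_add_right_eq_sub, ← dist_eq_norm]
        refine (hB.dist_le_mul _ _).trans ?_
        gcongr
        have := ih ⟨s, hs.1, hs.2.trans t.2.2⟩
        simpa [ext, projIcc_of_mem hT ⟨hs.1, hs.2.trans t.2.2⟩] using this
      calc ‖∫ s in (0 : ℝ)..t, (B (ext (next^[n] α) s) + h s) - (B (ext (next^[n] β) s) + h s)‖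
          ≤ ∫ s in (0 : ℝ)..t, L * ((L * s) ^ n / n.factorial * dist α β) := by
            refine intervalIntegral.norm_integral_le_of_norm_le t.2.1
              (ae_of_all _ fun s hs => hbd s ⟨hs.1.le, hs.2⟩) ?_
            exact Continuous.intervalIntegrable (by fun_prop) _ _
        _ = (L * t) ^ (n + 1) / (n + 1).factorial * dist α β := by
            have : (fun s : ℝ => L * ((L * s) ^ n / n.factorial * dist α β))
                = fun s : ℝ => ((L : ℝ) ^ (n + 1) / n.factorial * dist α β) * s ^ n := by
              funext s; rw [mul_pow, pow_succ]; ring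
            rw [this, intervalIntegral.integral_const_mul, integral_pow, Nat.factorial_succ]
            push_cast
            field_simp
            ring
  obtain ⟨n, hn⟩ := (FloorSemiring.tendsto_pow_div_factorial_atTop (L * T)).eventually
    (gt_mem_nhds zero_lt_one) |>.exists
  have hLT : 0 ≤ (L * T) ^ n / (n.factorial : ℝ) := by positivity
  have hc : ContractingWith ⟨(L * T) ^ n / n.factorial, hLT⟩ next^[n] := by
    refine ⟨by exact_mod_cast hn, LipschitzWith.of_dist_le_mul fun α β => ?_⟩
    refine (ContinuousMap.dist_le (mul_nonneg hLT dist_nonneg)).2 fun t => ?_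
    refine (hiter n α β t).trans ?_
    refine mul_le_mul_of_nonneg_right ?_ dist_nonneg
    change _ ≤ (L * T) ^ n / (n.factorial : ℝ)
    have h0 := t.2.1
    have h1 := t.2.2
    gcongr
  have : Nonempty C(Icc (0 : ℝ) T, E) := ⟨0⟩
  have hfix := hc.isFixedPt_fixedPoint_iterate
  set α := ContractingWith.fixedPoint next^[n] hc
  refine ⟨ext α, (hext α).continuousOn, fun t ht => ?_⟩
  have h1 : next α ⟨t, ht⟩ = α ⟨t, ht⟩ := by rw [hfix]
  rw [hnext] at h1
  rw [h1]
  simp [ext, projIcc_of_mem hT ht]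

/-- The increments of `U` are controlled by those of the scalar primitive of `‖H‖`, which is
absolutely continuous. -/
lemma absolutelyContinuousOnInterval_of_eq_integral {T : ℝ} (hT : 0 ≤ T) {H : ℝ → E}
    (hH : IntervalIntegrable H volume 0 T) {g : E} {U : ℝ → E}
    (hU : ∀ t ∈ Icc 0 T, U t = g + ∫ s in (0 : ℝ)..t, H s) :
    AbsolutelyContinuousOnInterval U 0 T := by
  refine absolutelyContinuousOnInterval_of_dist_le (C := 1) zero_le_one
    (hH.norm.absolutelyContinuousOnInterval_intervalIntegral (c := 0) left_mem_uIcc)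
    fun x hx y hy => ?_
  have hsub : ∀ z ∈ uIcc 0 T, IntervalIntegrable H volume 0 z := fun z hz =>
    hH.mono_set (uIcc_subset_uIcc_left hz)
  have hx' := hx
  have hy' := hy
  rw [uIcc_of_le hT] at hx' hy'
  rw [hU x hx', hU y hy', dist_add_left, dist_eq_norm, one_mul, Real.dist_eq,
    intervalIntegral.integral_interval_sub_left (hsub x hx) (hsub y hy),
    intervalIntegral.integral_interval_sub_left (hsub x hx).norm (hsub y hy).norm]
  exact intervalIntegral.norm_integral_le_abs_integral_norm

lemma ae_hasDerivAt_of_eq_integral {T : ℝ} {H : ℝ → E}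
    (hH : IntervalIntegrable H volume 0 T) {g : E} {U : ℝ → E}
    (hU : ∀ t ∈ Icc 0 T, U t = g + ∫ s in (0 : ℝ)..t, H s) :
    ∀ᵐ t ∂(volume.restrict (Ioo 0 T)), HasDerivAt U (H t) t := by
  rw [ae_restrict_iff' measurableSet_Ioo]
  filter_upwards [hH.ae_hasDerivAt_integral] with t ht hmem
  have hT : 0 ≤ T := (hmem.1.trans hmem.2).le
  have h1 := (ht (by rw [uIcc_of_le hT]; exact Ioo_subset_Icc_self hmem) 0 left_mem_uIcc).const_add g
  refine h1.congr_of_eventuallyEq ?_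
  filter_upwards [Ioo_mem_nhds hmem.1 hmem.2] with s hs
  exact hU s (Ioo_subset_Icc_self hs)

end ODE

/-! ### Curves of integrable functions -/

/-- In a separable space the balls generate the Borel sets. For `L¹`-valued curves the distance to a
fixed element is an integral, and its measurability in time follows from Tonelli. -/
lemma measurable_of_measurable_dist {α E : Type*} [MeasurableSpace α] [PseudoMetricSpace E]
    [SecondCountableTopology E] [MeasurableSpace E] [BorelSpace E] {h : α → E}
    (hh : ∀ c, Measurable fun t => dist (h t) c) : Measurable h := by
  have hgen : ‹MeasurableSpace E› = MeasurableSpace.generateFrom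
      {s | ∃ c : E, ∃ r : ℝ, s = Metric.ball c r} := by
    rw [BorelSpace.measurable_eq (α := E)]
    refine (TopologicalSpace.IsTopologicalBasis.borel_eq_generateFrom ?_)
    refine TopologicalSpace.isTopologicalBasis_of_isOpen_of_nhds ?_ ?_
    · rintro s ⟨c, r, rfl⟩; exact Metric.isOpen_ball
    · intro a u ha hu
      obtain ⟨ε, hε, hs⟩ := Metric.isOpen_iff.1 hu a ha
      exact ⟨_, ⟨a, ε, rfl⟩, Metric.mem_ball_self hε, hs⟩
  rw [hgen]
  refine measurable_generateFrom ?_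
  rintro s ⟨c, r, rfl⟩
  exact measurableSet_lt (hh c) measurable_const

variable {X : Type*} [MeasurableSpace X] {μ : Measure X} [IsFiniteMeasure μ]

/-- Passes from a jointly measurable source to a Bochner integrable one. A countably generated
σ-algebra makes `L¹` separable, so only distances to fixed elements have to be shown measurable. -/
lemma exists_integrable_curve [MeasurableSpace.CountablyGenerated X] {ν : Measure ℝ}
    [IsFiniteMeasure ν] {f : ℝ → X → ℝ}
    (hf : AEStronglyMeasurable (Function.uncurry f) (ν.prod μ))
    (hfin : ∫⁻ t, eLpNorm (f t) 1 μ ∂ν ≠ ∞) :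
    ∃ h : ℝ → Lp ℝ 1 μ, Integrable h ν ∧ ∀ᵐ t ∂ν, h t =ᵐ[μ] f t := by
  obtain ⟨F, hF, hfF⟩ := hf
  have hae : ∀ᵐ t ∂ν, f t =ᵐ[μ] fun x => F (t, x) := Measure.ae_ae_of_ae_prod hfF
  have hFt : ∀ t, StronglyMeasurable fun x => F (t, x) := fun t =>
    hF.comp_measurable measurable_prodMk_left
  have hmeasS : MeasurableSet {t | Integrable (fun x => F (t, x)) μ} :=
    measurableSet_integrable (f := fun t x => F (t, x)) hF
  classical
  let h : ℝ → Lp ℝ 1 μ := fun t =>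
    if ht : Integrable (fun x => F (t, x)) μ then ht.toL1 else 0
  have hcoe : ∀ t, Integrable (fun x => F (t, x)) μ → h t =ᵐ[μ] fun x => F (t, x) := fun t ht => by
    simp only [h, dif_pos ht]
    exact ht.coeFn_toL1
  have hnorm : ∫⁻ t, eLpNorm (fun x => F (t, x)) 1 μ ∂ν ≠ ∞ := by
    refine ne_of_eq_of_ne (lintegral_congr_ae ?_) hfin
    filter_upwards [hae] with t ht
    exact eLpNorm_congr_ae ht.symm
  have hmn : Measurable fun t => eLpNorm (fun x => F (t, x)) 1 μ := by
    simp_rw [eLpNorm_one_eq_lintegral_enorm]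
    exact Measurable.lintegral_prod_right' (f := fun z => ‖F z‖ₑ) hF.enorm
  have hgood : ∀ᵐ t ∂ν, Integrable (fun x => F (t, x)) μ := by
    filter_upwards [ae_lt_top hmn hnorm] with t ht
    exact memLp_one_iff_integrable.1 ⟨(hFt t).aestronglyMeasurable, ht⟩
  have : Fact ((1 : ℝ≥0∞) ≠ ∞) := ⟨ENNReal.one_ne_top⟩
  have hm : Measurable[_, borel _] h := by
    let _ : MeasurableSpace (Lp ℝ 1 μ) := borel _
    have _ : BorelSpace (Lp ℝ 1 μ) := ⟨rfl⟩
    refine measurable_of_measurable_dist fun c => ?_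
    have hd : (fun t => dist (h t) c) = {t | Integrable (fun x => F (t, x)) μ}.piecewise
        (fun t => (∫⁻ x, ‖F (t, x) - c x‖ₑ ∂μ).toReal) (fun _ => dist 0 c) := by
      funext t
      by_cases ht : Integrable (fun x => F (t, x)) μ
      · rw [piecewise_eq_of_mem _ _ _ (by exact ht), Lp.dist_def, eLpNorm_one_eq_lintegral_enorm]
        congr 1
        refine lintegral_congr_ae ?_
        filter_upwards [hcoe t ht] with x hx
        simp [hx]
      · rw [piecewise_eq_of_notMem _ _ _ (by exact ht)]
        simp only [h, dif_neg ht]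
    rw [hd]
    refine Measurable.piecewise hmeasS ?_ measurable_const
    refine Measurable.ennreal_toReal ?_
    exact Measurable.lintegral_prod_right' (f := fun z : ℝ × X => ‖F z - c z.2‖ₑ)
      (hF.sub ((Lp.stronglyMeasurable c).comp_measurable measurable_snd)).enorm
  refine ⟨h, ⟨?_, ?_⟩, ?_⟩
  · let _ : MeasurableSpace (Lp ℝ 1 μ) := borel _
    have _ : BorelSpace (Lp ℝ 1 μ) := ⟨rfl⟩
    exact (hm : Measurable h).aestronglyMeasurable
  · refine lt_of_le_of_lt (lintegral_mono_ae ?_) hnorm.lt_top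
    filter_upwards [hgood] with t ht
    rw [Lp.enorm_def]
    exact (eLpNorm_congr_ae (hcoe t ht)).le
  · filter_upwards [hgood, hae] with t ht ht'
    exact (hcoe t ht).trans ht'.symm

end

section

/-! ### Solutions of the abstract evolution problem -/

variable {X : Type*} [MeasurableSpace X] {μ : Measure X} [IsFiniteMeasure μ]

/-- The curve `U` in `L¹(μ)` solves `U' = nonlocalOp μ φ K U + f` on `[0,T]`. -/
structure IsCurveSolution (μ : Measure X) (φ : ℝ → ℝ) (T : ℝ) (K : X → X → ℝ) (f : ℝ → X → ℝ)
    (U : ℝ → Lp ℝ 1 μ) : Prop where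
  ac : AbsolutelyContinuousOnInterval U 0 T
  eq : ∀ᵐ t ∂(volume.restrict (Ioo 0 T)), Integrable (integrand φ K (U t)) (μ.prod μ) ∧
    ∃ V : Lp ℝ 1 μ, HasDerivAt U V t ∧ V =ᵐ[μ] fun x => nonlocalOp μ φ K (U t) x + f t x

lemma restrict_Ioo_mono {T t : ℝ} (ht : t ≤ T) {P : ℝ → Prop}
    (h : ∀ᵐ s ∂(volume.restrict (Ioo 0 T)), P s) : ∀ᵐ s ∂(volume.restrict (Ioo 0 t)), P s :=
  ae_mono (Measure.restrict_mono (Ioo_subset_Ioo_right ht) le_rfl) h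

/-- Stability of solutions in `L^q` with respect to all data. -/
theorem IsCurveSolution.eLpNorm_sub_le {q : ℝ} (hq : 1 ≤ q) {C : NNReal} {φ φ' : ℝ → ℝ}
    {K K' : X → X → ℝ} {f f' : ℝ → X → ℝ} {T : ℝ} {U U' : ℝ → Lp ℝ 1 μ}
    (hK : SymmKernel μ C K) (hφ : Flux φ) (hU : IsCurveSolution μ φ T K f U)
    (hU' : IsCurveSolution μ φ' T K' f' U') {Φ : ℝ → ℝ≥0∞}
    (hint : ∀ᵐ t ∂(volume.restrict (Ioo 0 T)), Integrable (integrand φ K (U' t)) (μ.prod μ))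
    (hΦ : ∀ᵐ t ∂(volume.restrict (Ioo 0 T)),
      eLpNorm (fun x => (nonlocalOp μ φ K (U' t) x - nonlocalOp μ φ' K' (U' t) x)
        + (f t x - f' t x)) (ENNReal.ofReal q) μ ≤ Φ t) {t : ℝ} (ht : t ∈ Icc 0 T) :
    eLpNorm (fun x => U t x - U' t x) (ENNReal.ofReal q) μ
      ≤ eLpNorm (fun x => U 0 x - U' 0 x) (ENNReal.ofReal q) μ + ∫⁻ s in Ioo 0 t, Φ s := by
  have hT : 0 ≤ T := ht.1.trans ht.2
  have hac : AbsolutelyContinuousOnInterval (fun s => U s - U' s) 0 t :=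
    (hU.ac.sub hU'.ac).mono (by rw [uIcc_of_le ht.1, uIcc_of_le hT]; exact Icc_subset_Icc_right ht.2)
  have key : ∀ᵐ s ∂(volume.restrict (Ioo 0 t)), DissipativeAt μ q (fun s => U s - U' s) (Φ s) s := by
    filter_upwards [restrict_Ioo_mono ht.2 hU.eq, restrict_Ioo_mono ht.2 hU'.eq,
      restrict_Ioo_mono ht.2 hint, restrict_Ioo_mono ht.2 hΦ] with s h1 h2 h3 h4
    obtain ⟨hi1, V, hV, hVeq⟩ := h1
    obtain ⟨hi2, V', hV', hVeq'⟩ := h2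
    -- The operator of `U` evaluated at `U'` is subtracted and added. The difference of its values
    -- at `U` and `U'` is the dissipative part; what remains is the defect of `U'` in the equation
    -- of `U`, so nothing like accretivity is asked of `φ'` and `K'`.
    refine ⟨V - V', fun x => nonlocalOp μ φ K (U s) x - nonlocalOp μ φ K (U' s) x, _, hV.sub hV',
      ?_, hi1.integral_prod_left.sub h3.integral_prod_left, ?_, h4⟩
    · filter_upwards [Lp.coeFn_sub V V', hVeq, hVeq'] with x hx hx1 hx2
      rw [hx, Pi.sub_apply, hx1, hx2]
      ring
    · rintro j hj ⟨b, hb⟩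
      have hw := ((L1.integrable_coeFn (U s)).sub (L1.integrable_coeFn (U' s))).1
      refine le_trans (le_of_eq ?_) (hK.integral_nonlocalOp_sub_nonpos hφ hi1 h3 hw hj hb)
      refine integral_congr_ae ?_
      filter_upwards [Lp.coeFn_sub (U s) (U' s)] with x hx
      rw [hx, Pi.sub_apply]
  have h := eLpNorm_le_of_dissipative hq ht.1 hac key
  rwa [eLpNorm_congr_ae (Lp.coeFn_sub (U t) (U' t)),
    eLpNorm_congr_ae (Lp.coeFn_sub (U 0) (U' 0))] at h

lemma isCurveSolution_zero {φ : ℝ → ℝ} (hφ : Flux φ) (T : ℝ) (K : X → X → ℝ) :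
    IsCurveSolution μ φ T K (fun _ _ => 0) (fun _ => 0) := by
  have h0 : φ 0 = 0 := by
    have := hφ.odd 0
    rw [neg_zero] at this
    linarith
  have hz : (((0 : Lp ℝ 1 μ) : X → ℝ)) =ᵐ[μ] fun _ => (0 : ℝ) := Lp.coeFn_zero _ _ _
  refine ⟨?_, ae_of_all _ fun t => ⟨?_, 0, hasDerivAt_const _ _, ?_⟩⟩
  · exact (LipschitzWith.const (0 : Lp ℝ 1 μ)).lipschitzOnWith.absolutelyContinuousOnInterval
  · refine (integrable_zero _ _ _).congr ((integrand_congr hz).trans ?_).symm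
    exact ae_of_all _ fun z => by simp [integrand, h0]
  · filter_upwards [hz, nonlocalOp_congr (φ := φ) (K := K) hz] with x h1 h2
    rw [h1, h2]
    simp [nonlocalOp, h0]

lemma IsCurveSolution.eLpNorm_le {q : ℝ} (hq : 1 ≤ q) {C : NNReal} {φ : ℝ → ℝ}
    {K : X → X → ℝ} {f : ℝ → X → ℝ} {T : ℝ} {U : ℝ → Lp ℝ 1 μ}
    (hK : SymmKernel μ C K) (hφ : Flux φ) (hU : IsCurveSolution μ φ T K f U)
    {t : ℝ} (ht : t ∈ Icc 0 T) :
    eLpNorm (U t) (ENNReal.ofReal q) μ ≤ eLpNorm (U 0) (ENNReal.ofReal q) μ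
      + ∫⁻ s in Ioo 0 t, eLpNorm (f s) (ENNReal.ofReal q) μ := by
  have h0 : φ 0 = 0 := by
    have := hφ.odd 0
    rw [neg_zero] at this
    linarith
  have hz : (((0 : Lp ℝ 1 μ) : X → ℝ)) =ᵐ[μ] fun _ => (0 : ℝ) := Lp.coeFn_zero _ _ _
  have hint : Integrable (integrand φ K ((0 : Lp ℝ 1 μ) : X → ℝ)) (μ.prod μ) := by
    refine (integrable_zero _ _ _).congr ((integrand_congr hz).trans ?_).symm
    exact ae_of_all _ fun z => by simp [integrand, h0]
  have h := hU.eLpNorm_sub_le hq hK hφ (isCurveSolution_zero hφ T K)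
    (Φ := fun s => eLpNorm (f s) (ENNReal.ofReal q) μ)
    (ae_of_all _ fun _ => hint) (ae_of_all _ fun s => by simp) ht
  have hs : ∀ s, eLpNorm (fun x => U s x - ((0 : Lp ℝ 1 μ) : X → ℝ) x) (ENNReal.ofReal q) μ
      = eLpNorm (U s) (ENNReal.ofReal q) μ := fun s => eLpNorm_congr_ae (by
    filter_upwards [hz] with x hx
    rw [hx, sub_zero])
  rwa [hs, hs] at h

lemma abs_Psi_le_growth {p r : ℝ} (hp : 1 < p) (hr : p - 1 ≤ r) (s : ℝ) :
    |Psi p s| ≤ 1 * (1 + |s| ^ r) := by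
  rw [abs_Psi hp, one_mul]
  have hn : 0 ≤ |s| ^ r := Real.rpow_nonneg (abs_nonneg s) _
  rcases le_total |s| 1 with h | h
  · have := Real.rpow_le_one (abs_nonneg s) h (by linarith : 0 ≤ p - 1)
    linarith
  · have := Real.rpow_le_rpow_of_exponent_le h hr
    linarith

lemma SymmKernel.norm_nonlocalL1_sub_le {C : NNReal} {K : X → X → ℝ} (hK : SymmKernel μ C K)
    {φ φ' : ℝ → ℝ} {e r : ℝ} (hr : 0 < r) (he : 0 ≤ e)
    (h : ∀ s, |φ s - φ' s| ≤ e * (1 + |s| ^ r)) {u : Lp ℝ 1 μ}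
    (hu : Integrable (integrand φ K u) (μ.prod μ))
    (hu' : Integrable (integrand φ' K u) (μ.prod μ))
    {M : ℝ≥0∞} (hM : eLpNorm u (ENNReal.ofReal r) μ ≤ M) (hM' : M ≠ ∞) :
    ‖nonlocalL1 μ φ K u - nonlocalL1 μ φ' K u‖
      ≤ e * (2 * C * (μ univ + ENNReal.ofReal (2 ^ r) * M ^ r)).toReal := by
  have h1 := (enorm_nonlocalL1_sub_le hu hu').trans
    (hK.lintegral_integrand_sub_le hr he h (L1.integrable_coeFn u).1 hM)
  have hne : 2 * (C : ℝ≥0∞) * (ENNReal.ofReal e * (μ univ + ENNReal.ofReal (2 ^ r) * M ^ r)) ≠ ∞ := by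
    finiteness
  have h2 := ENNReal.toReal_mono hne h1
  rw [toReal_enorm] at h2
  refine h2.trans (le_of_eq ?_)
  rw [show 2 * (C : ℝ≥0∞) * (ENNReal.ofReal e * (μ univ + ENNReal.ofReal (2 ^ r) * M ^ r))
    = ENNReal.ofReal e * (2 * C * (μ univ + ENNReal.ofReal (2 ^ r) * M ^ r)) by ring,
    ENNReal.toReal_mul, ENNReal.toReal_ofReal he]

/-- An integral equation gives a solution. -/
lemma isCurveSolution_of_eq_integral {φ : ℝ → ℝ} {T : ℝ} (hT : 0 ≤ T) {K : X → X → ℝ}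
    {f : ℝ → X → ℝ} {h : ℝ → Lp ℝ 1 μ} (hh : IntervalIntegrable h volume 0 T)
    (hf : ∀ᵐ t ∂(volume.restrict (Icc 0 T)), h t =ᵐ[μ] f t) {U : ℝ → Lp ℝ 1 μ} {g : Lp ℝ 1 μ}
    (hB : IntervalIntegrable (fun s => nonlocalL1 μ φ K (U s)) volume 0 T)
    (hint : ∀ t ∈ Icc 0 T, Integrable (integrand φ K (U t)) (μ.prod μ))
    (hU : ∀ t ∈ Icc 0 T, U t = g + ∫ s in (0 : ℝ)..t, (nonlocalL1 μ φ K (U s) + h s)) :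
    IsCurveSolution μ φ T K f U := by
  refine ⟨absolutelyContinuousOnInterval_of_eq_integral hT (hB.add hh) hU, ?_⟩
  filter_upwards [ae_hasDerivAt_of_eq_integral (hB.add hh) hU,
    ae_mono (Measure.restrict_mono Ioo_subset_Icc_self le_rfl) hf,
    ae_restrict_mem measurableSet_Ioo] with t h1 h2 h3
  have hi := hint t (Ioo_subset_Icc_self h3)
  refine ⟨hi, _, h1, ?_⟩
  filter_upwards [Lp.coeFn_add (nonlocalL1 μ φ K (U t)) (h t), coeFn_nonlocalL1 hi, h2]
    with x hx hx1 hx2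
  rw [hx, Pi.add_apply, hx1, hx2]

/-- Lower semicontinuity of the norm, by Fatou along an almost everywhere convergent subsequence. -/
lemma eLpNorm_le_of_tendsto_L1 {q : ℝ≥0∞} {u : ℕ → Lp ℝ 1 μ} {v : Lp ℝ 1 μ}
    (h : Tendsto u atTop (𝓝 v)) {M : ℝ≥0∞} (hM : ∀ n, eLpNorm (u n) q μ ≤ M) :
    eLpNorm v q μ ≤ M := by
  have h1 := tendstoInMeasure_of_tendsto_Lp h
  obtain ⟨ns, -, hns⟩ := h1.exists_seq_tendsto_ae
  refine (Lp.eLpNorm_lim_le_liminf_eLpNorm (f := fun i => u (ns i))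
    (fun n => Lp.aestronglyMeasurable _) v hns).trans ?_
  exact liminf_le_of_le (by isBoundedDefault) fun c hc => by
    obtain ⟨k, hk'⟩ := hc.exists
    exact hk'.trans (hM _)

/-- The rate depends only on `e` and `c`, so applying this at each time separately gives convergence
uniform in time. -/
lemma exists_limit_of_dist_le {E : Type*} [MetricSpace E] [CompleteSpace E] {u : ℕ → E}
    {e : ℕ → ℝ} (he : Tendsto e atTop (𝓝 0)) {c : ℝ}
    (h : ∀ k m, dist (u k) (u m) ≤ (e k + e m) * c) :
    ∃ v, Tendsto u atTop (𝓝 v) ∧ ∀ k, dist (u k) v ≤ e k * c := by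
  have hcs : CauchySeq u := by
    rw [Metric.cauchySeq_iff]
    intro ε hε
    have h2 : Tendsto (fun k => e k * c) atTop (𝓝 0) := by simpa using he.mul_const c
    obtain ⟨N, hN⟩ := eventually_atTop.1 (h2.eventually (gt_mem_nhds (half_pos hε)))
    refine ⟨N, fun m hm n hn => (h m n).trans_lt ?_⟩
    have := hN m hm
    have := hN n hn
    linarith
  obtain ⟨v, hv⟩ := cauchySeq_tendsto_of_complete hcs
  refine ⟨v, hv, fun k => ?_⟩
  refine le_of_tendsto_of_tendsto' (tendsto_const_nhds.dist hv)
    ((tendsto_const_nhds.add he).mul_const c) (fun m => h k m) |>.trans (le_of_eq (by simp))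

/-- Existence of solutions for the nonlocal `p`-Laplacian. -/
theorem exists_isCurveSolution [MeasurableSpace.CountablyGenerated X] {C : NNReal}
    {K : X → X → ℝ} (hK : SymmKernel μ C K) {p r : ℝ} (hp : 1 < p) (hr1 : 1 ≤ r) (hr : p - 1 < r)
    {T : ℝ} (hT : 0 ≤ T) {f : ℝ → X → ℝ}
    (hf : AEStronglyMeasurable (Function.uncurry f) ((volume.restrict (Icc 0 T)).prod μ))
    (hfin : ∫⁻ t in Icc 0 T, eLpNorm (f t) (ENNReal.ofReal r) μ ≠ ∞)
    {g : X → ℝ} (hg : MemLp g (ENNReal.ofReal r) μ) :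
    ∃ U : ℝ → Lp ℝ 1 μ, IsCurveSolution μ (Psi p) T K f U ∧ U 0 =ᵐ[μ] g := by
  have hr0 : 0 < r := by linarith
  have h1r : (1 : ℝ≥0∞) ≤ ENNReal.ofReal r := by simpa using hr1
  obtain ⟨h, hhint, hhf⟩ : ∃ h : ℝ → Lp ℝ 1 μ, Integrable h (volume.restrict (Icc 0 T)) ∧
      ∀ᵐ t ∂(volume.restrict (Icc 0 T)), h t =ᵐ[μ] f t := by
    refine exists_integrable_curve hf (ne_top_of_le_ne_top ?_ (lintegral_mono_ae
      (g := fun t => eLpNorm (f t) (ENNReal.ofReal r) μ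
        * μ univ ^ (1 / (1 : ℝ≥0∞).toReal - 1 / (ENNReal.ofReal r).toReal)) ?_))
    · have hθ : 0 ≤ 1 / (1 : ℝ≥0∞).toReal - 1 / (ENNReal.ofReal r).toReal := by
        rw [ENNReal.toReal_one, ENNReal.toReal_ofReal hr0.le, div_one, sub_nonneg, div_le_one hr0]
        exact hr1
      rw [lintegral_mul_const' _ _ (by finiteness)]
      finiteness
    · filter_upwards [hf.prodMk_left] with t ht
      exact eLpNorm_le_eLpNorm_mul_rpow_measure_univ h1r ht
  have hh : IntervalIntegrable h volume 0 T :=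
    (intervalIntegrable_iff_integrableOn_Icc_of_le hT).2 hhint
  have hg1 : Integrable g μ := memLp_one_iff_integrable.1 (hg.mono_exponent h1r)
  set G : Lp ℝ 1 μ := hg1.toL1 with hG
  have hGg : G =ᵐ[μ] g := hg1.coeFn_toL1
  choose L hL using exists_lipschitzWith_PsiApprox hp
  set B : ℕ → Lp ℝ 1 μ → Lp ℝ 1 μ := fun k => nonlocalL1 μ (PsiApprox p k) K with hBdef
  have hBL : ∀ k, LipschitzWith (2 * C * L k) (B k) := fun k =>
    hK.lipschitzWith_nonlocalL1 (flux_PsiApprox hp k) (hL k)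
  choose U hUc hUeq using fun k => exists_integral_equation (hBL k) hT hh G
  have hik : ∀ k (u : Lp ℝ 1 μ), Integrable (integrand (PsiApprox p k) K u) (μ.prod μ) := fun k u =>
    hK.integrable_integrand_of_lipschitz (flux_PsiApprox hp k) (hL k) (L1.integrable_coeFn u)
  have hBUc : ∀ k, ContinuousOn (fun s => B k (U k s)) (Icc 0 T) := fun k =>
    (hBL k).continuous.comp_continuousOn (hUc k)
  have hsol : ∀ k, IsCurveSolution μ (PsiApprox p k) T K f (U k) := fun k =>
    isCurveSolution_of_eq_integral hT hh hhf
      ((hBUc k).intervalIntegrable_of_Icc hT) (fun t _ => hik k _) (hUeq k)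
  have hU0 : ∀ k, U k 0 = G := fun k => by
    rw [hUeq k 0 ⟨le_rfl, hT⟩, intervalIntegral.integral_same, add_zero]
  -- A bound in `L^r` for all approximate solutions and all times. It turns the weighted closeness
  -- of `PsiApprox` and `Psi` into closeness of the operators in `L¹`.
  set M : ℝ≥0∞ := eLpNorm g (ENNReal.ofReal r) μ
    + ∫⁻ t in Icc 0 T, eLpNorm (f t) (ENNReal.ofReal r) μ with hMdef
  have hM : M ≠ ∞ := ENNReal.add_ne_top.2 ⟨hg.2.ne, hfin⟩
  have hUM : ∀ k, ∀ t ∈ Icc 0 T, eLpNorm (U k t) (ENNReal.ofReal r) μ ≤ M := by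
    intro k t ht
    refine ((hsol k).eLpNorm_le hr1 hK (flux_PsiApprox hp k) ht).trans ?_
    rw [hU0, eLpNorm_congr_ae hGg, hMdef]
    gcongr
    exact Ioo_subset_Icc_self.trans (Icc_subset_Icc_right ht.2)
  set e := approxErr p r with hedef
  have he0 : ∀ k, 0 ≤ e k := approxErr_nonneg p r
  have he : Tendsto e atTop (𝓝 0) := tendsto_approxErr hp hr
  set E : ℝ := (2 * C * (μ univ + ENNReal.ofReal (2 ^ r) * M ^ r)).toReal with hE
  have hE0 : 0 ≤ E := ENNReal.toReal_nonneg
  have hdiff : ∀ k m s, |PsiApprox p k s - PsiApprox p m s| ≤ (e k + e m) * (1 + |s| ^ r) := by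
    intro k m s
    have h1 := abs_PsiApprox_sub_le hp hr k s
    have h2 := abs_PsiApprox_sub_le hp hr m s
    have h3 := abs_sub_le (PsiApprox p k s) (Psi p s) (PsiApprox p m s)
    rw [abs_sub_comm (Psi p s)] at h3
    rw [add_mul]
    linarith
  have hiP : ∀ u : Lp ℝ 1 μ, eLpNorm u (ENNReal.ofReal r) μ ≤ M →
      Integrable (integrand (Psi p) K u) (μ.prod μ) := fun u hu =>
    hK.integrable_integrand_of_growth (flux_Psi hp).continuous hr0 zero_le_one
      (abs_Psi_le_growth hp hr.le) ⟨(L1.integrable_coeFn u).1, hu.trans_lt hM.lt_top⟩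
  have hBB : ∀ k m (u : Lp ℝ 1 μ), eLpNorm u (ENNReal.ofReal r) μ ≤ M →
      ‖B k u - B m u‖ ≤ (e k + e m) * E := fun k m u hu =>
    hK.norm_nonlocalL1_sub_le hr0 (add_nonneg (he0 k) (he0 m)) (hdiff k m) (hik k u) (hik m u) hu hM
  have hBP : ∀ k (u : Lp ℝ 1 μ), eLpNorm u (ENNReal.ofReal r) μ ≤ M →
      ‖B k u - nonlocalL1 μ (Psi p) K u‖ ≤ e k * E := fun k u hu =>
    hK.norm_nonlocalL1_sub_le hr0 (he0 k) (abs_PsiApprox_sub_le hp hr k) (hik k u) (hiP u hu) hu hM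
  -- Stability with `q = 1`: `U m` has the same source and initial value as `U k`, and its defect in
  -- the problem with index `k` is the difference of the two operators at `U m`.
  have hcauchy : ∀ t ∈ Icc 0 T, ∀ k m, dist (U k t) (U m t) ≤ (e k + e m) * (E * T) := by
    intro t ht k m
    have hEn : 2 * (C : ℝ≥0∞) * (ENNReal.ofReal (e k + e m)
        * (μ univ + ENNReal.ofReal (2 ^ r) * M ^ r)) = ENNReal.ofReal ((e k + e m) * E) := by
      rw [ENNReal.ofReal_mul (add_nonneg (he0 k) (he0 m)), hE, ENNReal.ofReal_toReal (by finiteness)]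
      ring
    have h1 := (hsol k).eLpNorm_sub_le le_rfl hK (flux_PsiApprox hp k) (hsol m)
      (Φ := fun _ => ENNReal.ofReal ((e k + e m) * E)) (ae_of_all _ fun s => hik k _) (by
        filter_upwards [ae_restrict_mem measurableSet_Ioo] with s hs
        simp only [sub_self, add_zero, ENNReal.ofReal_one]
        refine (eLpNorm_nonlocalOp_sub_le (hik k _) (hik m _)).trans ?_
        rw [← hEn]
        exact hK.lintegral_integrand_sub_le hr0 (add_nonneg (he0 k) (he0 m)) (hdiff k m)
          (L1.integrable_coeFn _).1 (hUM m s (Ioo_subset_Icc_self hs))) ht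
    rw [hU0, hU0, setLIntegral_const, Real.volume_Ioo, sub_zero, ← ENNReal.ofReal_mul
      (mul_nonneg (add_nonneg (he0 k) (he0 m)) hE0)] at h1
    simp only [sub_self, eLpNorm_zero', zero_add, ENNReal.ofReal_one] at h1
    rw [Lp.dist_def]
    refine (ENNReal.toReal_le_of_le_ofReal ?_ h1).trans ?_
    · exact mul_nonneg (mul_nonneg (add_nonneg (he0 k) (he0 m)) hE0) ht.1
    · have := ht.2
      have := add_nonneg (he0 k) (he0 m)
      rw [mul_assoc]
      gcongr
  have hlim : ∀ t, ∃ v, t ∈ Icc 0 T → Tendsto (fun k => U k t) atTop (𝓝 v) ∧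
      ∀ k, dist (U k t) v ≤ e k * (E * T) := fun t => by
    by_cases ht : t ∈ Icc 0 T
    · obtain ⟨v, hv⟩ := exists_limit_of_dist_le he (hcauchy t ht)
      exact ⟨v, fun _ => hv⟩
    · exact ⟨0, fun h => absurd h ht⟩
  choose W hW using hlim
  have hWM : ∀ t ∈ Icc 0 T, eLpNorm (W t) (ENNReal.ofReal r) μ ≤ M := fun t ht =>
    eLpNorm_le_of_tendsto_L1 (hW t ht).1 fun k => hUM k t ht
  -- The Lipschitz constants of `B k` need not be bounded in `k`, so `B k (U k)` is compared with
  -- the limit through a fixed `B j`: first `j` is chosen to make the approximation errors small,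
  -- then `k` is taken large relative to the Lipschitz constant of `B j`.
  have hunif : TendstoUniformlyOn (fun k s => B k (U k s)) (fun s => nonlocalL1 μ (Psi p) K (W s))
      atTop (Icc 0 T) := by
    rw [Metric.tendstoUniformlyOn_iff]
    intro ε hε
    have hlimE : Tendsto (fun j => 2 * (e j * E)) atTop (𝓝 0) := by
      simpa using (he.mul_const E).const_mul 2
    obtain ⟨j, hj⟩ := (hlimE.eventually (gt_mem_nhds (half_pos hε))).exists
    have hlimk : Tendsto (fun k => e k * E + (2 * C * L j : NNReal) * (e k * (E * T))) atTop
        (𝓝 0) := by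
      simpa using (he.mul_const E).add ((he.mul_const (E * T)).const_mul ((2 * C * L j : NNReal) : ℝ))
    filter_upwards [hlimk.eventually (gt_mem_nhds (half_pos hε))] with k hk s hs
    have h1 := hBB k j (U k s) (hUM k s hs)
    have h2 := (hBL j).dist_le_mul (U k s) (W s)
    have h3 := hBP j (W s) (hWM s hs)
    have h4 := (hW s hs).2 k
    rw [← dist_eq_norm] at h1 h3
    have h5 := dist_triangle4 (B k (U k s)) (B j (U k s)) (B j (W s)) (nonlocalL1 μ (Psi p) K (W s))
    have h6 : (2 * C * L j : NNReal) * dist (U k s) (W s)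
        ≤ (2 * C * L j : NNReal) * (e k * (E * T)) := by gcongr
    rw [dist_comm]
    linarith
  have hBWc : ContinuousOn (fun s => nonlocalL1 μ (Psi p) K (W s)) (Icc 0 T) :=
    hunif.continuousOn (Eventually.of_forall hBUc).frequently
  have hBWi := hBWc.intervalIntegrable_of_Icc (μ := volume) hT
  refine ⟨W, isCurveSolution_of_eq_integral (g := G) hT hh hhf hBWi
    (fun t ht => hiP _ (hWM t ht)) fun t ht => ?_, ?_⟩
  · have hsub : uIcc 0 t ⊆ uIcc 0 T := by
      rw [uIcc_of_le ht.1, uIcc_of_le hT]; exact Icc_subset_Icc_right ht.2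
    have hint : Tendsto (fun k => ∫ s in (0 : ℝ)..t, (B k (U k s) + h s)) atTop
        (𝓝 (∫ s in (0 : ℝ)..t, (nonlocalL1 μ (Psi p) K (W s) + h s))) := by
      rw [Metric.tendsto_nhds]
      intro ε hε
      have hε' : 0 < ε / (T + 1) := by positivity
      filter_upwards [Metric.tendstoUniformlyOn_iff.1 hunif _ hε'] with k hk
      rw [dist_eq_norm, ← intervalIntegral.integral_sub
        ((((hBUc k).intervalIntegrable_of_Icc hT).add hh).mono_set hsub)
        ((hBWi.add hh).mono_set hsub)]
      refine lt_of_le_of_lt (intervalIntegral.norm_integral_le_of_norm_le_const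
        (C := ε / (T + 1)) fun s hs => ?_) ?_
      · rw [add_sub_add_right_eq_sub, ← dist_eq_norm, dist_comm]
        rw [uIoc_of_le ht.1] at hs
        exact (hk s ⟨hs.1.le, hs.2.trans ht.2⟩).le
      · rw [sub_zero, abs_of_nonneg ht.1, div_mul_eq_mul_div, div_lt_iff₀ (by linarith)]
        nlinarith [ht.2]
    refine tendsto_nhds_unique (hW t ht).1 ?_
    simp_rw [fun k => hUeq k t ht]
    exact hint.const_add G
  · have : W 0 = G := tendsto_nhds_unique (hW 0 ⟨le_rfl, hT⟩).1 (by simp_rw [hU0]; exact tendsto_const_nhds)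
    rw [this]
    exact hGg

end

section

/-! ### Bounds in `L²` and `L^∞` -/

variable {X : Type*} [MeasurableSpace X] {μ : Measure X}

/-- The `L²` norm of `|u| ^ (p-1)` is a power of the `L^{2(p-1)}` norm of `u`, and norms on a
probability space increase with the exponent. -/
lemma eLpNorm_rpow_two_le [IsProbabilityMeasure μ] {p r : ℝ} (hp : 1 < p) (hr : 2 * (p - 1) ≤ r)
    {u : X → ℝ} (hu : AEStronglyMeasurable u μ) :
    eLpNorm (fun x => |u x| ^ (p - 1)) 2 μ ≤ eLpNorm u (ENNReal.ofReal r) μ ^ (p - 1) := by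
  have h := eLpNorm_norm_rpow (μ := μ) (p := 2) u (by linarith : 0 < p - 1)
  simp only [Real.norm_eq_abs] at h
  rw [h]
  refine ENNReal.rpow_le_rpow (eLpNorm_le_eLpNorm_of_exponent_le ?_ hu) (by linarith)
  rw [show (2 : ℝ≥0∞) = ENNReal.ofReal 2 by simp, ← ENNReal.ofReal_mul (by norm_num)]
  exact ENNReal.ofReal_le_ofReal hr

lemma enorm_Psi_sub_le {p : ℝ} (hp : 1 < p) (a b : ℝ) :
    ‖Psi p (b - a)‖ₑ
      ≤ ENNReal.ofReal (2 ^ (p - 1)) * (‖|b| ^ (p - 1)‖ₑ + ‖|a| ^ (p - 1)‖ₑ) := by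
  have ha : 0 ≤ |a| ^ (p - 1) := by positivity
  have hb : 0 ≤ |b| ^ (p - 1) := by positivity
  rw [Real.enorm_eq_ofReal ha, Real.enorm_eq_ofReal hb, ← ENNReal.ofReal_add hb ha,
    ← ENNReal.ofReal_mul (by positivity), Real.enorm_eq_ofReal_abs, abs_Psi hp]
  exact ENNReal.ofReal_le_ofReal (abs_sub_rpow_le (by linarith) _ _)

/-- Let `v = |u| ^ (p-1)`, so that `|Ψ(u(y) - u(x))|` is at most `2 ^ (p-1) (v(y) + v(x))`. The term
`v(y)` is treated by Cauchy–Schwarz in `y`. The term `v(x)` leaves `‖A(x,·)‖₁ v(x)`, and as `v` is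
only in `L²`, a bound on `A(x,·)` uniform in `x` is required. -/
lemma eLpNorm_nonlocalOp_le [IsProbabilityMeasure μ] {p : ℝ} (hp : 1 < p) {A : X → X → ℝ}
    (hA : AEStronglyMeasurable (Function.uncurry A) (μ.prod μ)) {κ : ℝ≥0∞} (hκ : κ ≠ ∞)
    (hAκ : ∀ᵐ x ∂μ, eLpNorm (A x) 2 μ ≤ κ) {u : X → ℝ} (hu : AEStronglyMeasurable u μ)
    (huN : eLpNorm (fun x => |u x| ^ (p - 1)) 2 μ ≠ ∞) :
    eLpNorm (nonlocalOp μ (Psi p) A u) 2 μ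
      ≤ ENNReal.ofReal (2 ^ (p - 1)) * κ * (2 * eLpNorm (fun x => |u x| ^ (p - 1)) 2 μ) := by
  set v : X → ℝ := fun x => |u x| ^ (p - 1) with hv
  set N := eLpNorm v 2 μ with hN
  have hvm : AEStronglyMeasurable v μ := by
    have : AEMeasurable u μ := hu.aemeasurable
    exact (this.abs.pow_const _).aestronglyMeasurable
  set c : ℝ := (ENNReal.ofReal (2 ^ (p - 1)) * κ).toReal with hc
  have hcne : ENNReal.ofReal (2 ^ (p - 1)) * κ ≠ ∞ := by finiteness
  have hpt : ∀ᵐ x ∂μ, ‖nonlocalOp μ (Psi p) A u x‖ₑ ≤ ‖c • (N.toReal + v x)‖ₑ := by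
    filter_upwards [hAκ, hA.prodMk_left] with x hx hxm
    have hxm' : AEStronglyMeasurable (A x) μ := hxm
    have hcs : ∫⁻ y, ‖A x y‖ₑ * ‖v y‖ₑ ∂μ ≤ κ * N := by
      have h2 : Real.HolderConjugate 2 2 := by constructor <;> norm_num
      refine (ENNReal.lintegral_mul_le_Lp_mul_Lq μ h2 hxm'.enorm hvm.enorm).trans ?_
      have e : ∀ w : X → ℝ, (∫⁻ y, ‖w y‖ₑ ^ (2 : ℝ) ∂μ) ^ (1 / (2 : ℝ)) = eLpNorm w 2 μ :=
        fun w => by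
        rw [eLpNorm_eq_lintegral_rpow_enorm_toReal (by norm_num) (by norm_num)]
        simp
      rw [e, e]
      gcongr
    have h1 : ∫⁻ y, ‖A x y‖ₑ ∂μ ≤ κ := by
      rw [← eLpNorm_one_eq_lintegral_enorm]
      exact (eLpNorm_le_eLpNorm_of_exponent_le (by norm_num) hxm').trans hx
    have hv0 : 0 ≤ v x := by positivity
    have hrhs : ‖c • (N.toReal + v x)‖ₑ
        = ENNReal.ofReal (2 ^ (p - 1)) * κ * (N + ‖v x‖ₑ) := by
      rw [smul_eq_mul, enorm_mul, Real.enorm_eq_ofReal ENNReal.toReal_nonneg,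
        ENNReal.ofReal_toReal hcne, Real.enorm_eq_ofReal (add_nonneg ENNReal.toReal_nonneg hv0),
        ENNReal.ofReal_add ENNReal.toReal_nonneg hv0, ENNReal.ofReal_toReal huN,
        Real.enorm_eq_ofReal hv0]
    rw [hrhs]
    calc ‖nonlocalOp μ (Psi p) A u x‖ₑ
        ≤ ∫⁻ y, ‖A x y * Psi p (u y - u x)‖ₑ ∂μ := enorm_integral_le_lintegral_enorm _
      _ ≤ ∫⁻ y, ENNReal.ofReal (2 ^ (p - 1)) * (‖A x y‖ₑ * ‖v y‖ₑ + ‖A x y‖ₑ * ‖v x‖ₑ) ∂μ := by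
          refine lintegral_mono fun y => ?_
          rw [enorm_mul]
          refine (mul_le_mul_right (enorm_Psi_sub_le hp (u x) (u y)) _).trans (le_of_eq ?_)
          ring
      _ = ENNReal.ofReal (2 ^ (p - 1))
          * (∫⁻ y, ‖A x y‖ₑ * ‖v y‖ₑ ∂μ + (∫⁻ y, ‖A x y‖ₑ ∂μ) * ‖v x‖ₑ) := by
          rw [lintegral_const_mul' _ _ (by simp), lintegral_add_left'
            (f := fun y => ‖A x y‖ₑ * ‖v y‖ₑ) (hxm'.enorm.mul hvm.enorm), lintegral_mul_const' _ _ (by simp)]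
      _ ≤ ENNReal.ofReal (2 ^ (p - 1)) * (κ * N + κ * ‖v x‖ₑ) := by gcongr
      _ = _ := by ring
  refine (eLpNorm_mono_enorm_ae hpt).trans ?_
  have hsm : (fun x => c • (N.toReal + v x)) = c • (fun x => N.toReal + v x) := rfl
  rw [hsm, eLpNorm_const_smul, Real.enorm_eq_ofReal ENNReal.toReal_nonneg,
    ENNReal.ofReal_toReal hcne]
  gcongr
  refine (eLpNorm_add_le (f := fun _ => N.toReal) (g := v) aestronglyMeasurable_const hvm
    (by norm_num)).trans ?_
  rw [eLpNorm_const _ (by norm_num) (NeZero.ne μ), measure_univ, ENNReal.one_rpow, mul_one,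
    Real.enorm_eq_ofReal ENNReal.toReal_nonneg, ENNReal.ofReal_toReal huN, two_mul]

/-- For bounded `u` the factor `Ψ(u(y) - u(x))` comes out of the integral as `(2B) ^ (p-1)`, so the
kernel need only be measured in `L²` of the product. -/
lemma eLpNorm_nonlocalOp_le_of_bounded [IsProbabilityMeasure μ] {p : ℝ} (hp : 1 < p)
    {A : X → X → ℝ} (hA : AEStronglyMeasurable (Function.uncurry A) (μ.prod μ)) {u : X → ℝ}
    {B : ℝ} (hu : ∀ᵐ x ∂μ, |u x| ≤ B) :
    eLpNorm (nonlocalOp μ (Psi p) A u) 2 μ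
      ≤ ENNReal.ofReal ((2 * B) ^ (p - 1)) * eLpNorm (Function.uncurry A) 2 (μ.prod μ) := by
  set c := ENNReal.ofReal ((2 * B) ^ (p - 1)) with hc
  have hpt : ∀ᵐ x ∂μ, ‖nonlocalOp μ (Psi p) A u x‖ₑ ≤ c * eLpNorm (A x) 2 μ := by
    filter_upwards [hu, hA.prodMk_left] with x hx hxm
    have hxm' : AEStronglyMeasurable (A x) μ := hxm
    calc ‖nonlocalOp μ (Psi p) A u x‖ₑ
        ≤ ∫⁻ y, ‖A x y * Psi p (u y - u x)‖ₑ ∂μ := enorm_integral_le_lintegral_enorm _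
      _ ≤ ∫⁻ y, c * ‖A x y‖ₑ ∂μ := by
          refine lintegral_mono_ae ?_
          filter_upwards [hu] with y hy
          rw [enorm_mul, mul_comm]
          gcongr
          rw [Real.enorm_eq_ofReal_abs, abs_Psi hp]
          refine ENNReal.ofReal_le_ofReal (Real.rpow_le_rpow (abs_nonneg _) ?_ (by linarith))
          have := abs_sub (u y) (u x)
          linarith
      _ = c * eLpNorm (A x) 1 μ := by
          rw [lintegral_const_mul' _ _ (by simp [hc]), eLpNorm_one_eq_lintegral_enorm]
      _ ≤ c * eLpNorm (A x) 2 μ := by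
          gcongr
          exact eLpNorm_le_eLpNorm_of_exponent_le (by norm_num) hxm'
  have e : ∀ {Y : Type _} [MeasurableSpace Y] (ν : Measure Y) (w : Y → ℝ),
      eLpNorm w 2 ν = (∫⁻ y, ‖w y‖ₑ ^ (2 : ℝ) ∂ν) ^ (1 / (2 : ℝ)) := fun ν w => by
    rw [eLpNorm_eq_lintegral_rpow_enorm_toReal (by norm_num) (by norm_num)]
    simp
  have e2 : ∀ x, eLpNorm (A x) 2 μ ^ (2 : ℝ) = ∫⁻ y, ‖A x y‖ₑ ^ (2 : ℝ) ∂μ := fun x => by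
    rw [e, ← ENNReal.rpow_mul]; simp
  rw [e μ, eLpNorm_eq_lintegral_rpow_enorm_toReal (by norm_num) (by norm_num)]
  simp only [ENNReal.toReal_ofNat]
  calc (∫⁻ x, ‖nonlocalOp μ (Psi p) A u x‖ₑ ^ (2 : ℝ) ∂μ) ^ (1 / (2 : ℝ))
      ≤ (∫⁻ x, c ^ (2 : ℝ) * ∫⁻ y, ‖A x y‖ₑ ^ (2 : ℝ) ∂μ ∂μ) ^ (1 / (2 : ℝ)) := by
        refine ENNReal.rpow_le_rpow (lintegral_mono_ae ?_) (by norm_num)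
        filter_upwards [hpt] with x hx
        rw [← e2, ← ENNReal.mul_rpow_of_nonneg _ _ (by norm_num : (0 : ℝ) ≤ 2)]
        gcongr
    _ = c * (∫⁻ z, ‖Function.uncurry A z‖ₑ ^ (2 : ℝ) ∂(μ.prod μ)) ^ (1 / (2 : ℝ)) := by
        rw [lintegral_const_mul' _ _ (by simp [hc]), ENNReal.mul_rpow_of_nonneg _ _ (by norm_num),
          ← ENNReal.rpow_mul, lintegral_prod _ (hA.enorm.pow_const _)]
        simp

/-- By Chebyshev the set where `|u| ≥ b` has measure at most `(M / b) ^ (n + 1)` for every `n`,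
hence zero if `b > M`. -/
lemma eLpNorm_top_le [IsProbabilityMeasure μ] {u : X → ℝ} (hu : AEStronglyMeasurable u μ)
    {M : ℝ≥0∞} (h : ∀ n : ℕ, eLpNorm u (ENNReal.ofReal (n + 1)) μ ≤ M) : eLpNorm u ∞ μ ≤ M := by
  rw [eLpNorm_exponent_top]
  refine le_of_forall_gt fun c hc => ?_
  obtain ⟨b, hMb, hbc⟩ := exists_between hc
  refine lt_of_le_of_lt (eLpNormEssSup_le_of_ae_enorm_bound ?_) hbc
  have hbt : b ≠ ∞ := (hbc.trans_le le_top).ne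
  have hb0 : b ≠ 0 := (zero_le.trans_lt hMb).ne'
  have hk : ∀ n : ℕ, μ {x | b ≤ ‖u x‖ₑ} ≤ (M / b) ^ (n + 1) := fun n => by
    have h1 := mul_meas_ge_le_pow_eLpNorm' μ (p := ENNReal.ofReal (n + 1))
      (by simp; positivity) (by simp) hu b
    have h2 : (ENNReal.ofReal ((n : ℝ) + 1)).toReal = ((n + 1 : ℕ) : ℝ) := by
      rw [ENNReal.toReal_ofReal (by positivity)]; push_cast; rfl
    rw [h2, ENNReal.rpow_natCast, ENNReal.rpow_natCast] at h1
    have h3 := h1.trans (pow_le_pow_left' (h n) (n + 1))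
    rw [ENNReal.div_eq_inv_mul, mul_pow, ← ENNReal.inv_pow, ← ENNReal.div_eq_inv_mul,
      ENNReal.le_div_iff_mul_le (Or.inl (pow_ne_zero _ hb0)) (Or.inl (ENNReal.pow_ne_top hbt)),
      mul_comm]
    exact h3
  have hlt : M / b < 1 := by
    rw [ENNReal.div_lt_iff (Or.inl hb0) (Or.inl hbt), one_mul]; exact hMb
  have hz : μ {x | b ≤ ‖u x‖ₑ} = 0 := le_antisymm
    (ge_of_tendsto' ((tendsto_add_atTop_iff_nat 1).2
      (ENNReal.tendsto_pow_atTop_nhds_zero_of_lt_one hlt)) hk) zero_le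
  have : ∀ᵐ x ∂μ, ¬ b ≤ ‖u x‖ₑ := by rw [ae_iff]; simpa using hz
  filter_upwards [this] with x hx
  exact (not_le.1 hx).le

lemma IsCurveSolution.eLpNorm_top_le [IsProbabilityMeasure μ] {C : NNReal} {φ : ℝ → ℝ}
    {K : X → X → ℝ} {f : ℝ → X → ℝ} {T : ℝ} {U : ℝ → Lp ℝ 1 μ}
    (hK : SymmKernel μ C K) (hφ : Flux φ) (hU : IsCurveSolution μ φ T K f U)
    (hf : ∀ᵐ t ∂(volume.restrict (Ioo 0 T)), AEStronglyMeasurable (f t) μ)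
    {t : ℝ} (ht : t ∈ Icc 0 T) :
    eLpNorm (U t) ∞ μ ≤ eLpNorm (U 0) ∞ μ + ∫⁻ s in Ioo 0 t, eLpNorm (f s) ∞ μ := by
  refine NonlocalPLaplacian.eLpNorm_top_le (L1.integrable_coeFn _).1 fun n => ?_
  refine (hU.eLpNorm_le (by simp) hK hφ ht).trans (add_le_add ?_ (lintegral_mono_ae ?_))
  · exact eLpNorm_le_eLpNorm_of_exponent_le le_top (L1.integrable_coeFn _).1
  · filter_upwards [restrict_Ioo_mono ht.2 hf] with s hs
    exact eLpNorm_le_eLpNorm_of_exponent_le le_top hs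

/-- A solution whose velocity is integrable in time with values in `L²` is continuous in `L²`. -/
lemma IsCurveSolution.tendsto_eLpNorm_sub [IsFiniteMeasure μ] {φ : ℝ → ℝ}
    {K : X → X → ℝ} {f : ℝ → X → ℝ} {T : ℝ} {U : ℝ → Lp ℝ 1 μ}
    (hU : IsCurveSolution μ φ T K f U) {Φ : ℝ → ℝ≥0∞}
    (hΦ : ∀ᵐ t ∂(volume.restrict (Ioo 0 T)),
      eLpNorm (fun x => nonlocalOp μ φ K (U t) x + f t x) 2 μ ≤ Φ t)
    (hfin : ∫⁻ t in Ioo 0 T, Φ t ≠ ∞) {t : ℝ} (ht : t ∈ Icc 0 T) :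
    Tendsto (fun τ => eLpNorm (fun x => U τ x - U t x) 2 μ) (𝓝[Icc 0 T] t) (𝓝 0) := by
  have hT : 0 ≤ T := ht.1.trans ht.2
  have key : ∀ a ∈ Icc 0 T, ∀ b ∈ Icc 0 T, a ≤ b →
      eLpNorm (fun x => U b x - U a x) 2 μ ≤ ∫⁻ s in Ioo a b, Φ s := by
    intro a ha b hb hab
    have hac : AbsolutelyContinuousOnInterval (fun s => U s - U a) a b := by
      refine (hU.ac.sub
        (LipschitzWith.const (U a)).lipschitzOnWith.absolutelyContinuousOnInterval).mono ?_
      rw [uIcc_of_le hab, uIcc_of_le hT]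
      exact Icc_subset_Icc ha.1 hb.2
    have hmono : ∀ {P : ℝ → Prop}, (∀ᵐ s ∂(volume.restrict (Ioo 0 T)), P s) →
        ∀ᵐ s ∂(volume.restrict (Ioo a b)), P s := fun h =>
      ae_mono (Measure.restrict_mono (Ioo_subset_Ioo ha.1 hb.2) le_rfl) h
    -- The growth estimate is applied with dissipative part zero and the whole velocity as `F`: it
    -- then bounds an increment in `L²` by the integral of the speed.
    have hd : ∀ᵐ s ∂(volume.restrict (Ioo a b)),
        DissipativeAt μ 2 (fun s => U s - U a) (Φ s) s := by
      filter_upwards [hmono hU.eq, hmono hΦ] with s hs hs'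
      obtain ⟨-, V, hV, hVeq⟩ := hs
      refine ⟨V, fun _ => 0, _, hV.sub_const _, ?_, integrable_zero _ _ _, fun j _ _ => by simp,
        by simpa using hs'⟩
      filter_upwards [hVeq] with x hx
      rw [hx, zero_add]
    have h := eLpNorm_le_of_dissipative one_le_two hab hac hd
    have h0 : eLpNorm (U a - U a : Lp ℝ 1 μ) (ENNReal.ofReal 2) μ = 0 := by
      rw [sub_self, eLpNorm_congr_ae (Lp.coeFn_zero _ _ _), eLpNorm_zero]
    rw [h0, zero_add, eLpNorm_congr_ae (Lp.coeFn_sub (U b) (U a))] at h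
    rwa [ENNReal.ofReal_ofNat] at h
  -- Written with the restricted measure, for which `Φ` has finite integral, so that absolute
  -- continuity of the integral applies below.
  have hle : ∀ τ ∈ Icc 0 T, eLpNorm (fun x => U τ x - U t x) 2 μ
      ≤ ∫⁻ s in Ioo (min τ t) (max τ t), Φ s ∂(volume.restrict (Ioo 0 T)) := by
    intro τ hτ
    have hsub : Ioo (min τ t) (max τ t) ⊆ Ioo 0 T :=
      Ioo_subset_Ioo (le_min hτ.1 ht.1) (max_le hτ.2 ht.2)
    rw [Measure.restrict_restrict measurableSet_Ioo, inter_eq_left.2 hsub]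
    rcases le_total τ t with h | h
    · rw [min_eq_left h, max_eq_right h]
      refine le_trans (le_of_eq ?_) (key τ hτ t ht h)
      rw [← eLpNorm_neg]
      congr 1
      funext x
      simp
    · rw [min_eq_right h, max_eq_left h]
      exact key t ht τ hτ h
  have hz : Tendsto (fun τ => ∫⁻ s in Ioo (min τ t) (max τ t), Φ s ∂(volume.restrict (Ioo 0 T)))
      (𝓝[Icc 0 T] t) (𝓝 0) := by
    refine tendsto_setLIntegral_zero hfin ?_
    have h1 : Tendsto (fun τ : ℝ => ENNReal.ofReal (max τ t - min τ t)) (𝓝[Icc 0 T] t) (𝓝 0) := by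
      have : Continuous fun τ : ℝ => ENNReal.ofReal (max τ t - min τ t) :=
        ENNReal.continuous_ofReal.comp (by fun_prop)
      have h2 := (this.tendsto t).mono_left (nhdsWithin_le_nhds (s := Icc 0 T))
      simpa using h2
    refine tendsto_of_tendsto_of_tendsto_of_le_of_le tendsto_const_nhds h1
      (fun _ => zero_le) fun τ => ?_
    simp only [Function.comp_apply]
    refine (Measure.restrict_apply_le _ _).trans ?_
    rw [Real.volume_Ioo]
  exact tendsto_of_tendsto_of_tendsto_of_le_of_le' tendsto_const_nhds hz
    (Eventually.of_forall fun _ => zero_le)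
    (eventually_nhdsWithin_of_forall fun τ hτ => hle τ hτ)

end

section

/-! ### Approximation by local averages -/

/-- The mean is the best constant in `L²`. It will be compared with values `F ξ` at points that need
not lie in the cell. -/
lemma lintegral_sub_average_le {Y : Type*} [MeasurableSpace Y] {ν : Measure Y} [IsFiniteMeasure ν]
    {F : Y → ℝ} (hF : MemLp F 2 ν) (m : ℝ) :
    ∫⁻ x, ‖F x - (ν univ).toReal⁻¹ * ∫ y, F y ∂ν‖ₑ ^ 2 ∂ν ≤ ∫⁻ x, ‖F x - m‖ₑ ^ 2 ∂ν := by
  set c := (ν univ).toReal⁻¹ * ∫ y, F y ∂ν with hc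
  have hF1 : Integrable F ν := hF.integrable (by norm_num)
  have hsq : ∀ a : ℝ, Integrable (fun x => (F x - a) ^ 2) ν := fun a =>
    (hF.sub (memLp_const a)).integrable_sq
  have hz : ∫ x, (F x - c) ∂ν = 0 := by
    rw [integral_sub hF1 (integrable_const _), integral_const, smul_eq_mul, Measure.real, hc]
    by_cases h0 : (ν univ).toReal = 0
    · have : ν = 0 := by
        rcases (ENNReal.toReal_eq_zero_iff _).1 h0 with h | h
        · exact Measure.measure_univ_eq_zero.1 h
        · exact absurd h (measure_ne_top _ _)
      simp [this]
    · field_simp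
      ring
  have hle : ∫ x, (F x - c) ^ 2 ∂ν ≤ ∫ x, (F x - m) ^ 2 ∂ν := by
    have h1 : ∀ x, (F x - m) ^ 2 = (F x - c) ^ 2 + 2 * (c - m) * (F x - c) + (c - m) ^ 2 :=
      fun x => by ring
    have h2 : ∫ x, (F x - m) ^ 2 ∂ν = ∫ x, (F x - c) ^ 2 ∂ν + ∫ _, (c - m) ^ 2 ∂ν := by
      simp_rw [h1]
      have hi : Integrable (fun x => 2 * (c - m) * (F x - c)) ν :=
        (hF1.sub (integrable_const _)).const_mul _
      rw [integral_add (f := fun x => (F x - c) ^ 2 + 2 * (c - m) * (F x - c)) ((hsq c).add hi)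
        (integrable_const _), integral_add (hsq c) hi,
        integral_const_mul, hz, mul_zero, add_zero]
    rw [h2]
    exact le_add_of_nonneg_right (integral_nonneg fun _ => sq_nonneg _)
  have hconv : ∀ a : ℝ, ∫⁻ x, ‖F x - a‖ₑ ^ 2 ∂ν = ENNReal.ofReal (∫ x, (F x - a) ^ 2 ∂ν) :=
    fun a => by
    rw [ofReal_integral_eq_lintegral_ofReal (hsq a) (ae_of_all _ fun _ => sq_nonneg _)]
    refine lintegral_congr fun x => ?_
    rw [Real.enorm_eq_ofReal_abs, ← ENNReal.ofReal_pow (abs_nonneg _), sq_abs]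
  rw [hconv, hconv]
  exact ENNReal.ofReal_le_ofReal hle

variable {ι : Type*} [Fintype ι]

lemma measurableSet_cube : MeasurableSet (cube ι) := measurableSet_Icc

lemma volume_cube : volume (cube ι) = 1 := by
  rw [cube, Real.volume_Icc_pi]
  simp

lemma modulus_congr {F F' : (ι → ℝ) → ℝ} {q : ℝ≥0∞} {h : ℝ}
    (hFF : F =ᵐ[volume.restrict (cube ι)] F') : modulus (cube ι) q F h = modulus (cube ι) q F' h := by
  unfold modulus
  refine iSup_congr fun z => iSup_congr fun _ => eLpNorm_congr_ae ?_
  rw [EventuallyEq, ae_restrict_iff' measurableSet_cube] at hFF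
  have hS : MeasurableSet {x | x ∈ cube ι ∧ x + z ∈ cube ι} :=
    measurableSet_cube.inter (measurableSet_cube.preimage (measurable_add_const z))
  rw [EventuallyEq, ae_restrict_iff' hS]
  filter_upwards [hFF, (measurePreserving_add_right volume z).quasiMeasurePreserving.ae hFF]
    with x h1 h2 hx
  rw [h1 hx.1, h2 hx.2]

/-- The crude factor `card ι + 1` in place of the square root of `card ι` leaves room for the strict
inequality in `modulus`. -/
lemma norm_toLp_lt {δ : ℝ} (hδ : 0 < δ) {z : ι → ℝ} (hz : ∀ k, |z k| ≤ δ) :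
    ‖WithLp.toLp 2 z‖ < (Fintype.card ι + 1) * δ := by
  rw [EuclideanSpace.norm_eq, Real.sqrt_lt' (by positivity)]
  have h1 : ∑ k, ‖(WithLp.toLp 2 z) k‖ ^ 2 ≤ ∑ _k : ι, δ ^ 2 := by
    refine Finset.sum_le_sum fun k _ => ?_
    have := hz k
    simp only [Real.norm_eq_abs]
    gcongr
  rw [Finset.sum_const, nsmul_eq_mul, Finset.card_univ] at h1
  have h2 : (0 : ℝ) ≤ Fintype.card ι := Nat.cast_nonneg _
  nlinarith [sq_nonneg δ, pow_pos hδ 2, mul_nonneg h2 (sq_nonneg δ), mul_nonneg (mul_nonneg h2 h2) (sq_nonneg δ)]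

/-- On each cell the average is replaced by `F ξ`, and the result is averaged over `ξ` in a cube `W`
of side `δ` containing the cell. Using `W` instead of the cell avoids any shape condition: cells may
be arbitrarily thin, but `W` has volume `δ ^ N`. With `ξ = x + z` the shift `z` ranges over `[-δ, δ]
^ N`, of volume `(2δ) ^ N`, whence the factor `2 ^ N`. Summing over disjoint cells and exchanging
integrals leaves one translation estimate for each `z`. -/
lemma sum_lintegral_sub_average_le_modulus {F : (ι → ℝ) → ℝ}
    (hF : MemLp F 2 (volume.restrict (cube ι))) {δ : ℝ} (hδ : 0 < δ) {I : Type*} [Fintype I]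
    {C : I → Set (ι → ℝ)} (hCm : ∀ i, MeasurableSet (C i)) (hCd : Pairwise (Function.onFun Disjoint C))
    {a : I → ι → ℝ} (hCa : ∀ i, C i ⊆ Icc (a i) (a i + fun _ => δ))
    (ha : ∀ i, Icc (a i) (a i + fun _ => δ) ⊆ cube ι) :
    ∑ i, ∫⁻ x in C i, ‖F x - (volume (C i)).toReal⁻¹ * ∫ y in C i, F y‖ₑ ^ 2
      ≤ 2 ^ Fintype.card ι * modulus (cube ι) 2 F ((Fintype.card ι + 1) * δ) ^ 2 := by
  wlog hFm : StronglyMeasurable F generalizing F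
  · obtain ⟨F', hF'm, hFF'⟩ := hF.1
    have h := this ((memLp_congr_ae hFF').1 hF) hF'm
    rw [modulus_congr hFF']
    refine le_trans (le_of_eq (Finset.sum_congr rfl fun i _ => ?_)) h
    have hi : F =ᵐ[volume.restrict (C i)] F' :=
      ae_mono (Measure.restrict_mono ((hCa i).trans (ha i)) le_rfl) hFF'
    rw [integral_congr_ae hi]
    refine lintegral_congr_ae ?_
    filter_upwards [hi] with x hx
    rw [hx]
  set N := Fintype.card ι with hN
  set ω := modulus (cube ι) 2 F ((N + 1) * δ) with hω
  set Q : Set (ι → ℝ) := Icc (fun _ => -δ) (fun _ => δ) with hQ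
  -- Cut off to zero when `x + z` leaves the cube, so that integrating over `x` gives exactly the
  -- norm in `modulus`.
  let g : (ι → ℝ) → (ι → ℝ) → ℝ≥0∞ := fun x z =>
    (cube ι).indicator (fun ξ => ‖F ξ - F x‖ₑ ^ 2) (x + z)
  have hgm : Measurable (Function.uncurry g) := by
    have : Function.uncurry g = ((fun q : (ι → ℝ) × (ι → ℝ) => q.1 + q.2) ⁻¹' (cube ι)).indicator
        (fun q => ‖F (q.1 + q.2) - F q.1‖ₑ ^ 2) := by
      funext q
      rfl
    rw [this]
    refine Measurable.indicator ?_ (measurableSet_cube.preimage (by fun_prop))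
    have h1 := hFm.measurable
    exact (((h1.comp (measurable_fst.add measurable_snd)).sub (h1.comp measurable_fst)).enorm).pow_const 2
  have hvolW : ∀ i, volume (Icc (a i) (a i + fun _ => δ)) = ENNReal.ofReal δ ^ N := fun i => by
    rw [Real.volume_Icc_pi]
    simp [hN]
  have hvolQ : volume Q = (2 * ENNReal.ofReal δ) ^ N := by
    rw [hQ, Real.volume_Icc_pi]
    simp only [sub_neg_eq_add, Finset.prod_const, Finset.card_univ, ← two_mul]
    rw [ENNReal.ofReal_mul (by norm_num), ENNReal.ofReal_ofNat]
  have hcell : ∀ i, ENNReal.ofReal δ ^ N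
      * ∫⁻ x in C i, ‖F x - (volume (C i)).toReal⁻¹ * ∫ y in C i, F y‖ₑ ^ 2
      ≤ ∫⁻ x in C i, ∫⁻ z in Q, g x z := by
    intro i
    set W := Icc (a i) (a i + fun _ => δ) with hW
    have hCc : C i ⊆ cube ι := (hCa i).trans (ha i)
    have hfin : IsFiniteMeasure (volume.restrict (C i)) :=
      ⟨by rw [Measure.restrict_apply_univ]; exact (measure_mono hCc).trans_lt (by simp [volume_cube])⟩
    have hFi : MemLp F 2 (volume.restrict (C i)) :=
      hF.mono_measure (Measure.restrict_mono hCc le_rfl)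
    have hm2 : Measurable fun q : (ι → ℝ) × (ι → ℝ) => ‖F q.2 - F q.1‖ₑ ^ 2 :=
      ((hFm.measurable.comp measurable_snd).sub (hFm.measurable.comp measurable_fst)).enorm.pow_const 2
    calc ENNReal.ofReal δ ^ N
          * ∫⁻ x in C i, ‖F x - (volume (C i)).toReal⁻¹ * ∫ y in C i, F y‖ₑ ^ 2
        = ∫⁻ _ξ in W, ∫⁻ x in C i, ‖F x - (volume (C i)).toReal⁻¹ * ∫ y in C i, F y‖ₑ ^ 2 := by
          rw [setLIntegral_const, hvolW, mul_comm]
      _ ≤ ∫⁻ ξ in W, ∫⁻ x in C i, ‖F x - F ξ‖ₑ ^ 2 := by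
          refine lintegral_mono fun ξ => ?_
          have := lintegral_sub_average_le hFi (F ξ)
          rwa [Measure.restrict_apply_univ] at this
      _ = ∫⁻ x in C i, ∫⁻ ξ in W, ‖F x - F ξ‖ₑ ^ 2 :=
          lintegral_lintegral_swap hm2.aemeasurable
      _ ≤ ∫⁻ x in C i, ∫⁻ z in Q, g x z := by
          refine setLIntegral_mono' (hCm i) fun x hx => ?_
          rw [← lintegral_indicator measurableSet_Icc, ← lintegral_indicator measurableSet_Icc,
            ← lintegral_add_left_eq_self _ x]
          refine lintegral_mono fun z => ?_
          by_cases hz : x + z ∈ W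
          · have hzQ : z ∈ Q := by
              have hx' := hCa i hx
              refine ⟨fun k => ?_, fun k => ?_⟩
              · have h1 := hz.1 k
                have h2 := hx'.2 k
                simp only [Pi.add_apply] at h1 h2
                linarith
              · have h1 := hz.2 k
                have h2 := hx'.1 k
                simp only [Pi.add_apply] at h1
                linarith
            rw [indicator_of_mem hz, indicator_of_mem hzQ]
            simp only [g]
            rw [indicator_of_mem (ha i hz), ← enorm_neg, neg_sub]
          · rw [indicator_of_notMem hz]
            exact zero_le
  have hsum : ∑ i, ∫⁻ x in C i, ∫⁻ z in Q, g x z ≤ ∫⁻ x in cube ι, ∫⁻ z in Q, g x z := by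
    rw [← tsum_fintype (L := .unconditional _), ← lintegral_iUnion hCm hCd]
    exact lintegral_mono_set (iUnion_subset fun i => (hCa i).trans (ha i))
  have hω2 : ∀ z ∈ Q, ∫⁻ x in cube ι, g x z ≤ ω ^ 2 := by
    intro z hz
    have hS : MeasurableSet {x | x ∈ cube ι ∧ x + z ∈ cube ι} :=
      measurableSet_cube.inter (measurableSet_cube.preimage (measurable_add_const z))
    have h1 : eLpNorm (fun x => F (x + z) - F x) 2
        (volume.restrict {x | x ∈ cube ι ∧ x + z ∈ cube ι}) ≤ ω := by
      rw [hω, modulus]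
      refine le_iSup₂_of_le z (norm_toLp_lt hδ fun k => abs_le.2 ⟨hz.1 k, hz.2 k⟩) le_rfl
    have h2 : ∫⁻ x in cube ι, g x z = eLpNorm (fun x => F (x + z) - F x) 2
        (volume.restrict {x | x ∈ cube ι ∧ x + z ∈ cube ι}) ^ 2 := by
      rw [eLpNorm_eq_lintegral_rpow_enorm_toReal (by norm_num) (by norm_num), ← ENNReal.rpow_natCast,
        ← ENNReal.rpow_mul]
      simp only [ENNReal.toReal_ofNat, Nat.cast_ofNat, one_div, ne_eq, OfNat.ofNat_ne_zero,
        not_false_eq_true, inv_mul_cancel₀, ENNReal.rpow_one]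
      rw [← lintegral_indicator hS, ← lintegral_indicator measurableSet_cube]
      refine lintegral_congr fun x => ?_
      simp only [g, indicator, mem_ofPred_eq]
      by_cases hx : x ∈ cube ι <;> by_cases hxz : x + z ∈ cube ι <;> simp [hx, hxz]
    rw [h2]
    gcongr
  have htot : ENNReal.ofReal δ ^ N
      * ∑ i, ∫⁻ x in C i, ‖F x - (volume (C i)).toReal⁻¹ * ∫ y in C i, F y‖ₑ ^ 2
      ≤ ENNReal.ofReal δ ^ N * (2 ^ N * ω ^ 2) := by
    rw [Finset.mul_sum]
    refine (Finset.sum_le_sum fun i _ => hcell i).trans (hsum.trans ?_)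
    rw [lintegral_lintegral_swap hgm.aemeasurable]
    refine (setLIntegral_mono' measurableSet_Icc hω2).trans (le_of_eq ?_)
    rw [setLIntegral_const, hvolQ, mul_pow]
    ring
  exact (ENNReal.mul_le_mul_iff_right (pow_ne_zero _ (by simpa using hδ)) (by finiteness)).1 htot

lemma modulus_le_lipSeminorm {F : (ι → ℝ) → ℝ} {S : Set (ι → ℝ)} {q : ℝ≥0∞} {s h : ℝ} (hh : 0 < h) :
    modulus S q F h ≤ ENNReal.ofReal (h ^ s) * lipSeminorm s q S F := by
  have h1 : ENNReal.ofReal (h ^ (-s)) * modulus S q F h ≤ lipSeminorm s q S F :=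
    le_iSup₂_of_le (f := fun (h : ℝ) (_ : 0 < h) => ENNReal.ofReal (h ^ (-s)) * modulus S q F h)
      h hh le_rfl
  calc modulus S q F h
      = ENNReal.ofReal (h ^ s) * (ENNReal.ofReal (h ^ (-s)) * modulus S q F h) := by
        rw [← mul_assoc, ← ENNReal.ofReal_mul (by positivity), ← Real.rpow_add hh, add_neg_cancel,
          Real.rpow_zero, ENNReal.ofReal_one, one_mul]
    _ ≤ _ := by gcongr

lemma sum_lintegral_sub_average_le_lipSeminorm {F : (ι → ℝ) → ℝ}
    (hF : MemLp F 2 (volume.restrict (cube ι))) {δ : ℝ} (hδ : 0 < δ) {I : Type*} [Fintype I]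
    {C : I → Set (ι → ℝ)} (hCm : ∀ i, MeasurableSet (C i)) (hCd : Pairwise (Function.onFun Disjoint C))
    {a : I → ι → ℝ} (hCa : ∀ i, C i ⊆ Icc (a i) (a i + fun _ => δ))
    (ha : ∀ i, Icc (a i) (a i + fun _ => δ) ⊆ cube ι) {s : ℝ} (hs1 : s ≤ 1) :
    (∑ i, ∫⁻ x in C i, ‖F x - (volume (C i)).toReal⁻¹ * ∫ y in C i, F y‖ₑ ^ 2) ^ (1 / (2 : ℝ))
      ≤ ENNReal.ofReal (2 ^ Fintype.card ι * (Fintype.card ι + 1) * δ ^ s)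
        * lipSeminorm s 2 (cube ι) F := by
  set N := Fintype.card ι with hN
  have h1 := sum_lintegral_sub_average_le_modulus hF hδ hCm hCd hCa ha
  have hN1 : (1 : ℝ) ≤ N + 1 := by linarith [Nat.cast_nonneg (α := ℝ) N]
  calc _ ≤ ((2 : ℝ≥0∞) ^ N * modulus (cube ι) 2 F ((N + 1) * δ) ^ 2) ^ (1 / (2 : ℝ)) := by
        gcongr
    _ = ((2 : ℝ≥0∞) ^ N) ^ (1 / (2 : ℝ)) * modulus (cube ι) 2 F ((N + 1) * δ) := by
        rw [ENNReal.mul_rpow_of_nonneg _ _ (by norm_num), ← ENNReal.rpow_natCast (_) 2,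
          ← ENNReal.rpow_mul]
        simp
    _ ≤ (2 : ℝ≥0∞) ^ N * (ENNReal.ofReal (((N + 1) * δ) ^ s) * lipSeminorm s 2 (cube ι) F) := by
        gcongr
        · calc ((2 : ℝ≥0∞) ^ N) ^ (1 / (2 : ℝ)) ≤ ((2 : ℝ≥0∞) ^ N) ^ (1 : ℝ) :=
              ENNReal.rpow_le_rpow_of_exponent_le (one_le_pow₀ (by norm_num)) (by norm_num)
            _ = _ := ENNReal.rpow_one _
        · exact modulus_le_lipSeminorm (by positivity)
    _ ≤ (2 : ℝ≥0∞) ^ N * (ENNReal.ofReal ((N + 1) * δ ^ s) * lipSeminorm s 2 (cube ι) F) := by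
        gcongr
        rw [Real.mul_rpow (by positivity) hδ.le]
        gcongr
        calc ((N : ℝ) + 1) ^ s ≤ ((N : ℝ) + 1) ^ (1 : ℝ) := Real.rpow_le_rpow_of_exponent_le hN1 hs1
          _ = _ := Real.rpow_one _
    _ = _ := by
        rw [mul_assoc ((2 : ℝ) ^ N), ENNReal.ofReal_mul (p := (2 : ℝ) ^ N) (by positivity),
          ENNReal.ofReal_pow (by norm_num), ENNReal.ofReal_ofNat, mul_assoc]

end

section

instance isProbabilityMeasure_μΩ (d : ℕ) : IsProbabilityMeasure (μΩ d) :=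
  ⟨by rw [μΩ, Measure.restrict_apply_univ, volume_cube]⟩

namespace Mesh

/-! ### Geometry of meshes -/

variable {d n : ℕ} (M : Mesh d n)

lemma node_nonneg (k : Fin d) (j : Fin (n + 1)) : 0 ≤ M.node k j := by
  rw [← M.first k]; exact (M.strictMono k).monotone (Fin.zero_le j)

lemma node_le_one (k : Fin d) (j : Fin (n + 1)) : M.node k j ≤ 1 := by
  rw [← M.last k]; exact (M.strictMono k).monotone (Fin.le_last j)

lemma node_lt_succ (k : Fin d) (j : Fin n) : M.node k j.castSucc < M.node k j.succ :=
  M.strictMono k Fin.castSucc_lt_succ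

lemma cell_eq_pi (i : Fin d → Fin n) :
    M.cell i = univ.pi fun k => Ioc (M.node k (i k).castSucc) (M.node k (i k).succ) := by
  ext x; simp [cell, mem_ofPred_eq]

lemma measurableSet_cell (i : Fin d → Fin n) : MeasurableSet (M.cell i) := by
  rw [cell_eq_pi]
  exact MeasurableSet.univ_pi fun _ => measurableSet_Ioc

lemma cell_subset_cube (i : Fin d → Fin n) : M.cell i ⊆ cube (Fin d) := fun _ hx =>
  ⟨fun k => (M.node_nonneg k _).trans (hx k).1.le, fun k => (hx k).2.trans (M.node_le_one k _)⟩

lemma eq_of_mem_Ioc {k : Fin d} {i j : Fin n} {x : ℝ}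
    (hi : x ∈ Ioc (M.node k i.castSucc) (M.node k i.succ))
    (hj : x ∈ Ioc (M.node k j.castSucc) (M.node k j.succ)) : i = j := by
  have key : ∀ {i j : Fin n}, x ∈ Ioc (M.node k i.castSucc) (M.node k i.succ) →
      x ∈ Ioc (M.node k j.castSucc) (M.node k j.succ) → ¬ i < j := fun {i j} hi hj hlt => by
    have h : M.node k i.succ ≤ M.node k j.castSucc :=
      (M.strictMono k).monotone (Fin.succ_le_castSucc_iff.2 hlt)
    linarith [hi.2, hj.1]
  exact le_antisymm (not_lt.1 (key hj hi)) (not_lt.1 (key hi hj))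

lemma eq_of_mem_cell {i j : Fin d → Fin n} {x : Fin d → ℝ} (hi : x ∈ M.cell i)
    (hj : x ∈ M.cell j) : i = j :=
  funext fun k => M.eq_of_mem_Ioc (hi k) (hj k)

lemma pairwise_disjoint_cell : Pairwise (Function.onFun Disjoint M.cell) := fun _ _ hij =>
  disjoint_left.2 fun _ hi hj => hij (M.eq_of_mem_cell hi hj)

lemma exists_mem_Ioc (k : Fin d) {x : ℝ} (hx : x ∈ Ioc (0 : ℝ) 1) :
    ∃ j : Fin n, x ∈ Ioc (M.node k j.castSucc) (M.node k j.succ) := by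
  have key : ∀ m : Fin (n + 1), x ≤ M.node k m →
      ∃ j : Fin n, x ∈ Ioc (M.node k j.castSucc) (M.node k j.succ) := by
    intro m
    induction m using Fin.induction with
    | zero => intro h; rw [M.first] at h; exact absurd hx.1 (not_lt.2 h)
    | succ j ih =>
      intro h
      by_cases h' : x ≤ M.node k j.castSucc
      · exact ih h'
      · exact ⟨j, not_le.1 h', h⟩
  exact key (Fin.last n) (by rw [M.last]; exact hx.2)

/-- Being open at their lower ends, the cells miss only the faces `x k = 0` of the cube. -/
lemma ae_mem_cell : ∀ᵐ x ∂(μΩ d), ∃ i, x ∈ M.cell i := by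
  have h0 : ∀ᵐ x ∂(volume : Measure (Fin d → ℝ)), ∀ k, x k ≠ 0 := by
    rw [ae_all_iff]
    intro k
    have := (Measure.quasiMeasurePreserving_eval (fun _ : Fin d => (volume : Measure ℝ)) k).ae
      (p := fun y => y ≠ 0) (by simp [ae_iff])
    exact this
  rw [μΩ, ae_restrict_iff' measurableSet_cube]
  filter_upwards [h0] with x hx hxc
  choose i hi using fun k => M.exists_mem_Ioc k
    ⟨lt_of_le_of_ne (hxc.1 k) (Ne.symm (hx k)), hxc.2 k⟩
  exact ⟨i, hi⟩

lemma restrict_cell (i : Fin d → Fin n) :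
    (μΩ d).restrict (M.cell i) = volume.restrict (M.cell i) := by
  rw [μΩ, Measure.restrict_restrict (M.measurableSet_cell i), inter_eq_left.2 (M.cell_subset_cube i)]

lemma volume_cell_lt_top (i : Fin d → Fin n) : volume (M.cell i) < ∞ :=
  (measure_mono (M.cell_subset_cube i)).trans_lt (by simp [volume_cube])

lemma volume_cell_pos (i : Fin d → Fin n) : 0 < volume (M.cell i) := by
  rw [cell_eq_pi, volume_pi_pi]
  simp only [Real.volume_Ioc]
  refine pos_iff_ne_zero.2 (Finset.prod_ne_zero_iff.2 fun k _ => ?_)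
  simpa using M.node_lt_succ k (i k)

lemma vol_pos (i : Fin d → Fin n) : 0 < M.vol i :=
  ENNReal.toReal_pos (M.volume_cell_pos i).ne' (M.volume_cell_lt_top i).ne

lemma inj_of_mem {v : (Fin d → Fin n) → ℝ} {i : Fin d → Fin n} {x : Fin d → ℝ}
    (hx : x ∈ M.cell i) : M.inj v x = v i := by
  rw [inj, Finset.sum_eq_single i]
  · rw [indicator_of_mem hx]
  · intro j _ hji
    rw [indicator_of_notMem fun hj => hji (M.eq_of_mem_cell hj hx)]
  · simp

lemma inj₂_of_mem {B : (Fin d → Fin n) → (Fin d → Fin n) → ℝ} {i j : Fin d → Fin n}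
    {x y : Fin d → ℝ} (hx : x ∈ M.cell i) (hy : y ∈ M.cell j) : M.inj₂ B x y = B i j := by
  rw [inj₂, Finset.sum_eq_single i, Finset.sum_eq_single j]
  · exact indicator_of_mem (mk_mem_prod hx hy) _
  · intro j' _ hj
    rw [indicator_of_notMem fun h => hj (M.eq_of_mem_cell h.2 hy)]
  · simp
  · intro i' _ hi
    refine Finset.sum_eq_zero fun j' _ => ?_
    rw [indicator_of_notMem fun h => hi (M.eq_of_mem_cell h.1 hx)]
  · simp

lemma measurable_inj (v : (Fin d → Fin n) → ℝ) : Measurable (M.inj v) :=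
  Finset.measurable_sum _ fun i _ => measurable_const.indicator (M.measurableSet_cell i)

lemma measurable_inj₂ (B : (Fin d → Fin n) → (Fin d → Fin n) → ℝ) :
    Measurable (Function.uncurry (M.inj₂ B)) := by
  have : Function.uncurry (M.inj₂ B) = fun z => ∑ i, ∑ j,
      (M.cell i ×ˢ M.cell j).indicator (fun _ => B i j) z := rfl
  rw [this]
  exact Finset.measurable_sum _ fun i _ => Finset.measurable_sum _ fun j _ =>
    measurable_const.indicator ((M.measurableSet_cell i).prod (M.measurableSet_cell j))

lemma norm_inj_le (v : (Fin d → Fin n) → ℝ) : ∀ᵐ x ∂(μΩ d), ‖M.inj v x‖ ≤ ‖v‖ := by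
  filter_upwards [M.ae_mem_cell] with x hx
  obtain ⟨i, hi⟩ := hx
  rw [M.inj_of_mem hi]
  exact norm_le_pi_norm v i

lemma memLp_inj (v : (Fin d → Fin n) → ℝ) (q : ℝ≥0∞) : MemLp (M.inj v) q (μΩ d) :=
  MemLp.of_bound (M.measurable_inj v).aestronglyMeasurable _ (M.norm_inj_le v)

lemma integral_inj (v : (Fin d → Fin n) → ℝ) : ∫ x, M.inj v x ∂(μΩ d) = ∑ i, M.vol i * v i := by
  unfold inj
  rw [integral_finsetSum _ fun i _ => (integrable_const (v i)).indicator (M.measurableSet_cell i)]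
  refine Finset.sum_congr rfl fun i _ => ?_
  rw [integral_indicator (M.measurableSet_cell i), M.restrict_cell, setIntegral_const, smul_eq_mul]
  rfl

lemma lintegral_eq_sum (h : (Fin d → ℝ) → ℝ≥0∞) :
    ∫⁻ x, h x ∂(μΩ d) = ∑ i, ∫⁻ x in M.cell i, h x := by
  have h1 : ∫⁻ x, h x ∂(μΩ d) = ∫⁻ x in ⋃ i, M.cell i, h x ∂(μΩ d) := by
    rw [Measure.restrict_eq_self_of_ae_mem]
    filter_upwards [M.ae_mem_cell] with x hx
    exact mem_iUnion.2 hx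
  rw [h1, lintegral_iUnion M.measurableSet_cell M.pairwise_disjoint_cell, tsum_fintype]
  simp_rw [M.restrict_cell]

/-- The nonlocal operator on piecewise constant functions. -/
lemma nonlocalOp_inj (p : ℝ) (B : (Fin d → Fin n) → (Fin d → Fin n) → ℝ)
    (v : (Fin d → Fin n) → ℝ) :
    nonlocalOp (μΩ d) (Psi p) (M.inj₂ B) (M.inj v) =ᵐ[μΩ d] M.inj (-M.pLapDisc p B v) := by
  filter_upwards [M.ae_mem_cell] with x hx
  obtain ⟨i, hi⟩ := hx
  have h : (fun y => M.inj₂ B x y * Psi p (M.inj v y - M.inj v x))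
      =ᵐ[μΩ d] M.inj fun j => B i j * Psi p (v j - v i) := by
    filter_upwards [M.ae_mem_cell] with y hy
    obtain ⟨j, hj⟩ := hy
    rw [M.inj_of_mem hi, M.inj_of_mem hj, M.inj_of_mem hj, M.inj₂_of_mem hi hj]
  rw [nonlocalOp, integral_congr_ae h, integral_inj, M.inj_of_mem hi]
  simp [pLapDisc, mul_assoc]

lemma integrable_integrand_inj {p : ℝ} (hp : 1 < p) (B : (Fin d → Fin n) → (Fin d → Fin n) → ℝ)
    (v : (Fin d → Fin n) → ℝ) :
    Integrable (integrand (Psi p) (M.inj₂ B) (M.inj v)) ((μΩ d).prod (μΩ d)) := by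
  have hm : Measurable (integrand (Psi p) (M.inj₂ B) (M.inj v)) := by
    have h1 := M.measurable_inj v
    exact (M.measurable_inj₂ B).mul ((flux_Psi hp).continuous.measurable.comp
      ((h1.comp measurable_snd).sub (h1.comp measurable_fst)))
  refine Integrable.of_bound (C := ∑ i, ∑ j, |B i j * Psi p (v j - v i)|) hm.aestronglyMeasurable ?_
  filter_upwards [Measure.quasiMeasurePreserving_fst.ae M.ae_mem_cell,
    Measure.quasiMeasurePreserving_snd.ae M.ae_mem_cell] with z h1 h2
  obtain ⟨i, hi⟩ := h1
  obtain ⟨j, hj⟩ := h2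
  rw [integrand, M.inj_of_mem hi, M.inj_of_mem hj, M.inj₂_of_mem hi hj, Real.norm_eq_abs]
  refine le_trans ?_ (Finset.single_le_sum (f := fun i => ∑ j, |B i j * Psi p (v j - v i)|)
    (fun i _ => Finset.sum_nonneg fun j _ => abs_nonneg _) (Finset.mem_univ i))
  exact Finset.single_le_sum (f := fun j => |B i j * Psi p (v j - v i)|)
    (fun j _ => abs_nonneg _) (Finset.mem_univ j)

/-- The injector as a continuous linear map into `L¹`. -/
def injL (M : Mesh d n) : ((Fin d → Fin n) → ℝ) →L[ℝ] Lp ℝ 1 (μΩ d) :=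
  LinearMap.toContinuousLinearMap
    { toFun := fun v => (M.memLp_inj v 1).toLp
      map_add' := fun v w => by
        rw [← MemLp.toLp_add]
        congr 1
        funext x
        simp [inj, ← Finset.sum_add_distrib, indicator_add]
      map_smul' := fun c v => by
        rw [RingHom.id_apply, ← MemLp.toLp_const_smul]
        congr 1
        funext x
        simp only [inj, Pi.smul_apply, smul_eq_mul, Finset.mul_sum]
        refine Finset.sum_congr rfl fun i _ => ?_
        by_cases hx : x ∈ M.cell i <;> simp [hx] }

lemma coeFn_injL (v : (Fin d → Fin n) → ℝ) : M.injL v =ᵐ[μΩ d] M.inj v :=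
  (M.memLp_inj v 1).coeFn_toLp

end Mesh

/-- Solutions of the continuum problem as curves in `L¹`. -/
lemma isSolution_iff {d : ℕ} {p T : ℝ} (hT : 0 ≤ T) {K : (Fin d → ℝ) → (Fin d → ℝ) → ℝ}
    {f : ℝ → (Fin d → ℝ) → ℝ} {g : (Fin d → ℝ) → ℝ} {u : ℝ → (Fin d → ℝ) → ℝ} :
    IsSolution p T K f g u ↔ ∃ U : ℝ → Lp ℝ 1 (μΩ d), (∀ t ∈ Icc 0 T, u t =ᵐ[μΩ d] U t) ∧
      IsCurveSolution (μΩ d) (Psi p) T K f U ∧ U 0 =ᵐ[μΩ d] g := by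
  have hop : ∀ (w : (Fin d → ℝ) → ℝ) x, -pLap p K w x = nonlocalOp (μΩ d) (Psi p) K w x :=
    fun w x => by simp [pLap, nonlocalOp]
  have h00 : (0 : ℝ) ∈ Icc 0 T := ⟨le_rfl, hT⟩
  constructor
  · rintro ⟨U, hU, hac, h0, heq⟩
    refine ⟨U, hU, ⟨hac, ?_⟩, (hU 0 h00).symm.trans h0⟩
    filter_upwards [heq, ae_restrict_mem measurableSet_Ioo] with t ht hmem
    obtain ⟨hd, V, hV, hVeq⟩ := ht
    have hut := hU t (Ioo_subset_Icc_self hmem)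
    refine ⟨Integrable.congr hd (integrand_congr hut), V, hV, ?_⟩
    filter_upwards [hVeq, nonlocalOp_congr (φ := Psi p) (K := K) hut] with x h1 h2
    rw [h1, hop, h2]
  · rintro ⟨U, hU, hS, h0⟩
    refine ⟨U, hU, hS.ac, (hU 0 h00).trans h0, ?_⟩
    filter_upwards [hS.eq, ae_restrict_mem measurableSet_Ioo] with t ht hmem
    obtain ⟨hd, V, hV, hVeq⟩ := ht
    have hut := hU t (Ioo_subset_Icc_self hmem)
    refine ⟨Integrable.congr hd (integrand_congr hut.symm), V, hV, ?_⟩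
    filter_upwards [hVeq, nonlocalOp_congr (φ := Psi p) (K := K) hut] with x h1 h2
    rw [h1, hop, h2]

namespace Mesh

variable {d n : ℕ} (M : Mesh d n)

/-- The extension of a semi-discrete solution solves the continuum problem. -/
lemma IsSemidiscreteSolution.isCurveSolution {M : Mesh d n} {p T : ℝ} (hp : 1 < p)
    {B : (Fin d → Fin n) → (Fin d → Fin n) → ℝ} {b : ℝ → (Fin d → Fin n) → ℝ}
    {a : (Fin d → Fin n) → ℝ} {v : ℝ → (Fin d → Fin n) → ℝ}
    (hv : M.IsSemidiscreteSolution p T B b a v) :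
    IsCurveSolution (μΩ d) (Psi p) T (M.inj₂ B) (fun t => M.inj (b t)) fun t => M.injL (v t) := by
  refine ⟨absolutelyContinuousOnInterval_of_dist_le (norm_nonneg M.injL) hv.1 fun x _ y _ => ?_, ?_⟩
  · rw [dist_eq_norm, dist_eq_norm, ← map_sub]
    exact M.injL.le_opNorm _
  · filter_upwards [hv.2.2] with t ht
    refine ⟨(M.integrable_integrand_inj hp B (v t)).congr (integrand_congr (M.coeFn_injL _).symm),
      _, M.injL.hasFDerivAt.comp_hasDerivAt t ht, ?_⟩
    filter_upwards [M.coeFn_injL (-M.pLapDisc p B (v t) + b t), M.ae_mem_cell,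
      nonlocalOp_congr (φ := Psi p) (K := M.inj₂ B) (M.coeFn_injL (v t)),
      M.nonlocalOp_inj p B (v t)] with x h1 h2 h3 h4
    obtain ⟨i, hi⟩ := h2
    rw [h1, h3, h4, M.inj_of_mem hi, M.inj_of_mem hi, M.inj_of_mem hi, Pi.add_apply]

end Mesh

end

section

/-! ### Projected kernels -/

lemma IsKernel.symmKernel {d : ℕ} {K : (Fin d → ℝ) → (Fin d → ℝ) → ℝ} (hK : IsKernel d K) :
    SymmKernel (μΩ d) (normLinfLq d 2 K).toNNReal K := by
  refine ⟨hK.measurable, hK.nonneg, hK.symm, ?_⟩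
  filter_upwards [ae_le_essSup (μ := μΩ d) (f := fun x => eLpNorm (K x) 2 (μΩ d)),
    hK.measurable.prodMk_left] with x hx hxm
  rw [ENNReal.coe_toNNReal hK.bounded.ne, ← eLpNorm_one_eq_lintegral_enorm]
  exact (eLpNorm_le_eLpNorm_of_exponent_le (by norm_num) hxm).trans hx

lemma prod_μΩ (d : ℕ) :
    (μΩ d).prod (μΩ d) = volume.restrict (cube (Fin d) ×ˢ cube (Fin d)) := by
  rw [μΩ, Measure.prod_restrict, Measure.volume_eq_prod]

namespace Mesh

variable {d n : ℕ} (M : Mesh d n)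

lemma prod_cell_subset (i j : Fin d → Fin n) :
    M.cell i ×ˢ M.cell j ⊆ cube (Fin d) ×ˢ cube (Fin d) :=
  prod_mono (M.cell_subset_cube i) (M.cell_subset_cube j)

lemma ae_prod_cell {P : (Fin d → ℝ) × (Fin d → ℝ) → Prop}
    (h : ∀ᵐ z ∂((μΩ d).prod (μΩ d)), P z) (i j : Fin d → Fin n) :
    ∀ᵐ z ∂(volume.restrict (M.cell i ×ˢ M.cell j)), P z := by
  rw [prod_μΩ] at h
  exact ae_mono (Measure.restrict_mono (M.prod_cell_subset i j) le_rfl) h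

lemma proj₂_nonneg {K : (Fin d → ℝ) → (Fin d → ℝ) → ℝ} (hK : IsKernel d K)
    (i j : Fin d → Fin n) : 0 ≤ M.proj₂ K i j :=
  mul_nonneg (inv_nonneg.2 (mul_nonneg (M.vol_pos i).le (M.vol_pos j).le))
    (integral_nonneg_of_ae (M.ae_prod_cell hK.nonneg i j))

lemma proj₂_symm {K : (Fin d → ℝ) → (Fin d → ℝ) → ℝ} (hK : IsKernel d K)
    (i j : Fin d → Fin n) : M.proj₂ K i j = M.proj₂ K j i := by
  rw [proj₂, proj₂, mul_comm (M.vol i)]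
  congr 1
  rw [Measure.volume_eq_prod, ← setIntegral_prod_swap]
  refine integral_congr_ae ?_
  filter_upwards [M.ae_prod_cell hK.symm j i] with z hz
  simp [hz]

/-- The marginal bound is crude and depends on the mesh. This is harmless, since it only secures
integrability and does not enter the stability estimate. -/
lemma symmKernel_inj₂ {B : (Fin d → Fin n) → (Fin d → Fin n) → ℝ} (hB : ∀ i j, 0 ≤ B i j)
    (hBs : ∀ i j, B i j = B j i) :
    SymmKernel (μΩ d) (∑ i, ∑ j, B i j).toNNReal (M.inj₂ B) := by
  have hcells : ∀ᵐ z ∂((μΩ d).prod (μΩ d)), (∃ i, z.1 ∈ M.cell i) ∧ ∃ j, z.2 ∈ M.cell j := by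
    filter_upwards [Measure.quasiMeasurePreserving_fst.ae M.ae_mem_cell,
      Measure.quasiMeasurePreserving_snd.ae M.ae_mem_cell] with z h1 h2
    exact ⟨h1, h2⟩
  refine ⟨(M.measurable_inj₂ B).aestronglyMeasurable, ?_, ?_, ?_⟩
  · filter_upwards [hcells] with z hz
    obtain ⟨⟨i, hi⟩, j, hj⟩ := hz
    rw [M.inj₂_of_mem hi hj]
    exact hB i j
  · filter_upwards [hcells] with z hz
    obtain ⟨⟨i, hi⟩, j, hj⟩ := hz
    rw [M.inj₂_of_mem hi hj, M.inj₂_of_mem hj hi]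
    exact hBs i j
  · filter_upwards [M.ae_mem_cell] with x hx
    obtain ⟨i, hi⟩ := hx
    refine (lintegral_mono_ae (g := fun _ => ENNReal.ofReal (∑ i, ∑ j, B i j)) ?_).trans ?_
    · filter_upwards [M.ae_mem_cell] with y hy
      obtain ⟨j, hj⟩ := hy
      rw [M.inj₂_of_mem hi hj, Real.enorm_eq_ofReal (hB i j)]
      refine ENNReal.ofReal_le_ofReal (le_trans ?_ (Finset.single_le_sum
        (f := fun i => ∑ j, B i j) (fun i _ => Finset.sum_nonneg fun j _ => hB i j)
        (Finset.mem_univ i)))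
      exact Finset.single_le_sum (f := fun j => B i j) (fun j _ => hB i j) (Finset.mem_univ j)
    · rw [lintegral_const, measure_univ, mul_one]
      rfl

/-! ### Existence of semi-discrete solutions -/

/-- The measure on the set of cells that gives each cell its volume. -/
def cellMeasure (M : Mesh d n) : Measure (Fin d → Fin n) :=
  ∑ i, ENNReal.ofReal (M.vol i) • Measure.dirac i

lemma cellMeasure_singleton (i : Fin d → Fin n) :
    M.cellMeasure {i} = ENNReal.ofReal (M.vol i) := by
  rw [cellMeasure, Measure.finsetSum_apply, Finset.sum_eq_single i]
  · simp
  · intro j _ hj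
    simp [hj]
  · simp

instance : IsFiniteMeasure M.cellMeasure :=
  ⟨by
    rw [cellMeasure, Measure.finsetSum_apply]
    exact ENNReal.sum_lt_top.2 fun i _ => by simp⟩

lemma cellMeasure_real_singleton (i : Fin d → Fin n) : M.cellMeasure.real {i} = M.vol i := by
  rw [Measure.real, cellMeasure_singleton, ENNReal.toReal_ofReal (M.vol_pos i).le]

lemma forall_of_ae_cellMeasure {P : (Fin d → Fin n) → Prop} (h : ∀ᵐ i ∂M.cellMeasure, P i)
    (i : Fin d → Fin n) : P i := by
  by_contra hi
  have h1 : M.cellMeasure {i} ≤ 0 := by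
    rw [← ae_iff.1 h]
    exact measure_mono (singleton_subset_iff.2 hi)
  rw [cellMeasure_singleton, nonpos_iff_eq_zero, ENNReal.ofReal_eq_zero] at h1
  exact absurd (M.vol_pos i) (not_lt.2 h1)

lemma integrable_cellMeasure {Y : Type*} [MeasurableSpace Y] [Finite Y] [MeasurableSingletonClass Y]
    (ν : Measure Y) [IsFiniteMeasure ν] (w : Y → ℝ) : Integrable w ν := by
  have := Fintype.ofFinite Y
  exact Integrable.of_finite

lemma symmKernel_cellMeasure {B : (Fin d → Fin n) → (Fin d → Fin n) → ℝ} (hB : ∀ i j, 0 ≤ B i j)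
    (hBs : ∀ i j, B i j = B j i) :
    SymmKernel M.cellMeasure (∑ i, ∫⁻ j, ‖B i j‖ₑ ∂M.cellMeasure).toNNReal B := by
  refine ⟨(measurable_of_finite _).aestronglyMeasurable, ae_of_all _ fun z => hB _ _,
    ae_of_all _ fun z => hBs _ _, ae_of_all _ fun i => ?_⟩
  rw [ENNReal.coe_toNNReal]
  · exact Finset.single_le_sum (f := fun i => ∫⁻ j, ‖B i j‖ₑ ∂M.cellMeasure)
      (fun _ _ => zero_le) (Finset.mem_univ i)
  · exact (ENNReal.sum_lt_top.2 fun i _ => (integrable_cellMeasure M.cellMeasure (B i)).2).ne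

/-- Point evaluations on `L¹` of the set of cells. -/
lemma exists_evaluation : ∃ ev : Lp ℝ 1 M.cellMeasure →L[ℝ] ((Fin d → Fin n) → ℝ),
    ∀ u i, ev u i = u i := by
  classical
  have h : ∀ i, ∃ ℓ : Lp ℝ 1 M.cellMeasure →L[ℝ] ℝ, ∀ u, ℓ u = u i := fun i => by
    -- Integration against the indicator of the atom `i`, divided by its mass.
    obtain ⟨ℓ, hℓ⟩ := exists_pairing (μ := M.cellMeasure)
      (j := fun x => if x = i then (M.vol i)⁻¹ else 0) (B := (M.vol i)⁻¹)
      (measurable_of_finite _).aestronglyMeasurable fun x => by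
        have := inv_nonneg.2 (M.vol_pos i).le
        split_ifs
        · rw [abs_of_nonneg this]
        · simpa using this
    refine ⟨ℓ, fun u => ?_⟩
    rw [hℓ, integral_fintype (integrable_cellMeasure _ _), Finset.sum_eq_single i]
    · rw [cellMeasure_real_singleton, if_pos rfl, smul_eq_mul, mul_inv_cancel_left₀ (M.vol_pos i).ne']
    · intro j _ hj
      simp [hj]
    · simp
  choose ℓ hℓ using h
  exact ⟨ContinuousLinearMap.pi ℓ, fun u i => hℓ i u⟩

/-- With the cells weighted by volume, the system is itself a nonlocal problem on a finite measure
space, and the abstract existence theorem applies. Point evaluations carry the `L¹` curve back to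
vectors. -/
lemma exists_isSemidiscreteSolution {p : ℝ} (hp : 1 < p) {T : ℝ} (hT : 0 ≤ T)
    {B : (Fin d → Fin n) → (Fin d → Fin n) → ℝ} (hB : ∀ i j, 0 ≤ B i j)
    (hBs : ∀ i j, B i j = B j i) {b : ℝ → (Fin d → Fin n) → ℝ}
    (hbm : ∀ i, AEStronglyMeasurable (fun t => b t i) (volume.restrict (Icc 0 T)))
    (hb : ∀ i, ∫⁻ t in Icc 0 T, ‖b t i‖ₑ ≠ ∞) (a : (Fin d → Fin n) → ℝ) :
    ∃ v, M.IsSemidiscreteSolution p T B b a v := by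
  classical
  have hm : AEStronglyMeasurable (Function.uncurry b)
      ((volume.restrict (Icc 0 T)).prod M.cellMeasure) := by
    have h1 : Function.uncurry b = fun z => ∑ i, b z.1 i * (if z.2 = i then 1 else 0) := by
      funext z
      simp [Function.uncurry]
    rw [h1]
    refine Finset.aestronglyMeasurable_fun_sum _ fun i _ => (hbm i).comp_fst.mul ?_
    exact ((measurable_of_finite fun j : Fin d → Fin n => if j = i then (1 : ℝ) else 0).comp
      measurable_snd).aestronglyMeasurable
  have hr0 : 0 < p := by linarith
  have hfin : ∫⁻ t in Icc 0 T, eLpNorm (b t) (ENNReal.ofReal p) M.cellMeasure ≠ ∞ := by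
    have h1 : ∀ t, eLpNorm (b t) (ENNReal.ofReal p) M.cellMeasure
        ≤ M.cellMeasure univ ^ (ENNReal.ofReal p).toReal⁻¹ * ∑ i, ‖b t i‖ₑ := fun t => by
      have h2 := eLpNorm_le_of_ae_bound (μ := M.cellMeasure) (p := ENNReal.ofReal p)
        (f := b t) (C := ∑ i, |b t i|) (ae_of_all _ fun i =>
          (Real.norm_eq_abs _).trans_le (Finset.single_le_sum (f := fun i => |b t i|)
            (fun _ _ => abs_nonneg _) (Finset.mem_univ i)))
      rw [ENNReal.ofReal_sum_of_nonneg fun _ _ => abs_nonneg _] at h2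
      simp_rw [Real.enorm_eq_ofReal_abs]
      exact h2
    refine ne_top_of_le_ne_top ?_ (lintegral_mono h1)
    have h0 : M.cellMeasure univ ^ (ENNReal.ofReal p).toReal⁻¹ ≠ ∞ :=
      ENNReal.rpow_ne_top_of_nonneg (by simp [hr0.le]) (measure_ne_top _ _)
    rw [lintegral_const_mul' _ _ h0, lintegral_finsetSum' _ fun i _ => (hbm i).enorm]
    exact ENNReal.mul_ne_top h0 (ENNReal.sum_ne_top.2 fun i _ => hb i)
  have hg : MemLp a (ENNReal.ofReal p) M.cellMeasure :=
    MemLp.of_bound (measurable_of_finite _).aestronglyMeasurable (∑ i, |a i|) (ae_of_all _ fun i =>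
      (Real.norm_eq_abs _).trans_le (Finset.single_le_sum (f := fun i => |a i|)
        (fun _ _ => abs_nonneg _) (Finset.mem_univ i)))
  -- On a finite set every function is in every `L^r`; `r = p` satisfies both `1 ≤ r` and `p - 1 <
  -- r`.
  obtain ⟨U, hU, hU0⟩ := exists_isCurveSolution (M.symmKernel_cellMeasure hB hBs) hp hp.le
    (by linarith : p - 1 < p) hT hm hfin hg
  obtain ⟨ev, hev⟩ := M.exists_evaluation
  refine ⟨fun t => ev (U t), ?_, ?_, ?_⟩
  · refine absolutelyContinuousOnInterval_of_dist_le (norm_nonneg ev) hU.ac fun x _ y _ => ?_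
    rw [dist_eq_norm, dist_eq_norm, ← map_sub]
    exact ev.le_opNorm _
  · funext i
    simp only [hev]
    exact M.forall_of_ae_cellMeasure hU0 i
  · filter_upwards [hU.eq] with t ht
    obtain ⟨-, V, hV, hVeq⟩ := ht
    have h1 := ev.hasFDerivAt.comp_hasDerivAt t hV
    have h2 : ev V = -M.pLapDisc p B (ev (U t)) + b t := by
      funext i
      have h3 : V i = ∫ j, B i j * Psi p (U t j - U t i) ∂M.cellMeasure + b t i :=
        M.forall_of_ae_cellMeasure hVeq i
      rw [hev, h3, integral_fintype (integrable_cellMeasure _ _), Pi.add_apply, Pi.neg_apply,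
        pLapDisc, neg_neg]
      congr 1
      refine Finset.sum_congr rfl fun j _ => ?_
      rw [cellMeasure_real_singleton, hev, hev, smul_eq_mul, mul_assoc]
    rw [← h2]
    exact h1

lemma aestronglyMeasurable_proj {T : ℝ} {f : ℝ → (Fin d → ℝ) → ℝ}
    (hf : AEStronglyMeasurable (Function.uncurry f) ((volume.restrict (Icc 0 T)).prod (μΩ d)))
    (i : Fin d → Fin n) :
    AEStronglyMeasurable (fun t => M.proj (f t) i) (volume.restrict (Icc 0 T)) := by
  have h1 : AEStronglyMeasurable (Function.uncurry f)
      ((volume.restrict (Icc 0 T)).prod (volume.restrict (M.cell i))) := by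
    refine hf.mono_ac (Measure.AbsolutelyContinuous.prod Measure.AbsolutelyContinuous.rfl ?_)
    exact (Measure.restrict_mono (M.cell_subset_cube i) le_rfl).absolutelyContinuous
  exact h1.integral_prod_right'.const_mul _

lemma enorm_proj_le (w : (Fin d → ℝ) → ℝ) (i : Fin d → Fin n) :
    ‖M.proj w i‖ₑ ≤ ENNReal.ofReal (M.vol i)⁻¹ * eLpNorm w 1 (μΩ d) := by
  rw [proj, enorm_mul, Real.enorm_eq_ofReal (inv_nonneg.2 (M.vol_pos i).le)]
  gcongr
  refine (enorm_integral_le_lintegral_enorm _).trans ?_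
  rw [eLpNorm_one_eq_lintegral_enorm]
  exact lintegral_mono' (Measure.restrict_mono (M.cell_subset_cube i) le_rfl) le_rfl

end Mesh

end

section

namespace Mesh

/-! ### Projection errors -/

variable {d n : ℕ} (M : Mesh d n)

lemma side_le_size (k : Fin d) (j : Fin n) :
    M.node k j.succ - M.node k j.castSucc ≤ M.size := by
  refine (le_abs_self _).trans (le_trans ?_
    (le_ciSup (f := fun k : Fin d => ⨆ j : Fin n, |M.node k j.succ - M.node k j.castSucc|)
      (finite_range _).bddAbove k))
  exact le_ciSup (f := fun j : Fin n => |M.node k j.succ - M.node k j.castSucc|)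
    (finite_range _).bddAbove j

lemma size_le_one : M.size ≤ 1 := by
  refine Real.iSup_le (fun k => Real.iSup_le (fun j => ?_) zero_le_one) zero_le_one
  rw [abs_le]
  constructor <;> linarith [M.node_nonneg k j.succ, M.node_nonneg k j.castSucc,
    M.node_le_one k j.succ, M.node_le_one k j.castSucc]

lemma size_pos (hd : 1 ≤ d) : 0 < M.size := by
  obtain ⟨j, -⟩ := M.exists_mem_Ioc ⟨0, hd⟩ (x := 1) ⟨one_pos, le_rfl⟩
  linarith [M.side_le_size ⟨0, hd⟩ j, M.node_lt_succ ⟨0, hd⟩ j]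

/-- The lower corner of a cube in `Ω` with side `M.size` that contains the cell `i`. -/
def corner (i : Fin d → Fin n) : Fin d → ℝ :=
  -- A cube started at the lower node of the cell may leave `Ω`; it is then shifted back so as to
  -- end at `1`.
  fun k => min (M.node k (i k).castSucc) (1 - M.size)

lemma corner_le {i : Fin d → Fin n} {x : Fin d → ℝ} (hx : x ∈ M.cell i) (k : Fin d) :
    M.corner i k ≤ x k :=
  (min_le_left _ _).trans (hx k).1.le

lemma le_corner_add {i : Fin d → Fin n} {x : Fin d → ℝ} (hx : x ∈ M.cell i) (k : Fin d) :
    x k ≤ M.corner i k + M.size := by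
  rw [corner, ← min_add_add_right, le_min_iff]
  constructor <;> linarith [(hx k).2, M.side_le_size k (i k), M.node_le_one k (i k).succ]

lemma corner_nonneg (i : Fin d → Fin n) (k : Fin d) : 0 ≤ M.corner i k :=
  le_min (M.node_nonneg _ _) (by linarith [M.size_le_one])

lemma corner_add_le (i : Fin d → Fin n) (k : Fin d) : M.corner i k + M.size ≤ 1 := by
  have : M.corner i k ≤ 1 - M.size := min_le_right _ _
  linarith

lemma eLpNorm_inj_proj_sub_le (hd : 1 ≤ d) {F : (Fin d → ℝ) → ℝ} (hF : MemLp F 2 (μΩ d)) {s : ℝ}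
    (hs1 : s ≤ 1) :
    eLpNorm (M.inj (M.proj F) - F) 2 (μΩ d)
      ≤ ENNReal.ofReal (2 ^ d * (d + 1) * M.size ^ s) * lipSeminorm s 2 (cube (Fin d)) F := by
  have h := sum_lintegral_sub_average_le_lipSeminorm hF (M.size_pos hd) M.measurableSet_cell
    M.pairwise_disjoint_cell (a := M.corner)
    (fun i x hx => ⟨fun k => M.corner_le hx k, fun k => M.le_corner_add hx k⟩)
    (fun i x hx => ⟨fun k => (M.corner_nonneg i k).trans (hx.1 k),
      fun k => (hx.2 k).trans (M.corner_add_le i k)⟩) hs1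
  rw [Fintype.card_fin] at h
  refine le_trans (le_of_eq ?_) h
  rw [eLpNorm_eq_lintegral_rpow_enorm_toReal two_ne_zero ENNReal.ofNat_ne_top, M.lintegral_eq_sum]
  simp only [ENNReal.toReal_ofNat, ENNReal.rpow_ofNat]
  congr 1
  refine Finset.sum_congr rfl fun i _ => setLIntegral_congr_fun (M.measurableSet_cell i) fun x hx => ?_
  change ‖M.inj (M.proj F) x - F x‖ₑ ^ 2 = _
  rw [M.inj_of_mem hx, enorm_sub_rev]
  rfl

lemma lintegral_prod_eq_sum (h : (Fin d → ℝ) × (Fin d → ℝ) → ℝ≥0∞) :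
    ∫⁻ z, h z ∂((μΩ d).prod (μΩ d))
      = ∑ ij : (Fin d → Fin n) × (Fin d → Fin n), ∫⁻ z in M.cell ij.1 ×ˢ M.cell ij.2, h z := by
  have hcells : ∀ᵐ z ∂((μΩ d).prod (μΩ d)),
      z ∈ ⋃ ij : (Fin d → Fin n) × (Fin d → Fin n), M.cell ij.1 ×ˢ M.cell ij.2 := by
    filter_upwards [Measure.quasiMeasurePreserving_fst.ae M.ae_mem_cell,
      Measure.quasiMeasurePreserving_snd.ae M.ae_mem_cell] with z ⟨i, hi⟩ ⟨j, hj⟩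
    exact mem_iUnion.2 ⟨(i, j), hi, hj⟩
  rw [← Measure.restrict_eq_self_of_ae_mem hcells,
    lintegral_iUnion (s := fun ij : (Fin d → Fin n) × (Fin d → Fin n) => M.cell ij.1 ×ˢ M.cell ij.2)
      (fun ij => (M.measurableSet_cell ij.1).prod (M.measurableSet_cell ij.2)), tsum_fintype]
  · refine Finset.sum_congr rfl fun ij _ => ?_
    rw [prod_μΩ, Measure.restrict_restrict ((M.measurableSet_cell ij.1).prod
      (M.measurableSet_cell ij.2)), inter_eq_left.2 (M.prod_cell_subset _ _)]
  · exact fun ij kl hne => disjoint_left.2 fun z h1 h2 => hne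
      (Prod.ext (M.eq_of_mem_cell h1.1 h2.1) (M.eq_of_mem_cell h1.2 h2.2))

/-- The estimate by averages is used in dimension `2d`: products of cells are transported to `Fin d
⊕ Fin d → ℝ` by a measure-preserving equivalence. -/
lemma normLqSq_inj₂_proj₂_sub_le (hd : 1 ≤ d) {K : (Fin d → ℝ) → (Fin d → ℝ) → ℝ}
    (hK : MemLp (joined K) 2 (volume.restrict (cube (Fin d ⊕ Fin d)))) {s : ℝ} (hs1 : s ≤ 1) :
    normLqSq d 2 (M.inj₂ (M.proj₂ K) - K)
      ≤ ENNReal.ofReal (2 ^ (d + d) * ((d + d : ℕ) + 1) * M.size ^ s)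
        * lipSeminorm s 2 (cube (Fin d ⊕ Fin d)) (joined K) := by
  let e := MeasurableEquiv.sumPiEquivProdPi (fun _ : Fin d ⊕ Fin d => ℝ)
  have he : MeasurePreserving e := volume_measurePreserving_sumPiEquivProdPi (fun _ : Fin d ⊕ Fin d => ℝ)
  let C : (Fin d → Fin n) × (Fin d → Fin n) → Set (Fin d ⊕ Fin d → ℝ) :=
    fun ij => e ⁻¹' (M.cell ij.1 ×ˢ M.cell ij.2)
  have hm : ∀ ij : (Fin d → Fin n) × (Fin d → Fin n), MeasurableSet (M.cell ij.1 ×ˢ M.cell ij.2) :=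
    fun ij => (M.measurableSet_cell ij.1).prod (M.measurableSet_cell ij.2)
  have hvol : ∀ ij, (volume (C ij)).toReal = M.vol ij.1 * M.vol ij.2 := fun ij => by
    rw [he.measure_preimage (hm ij).nullMeasurableSet, Measure.volume_eq_prod, Measure.prod_prod,
      ENNReal.toReal_mul]
    rfl
  have h := sum_lintegral_sub_average_le_lipSeminorm hK (M.size_pos hd) (C := C)
    (fun ij => e.measurable (hm ij))
    (fun ij kl hne => disjoint_left.2 fun z h1 h2 => hne
      (Prod.ext (M.eq_of_mem_cell h1.1 h2.1) (M.eq_of_mem_cell h1.2 h2.2)))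
    (a := fun ij => Sum.elim (M.corner ij.1) (M.corner ij.2))
    (fun ij x hx => ⟨fun k => by
        cases k with
        | inl k => exact M.corner_le hx.1 k
        | inr k => exact M.corner_le hx.2 k,
      fun k => by
        cases k with
        | inl k => exact M.le_corner_add hx.1 k
        | inr k => exact M.le_corner_add hx.2 k⟩)
    (fun ij x hx => ⟨fun k => by
        cases k with
        | inl k => exact (M.corner_nonneg ij.1 k).trans (hx.1 (Sum.inl k))
        | inr k => exact (M.corner_nonneg ij.2 k).trans (hx.1 (Sum.inr k)),
      fun k => by
        cases k with
        | inl k => exact (hx.2 (Sum.inl k)).trans (M.corner_add_le ij.1 k)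
        | inr k => exact (hx.2 (Sum.inr k)).trans (M.corner_add_le ij.2 k)⟩) hs1
  rw [Fintype.card_sum, Fintype.card_fin] at h
  refine le_trans (le_of_eq ?_) h
  rw [normLqSq, eLpNorm_eq_lintegral_rpow_enorm_toReal two_ne_zero ENNReal.ofNat_ne_top,
    M.lintegral_prod_eq_sum]
  simp only [ENNReal.toReal_ofNat, ENNReal.rpow_ofNat]
  congr 1
  refine Finset.sum_congr rfl fun ij _ => ?_
  have hint : ∫ z in C ij, joined K z = ∫ z in M.cell ij.1 ×ˢ M.cell ij.2, K z.1 z.2 :=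
    he.setIntegral_preimage_emb e.measurableEmbedding (fun z => K z.1 z.2) _
  rw [hvol, hint]
  have hlint := he.setLIntegral_comp_preimage_emb e.measurableEmbedding
    (fun z => ‖K z.1 z.2 - (M.vol ij.1 * M.vol ij.2)⁻¹
      * ∫ z in M.cell ij.1 ×ˢ M.cell ij.2, K z.1 z.2‖ₑ ^ 2) (M.cell ij.1 ×ˢ M.cell ij.2)
  refine Eq.trans ?_ hlint.symm
  refine setLIntegral_congr_fun (hm ij) fun z hz => ?_
  change ‖M.inj₂ (M.proj₂ K) z.1 z.2 - K z.1 z.2‖ₑ ^ 2 = _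
  rw [M.inj₂_of_mem hz.1 hz.2, enorm_sub_rev]
  rfl

end Mesh

end

section

/-! ### The data -/

variable {d : ℕ}

lemma Icc_subset_timeSet {T : ℝ} {T₀ : ℝ≥0∞} (hT₀ : ENNReal.ofReal T ≤ T₀) :
    Icc 0 T ⊆ timeSet T₀ :=
  fun _ ht => ⟨ht.1, (ENNReal.ofReal_le_ofReal ht.2).trans hT₀⟩

lemma normL1Lq_mono_set {I J : Set ℝ} (hIJ : I ⊆ J) {q : ℝ≥0∞} {f : ℝ → (Fin d → ℝ) → ℝ} :
    normL1Lq I q f ≤ normL1Lq J q f :=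
  lintegral_mono_set hIJ

lemma DataIn.mono_set {I J : Set ℝ} (hIJ : I ⊆ J) {q : ℝ≥0∞} {f : ℝ → (Fin d → ℝ) → ℝ}
    {g : (Fin d → ℝ) → ℝ} (h : DataIn J q f g) : DataIn I q f g := by
  refine ⟨h.1, h.2.1.mono_ac ?_, (normL1Lq_mono_set hIJ).trans_lt h.2.2⟩
  exact (Measure.restrict_mono hIJ le_rfl).absolutelyContinuous.prod Measure.AbsolutelyContinuous.rfl

lemma DataIn.ae_aestronglyMeasurable {J : Set ℝ} {q : ℝ≥0∞} {f : ℝ → (Fin d → ℝ) → ℝ}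
    {g : (Fin d → ℝ) → ℝ} (h : DataIn J q f g) :
    ∀ᵐ t ∂(volume.restrict J), AEStronglyMeasurable (f t) (μΩ d) :=
  h.2.1.prodMk_left

lemma DataIn.mono_exponent {J : Set ℝ} {q r : ℝ≥0∞} (hqr : q ≤ r) {f : ℝ → (Fin d → ℝ) → ℝ}
    {g : (Fin d → ℝ) → ℝ} (h : DataIn J r f g) : DataIn J q f g := by
  refine ⟨h.1.mono_exponent hqr, h.2.1, lt_of_le_of_lt (lintegral_mono_ae ?_) h.2.2⟩
  filter_upwards [h.ae_aestronglyMeasurable] with t ht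
  exact eLpNorm_le_eLpNorm_of_exponent_le hqr ht

lemma DataIn.ae_memLp_two {J : Set ℝ} {f : ℝ → (Fin d → ℝ) → ℝ}
    {g : (Fin d → ℝ) → ℝ} (h : DataIn J 2 f g) :
    ∀ᵐ t ∂(volume.restrict J), MemLp (f t) 2 (μΩ d) := by
  have hm : AEMeasurable (fun t => eLpNorm (f t) 2 (μΩ d)) (volume.restrict J) := by
    simp_rw [eLpNorm_eq_lintegral_rpow_enorm_toReal two_ne_zero ENNReal.ofNat_ne_top]
    exact (h.2.1.enorm.pow_const _).lintegral_prod_right'.pow_const _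
  filter_upwards [h.ae_aestronglyMeasurable, ae_lt_top' hm h.2.2.ne] with t h1 h2
  exact ⟨h1, h2⟩

/-- An exponent in which the data are always integrable. -/
def dataExp (p : ℝ) : ℝ := max 2 (2 * (p - 1))

lemma CondAB.dataIn {p : ℝ} {J : Set ℝ} {f : ℝ → (Fin d → ℝ) → ℝ} {g : (Fin d → ℝ) → ℝ}
    (h : CondAB p J f g) : DataIn J (ENNReal.ofReal (dataExp p)) f g := by
  rcases h with ⟨hp, h⟩ | ⟨hp, h⟩
  · rw [dataExp, max_eq_left (by linarith), ENNReal.ofReal_ofNat]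
    exact h
  · rwa [dataExp, max_eq_right (by linarith)]

lemma dataIn_of_condAB_or_condC {p : ℝ} {J : Set ℝ} {f : ℝ → (Fin d → ℝ) → ℝ}
    {g : (Fin d → ℝ) → ℝ} (h : CondAB p J f g ∨ CondC J f g) :
    DataIn J (ENNReal.ofReal (dataExp p)) f g :=
  h.elim CondAB.dataIn fun h => DataIn.mono_exponent le_top h

lemma two_le_dataExp (p : ℝ) : 2 ≤ dataExp p := le_max_left _ _

lemma le_dataExp (p : ℝ) : 2 * (p - 1) ≤ dataExp p := le_max_right _ _

lemma two_le_ofReal_dataExp (p : ℝ) : (2 : ℝ≥0∞) ≤ ENNReal.ofReal (dataExp p) := by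
  rw [← ENNReal.ofReal_ofNat 2]
  exact ENNReal.ofReal_le_ofReal (two_le_dataExp p)

/-! ### Existence and uniqueness -/

lemma exists_isSolution {p : ℝ} (hp : 1 < p) {T : ℝ} (hT : 0 ≤ T) {K : (Fin d → ℝ) → (Fin d → ℝ) → ℝ}
    (hK : IsKernel d K) {f : ℝ → (Fin d → ℝ) → ℝ} {g : (Fin d → ℝ) → ℝ}
    (hdata : DataIn (Icc 0 T) (ENNReal.ofReal (dataExp p)) f g) :
    ∃ u, IsSolution p T K f g u := by
  obtain ⟨U, hU, hU0⟩ := exists_isCurveSolution hK.symmKernel hp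
    (by linarith [two_le_dataExp p] : 1 ≤ dataExp p) (by linarith [le_dataExp p]) hT hdata.2.1
    hdata.2.2.ne hdata.1
  exact ⟨fun t => U t, (isSolution_iff hT).2 ⟨U, fun t _ => EventuallyEq.rfl, hU, hU0⟩⟩

/-- Stability with `q = 1`: two solutions with the same kernel and source have zero defect, so no
integrability of `f` is involved. -/
lemma IsSolution.isUniqueSolution {p : ℝ} (hp : 1 < p) {T : ℝ} (hT : 0 ≤ T)
    {K : (Fin d → ℝ) → (Fin d → ℝ) → ℝ} {C : NNReal} (hK : SymmKernel (μΩ d) C K)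
    {f : ℝ → (Fin d → ℝ) → ℝ} {g : (Fin d → ℝ) → ℝ} {u : ℝ → (Fin d → ℝ) → ℝ}
    (hu : IsSolution p T K f g u) : IsUniqueSolution p T K f g u := by
  refine ⟨hu, fun v hv t ht => ?_⟩
  obtain ⟨U, huU, hU, hU0⟩ := (isSolution_iff hT).1 hu
  obtain ⟨V, hvV, hV, hV0⟩ := (isSolution_iff hT).1 hv
  have h := hV.eLpNorm_sub_le le_rfl hK (flux_Psi hp) hU (Φ := 0) (hU.eq.mono fun t h => h.1)
    (ae_of_all _ fun t => by simp) ht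
  have h0 : eLpNorm (fun x => V 0 x - U 0 x) (ENNReal.ofReal 1) (μΩ d) = 0 := by
    rw [eLpNorm_congr_ae (g := 0), eLpNorm_zero]
    filter_upwards [hU0, hV0] with x h1 h2
    simp [h1, h2]
  rw [h0, Pi.zero_def, lintegral_zero, add_zero, nonpos_iff_eq_zero] at h
  have h1 := (eLpNorm_eq_zero_iff ((L1.integrable_coeFn (V t)).1.sub (L1.integrable_coeFn (U t)).1)
    (by simp)).1 h
  filter_upwards [h1, huU t ht, hvV t ht] with x h1 h2 h3
  rw [h2, h3]
  exact sub_eq_zero.1 h1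

namespace Mesh

variable {n : ℕ} (M : Mesh d n)

lemma exists_isSemidiscreteSolution_proj {p : ℝ} (hp : 1 < p) {T : ℝ} (hT : 0 ≤ T)
    {K : (Fin d → ℝ) → (Fin d → ℝ) → ℝ} (hK : IsKernel d K) {f : ℝ → (Fin d → ℝ) → ℝ}
    {g : (Fin d → ℝ) → ℝ} (hdata : DataIn (Icc 0 T) 1 f g) :
    ∃ v, M.IsSemidiscreteSolution p T (M.proj₂ K) (fun t => M.proj (f t)) (M.proj g) v := by
  refine M.exists_isSemidiscreteSolution hp hT (M.proj₂_nonneg hK) (M.proj₂_symm hK)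
    (M.aestronglyMeasurable_proj hdata.2.1) (fun i => ?_) _
  refine ne_top_of_le_ne_top ?_ (lintegral_mono fun t => M.enorm_proj_le (f t) i)
  rw [lintegral_const_mul' _ _ ENNReal.ofReal_ne_top]
  exact ENNReal.mul_ne_top ENNReal.ofReal_ne_top hdata.2.2.ne

lemma IsSemidiscreteSolution.isSolution {M : Mesh d n} {p : ℝ} (hp : 1 < p) {T : ℝ} (hT : 0 ≤ T)
    {B : (Fin d → Fin n) → (Fin d → Fin n) → ℝ} {b : ℝ → (Fin d → Fin n) → ℝ}
    {a : (Fin d → Fin n) → ℝ} {v : ℝ → (Fin d → Fin n) → ℝ}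
    (hv : M.IsSemidiscreteSolution p T B b a v) :
    IsSolution p T (M.inj₂ B) (fun t => M.inj (b t)) (M.inj a) fun t => M.inj (v t) :=
  (isSolution_iff hT).2 ⟨fun t => M.injL (v t), fun t _ => (M.coeFn_injL (v t)).symm,
    hv.isCurveSolution hp, by simpa only [hv.2.1] using M.coeFn_injL a⟩

end Mesh

/-! ### A priori bounds -/

lemma IsSolution.eLpNorm_le {p : ℝ} (hp : 1 < p) {T : ℝ} {K : (Fin d → ℝ) → (Fin d → ℝ) → ℝ}
    (hK : IsKernel d K) {f : ℝ → (Fin d → ℝ) → ℝ} {g : (Fin d → ℝ) → ℝ}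
    {u : ℝ → (Fin d → ℝ) → ℝ} (hu : IsSolution p T K f g u) {q : ℝ} (hq : 1 ≤ q) {t : ℝ}
    (ht : t ∈ Icc 0 T) :
    eLpNorm (u t) (ENNReal.ofReal q) (μΩ d) ≤ eLpNorm g (ENNReal.ofReal q) (μΩ d)
      + normL1Lq (Icc 0 T) (ENNReal.ofReal q) f := by
  obtain ⟨U, huU, hU, hU0⟩ := (isSolution_iff (ht.1.trans ht.2)).1 hu
  rw [eLpNorm_congr_ae (huU t ht), ← eLpNorm_congr_ae hU0]
  refine (hU.eLpNorm_le hq hK.symmKernel (flux_Psi hp) ht).trans (add_le_add le_rfl ?_)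
  exact lintegral_mono_set ((Ioo_subset_Ioo_right ht.2).trans Ioo_subset_Icc_self)

lemma IsSolution.eLpNorm_top_le {p : ℝ} (hp : 1 < p) {T : ℝ} {K : (Fin d → ℝ) → (Fin d → ℝ) → ℝ}
    (hK : IsKernel d K) {f : ℝ → (Fin d → ℝ) → ℝ} {g : (Fin d → ℝ) → ℝ}
    (hdata : DataIn (Icc 0 T) ∞ f g)
    {u : ℝ → (Fin d → ℝ) → ℝ} (hu : IsSolution p T K f g u) {t : ℝ} (ht : t ∈ Icc 0 T) :
    eLpNorm (u t) ∞ (μΩ d) ≤ eLpNorm g ∞ (μΩ d) + normL1Lq (Icc 0 T) ∞ f := by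
  obtain ⟨U, huU, hU, hU0⟩ := (isSolution_iff (ht.1.trans ht.2)).1 hu
  rw [eLpNorm_congr_ae (huU t ht), ← eLpNorm_congr_ae hU0]
  refine (hU.eLpNorm_top_le hK.symmKernel (flux_Psi hp)
    (ae_mono (Measure.restrict_mono Ioo_subset_Icc_self le_rfl) hdata.ae_aestronglyMeasurable)
    ht).trans (add_le_add le_rfl ?_)
  exact lintegral_mono_set ((Ioo_subset_Ioo_right ht.2).trans Ioo_subset_Icc_self)

lemma IsSolution.aestronglyMeasurable {p T : ℝ} {K : (Fin d → ℝ) → (Fin d → ℝ) → ℝ}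
    {f : ℝ → (Fin d → ℝ) → ℝ} {g : (Fin d → ℝ) → ℝ} {u : ℝ → (Fin d → ℝ) → ℝ}
    (hu : IsSolution p T K f g u) {t : ℝ} (ht : t ∈ Icc 0 T) :
    AEStronglyMeasurable (u t) (μΩ d) := by
  obtain ⟨U, huU, -⟩ := hu
  exact (L1.integrable_coeFn (U t)).1.congr (huU t ht).symm

/-- A bound for the nonlocal operator on functions that are bounded in `L^r`, `r ≥ 2(p-1)`. -/
lemma eLpNorm_nonlocalOp_le_normLinfLq {p : ℝ} (hp : 1 < p) {A : (Fin d → ℝ) → (Fin d → ℝ) → ℝ}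
    (hA : AEStronglyMeasurable (Function.uncurry A) ((μΩ d).prod (μΩ d)))
    (hA' : normLinfLq d 2 A ≠ ∞) {u : (Fin d → ℝ) → ℝ} (hu : AEStronglyMeasurable u (μΩ d))
    {R : ℝ≥0∞} (hR : R ≠ ∞) (huR : eLpNorm u (ENNReal.ofReal (dataExp p)) (μΩ d) ≤ R) :
    eLpNorm (nonlocalOp (μΩ d) (Psi p) A u) 2 (μΩ d)
      ≤ ENNReal.ofReal (2 ^ p * R.toReal ^ (p - 1)) * normLinfLq d 2 A := by
  have hN : eLpNorm (fun x => |u x| ^ (p - 1)) 2 (μΩ d) ≤ ENNReal.ofReal (R.toReal ^ (p - 1)) := by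
    refine (eLpNorm_rpow_two_le hp (le_dataExp p) hu).trans ?_
    rw [← ENNReal.ofReal_rpow_of_nonneg ENNReal.toReal_nonneg (by linarith), ENNReal.ofReal_toReal hR]
    exact ENNReal.rpow_le_rpow huR (by linarith)
  refine (eLpNorm_nonlocalOp_le hp hA hA' ae_le_essSup hu
    (ne_top_of_le_ne_top ENNReal.ofReal_ne_top hN)).trans ?_
  calc _ ≤ ENNReal.ofReal (2 ^ (p - 1)) * normLinfLq d 2 A
        * (2 * ENNReal.ofReal (R.toReal ^ (p - 1))) := by gcongr
    _ = ENNReal.ofReal (2 ^ (p - 1)) * 2 * ENNReal.ofReal (R.toReal ^ (p - 1))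
        * normLinfLq d 2 A := by ring
    _ = _ := by
      rw [← ENNReal.ofReal_ofNat 2, ← ENNReal.ofReal_mul (by positivity),
        ← ENNReal.ofReal_mul (by positivity)]
      congr 3
      rw [Real.rpow_sub_one two_ne_zero]
      ring

/-- A bound for the nonlocal operator on bounded functions. -/
lemma eLpNorm_nonlocalOp_le_normLqSq {p : ℝ} (hp : 1 < p) {A : (Fin d → ℝ) → (Fin d → ℝ) → ℝ}
    (hA : AEStronglyMeasurable (Function.uncurry A) ((μΩ d).prod (μΩ d)))
    {u : (Fin d → ℝ) → ℝ} {R : ℝ≥0∞} (hR : R ≠ ∞) (huR : eLpNorm u ∞ (μΩ d) ≤ R) :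
    eLpNorm (nonlocalOp (μΩ d) (Psi p) A u) 2 (μΩ d)
      ≤ ENNReal.ofReal ((2 * R.toReal) ^ (p - 1)) * normLqSq d 2 A := by
  refine eLpNorm_nonlocalOp_le_of_bounded hp hA ?_
  rw [eLpNorm_exponent_top] at huR
  filter_upwards [ae_le_eLpNormEssSup (f := u) (μ := μΩ d)] with x hx
  rw [← ENNReal.ofReal_le_iff_le_toReal hR, ← Real.enorm_eq_ofReal_abs]
  exact hx.trans huR

end

section

/-! ### Error estimates -/

variable {d : ℕ}

/-- Solutions for data in `L^r`, `r ≥ 2`, `r ≥ 2(p-1)`, are continuous in `L²`. -/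
lemma IsSolution.memC {p : ℝ} (hp : 1 < p) {T : ℝ} {K : (Fin d → ℝ) → (Fin d → ℝ) → ℝ}
    (hK : IsKernel d K) {f : ℝ → (Fin d → ℝ) → ℝ} {g : (Fin d → ℝ) → ℝ}
    (hdata : DataIn (Icc 0 T) (ENNReal.ofReal (dataExp p)) f g)
    {u : ℝ → (Fin d → ℝ) → ℝ} (hu : IsSolution p T K f g u) : MemC T 2 u := by
  set R := eLpNorm g (ENNReal.ofReal (dataExp p)) (μΩ d)
    + normL1Lq (Icc 0 T) (ENNReal.ofReal (dataExp p)) f with hRdef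
  have hR : R ≠ ∞ := ENNReal.add_ne_top.2 ⟨hdata.1.2.ne, hdata.2.2.ne⟩
  have hr1 : 1 ≤ dataExp p := by linarith [two_le_dataExp p]
  have huR : ∀ t ∈ Icc 0 T, eLpNorm (u t) (ENNReal.ofReal (dataExp p)) (μΩ d) ≤ R :=
    fun t ht => hu.eLpNorm_le hp hK hr1 ht
  have hdata2 : DataIn (Icc 0 T) 2 f g := hdata.mono_exponent (two_le_ofReal_dataExp p)
  refine ⟨fun t ht => ?_, fun t ht => ?_⟩
  · exact MemLp.mono_exponent ⟨hu.aestronglyMeasurable ht, (huR t ht).trans_lt hR.lt_top⟩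
      (two_le_ofReal_dataExp p)
  · obtain ⟨U, huU, hU, hU0⟩ := (isSolution_iff (ht.1.trans ht.2)).1 hu
    set c := ENNReal.ofReal (2 ^ p * R.toReal ^ (p - 1)) * normLinfLq d 2 K with hc
    have hcne : c ≠ ∞ := ENNReal.mul_ne_top ENNReal.ofReal_ne_top hK.bounded.ne
    have hΦ : ∀ᵐ s ∂(volume.restrict (Ioo 0 T)),
        eLpNorm (fun x => nonlocalOp (μΩ d) (Psi p) K (U s) x + f s x) 2 (μΩ d)
          ≤ c + eLpNorm (f s) 2 (μΩ d) := by
      filter_upwards [hU.eq, ae_restrict_mem measurableSet_Ioo,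
        ae_mono (Measure.restrict_mono Ioo_subset_Icc_self le_rfl) hdata.ae_aestronglyMeasurable]
        with s hs hmem hfs
      refine (eLpNorm_add_le hs.1.integral_prod_left.1 hfs one_le_two).trans ?_
      gcongr
      refine eLpNorm_nonlocalOp_le_normLinfLq hp hK.measurable hK.bounded.ne
        (L1.integrable_coeFn _).1 hR ?_
      rw [← eLpNorm_congr_ae (huU s (Ioo_subset_Icc_self hmem))]
      exact huR s (Ioo_subset_Icc_self hmem)
    have hfin : ∫⁻ s in Ioo 0 T, (c + eLpNorm (f s) 2 (μΩ d)) ≠ ∞ := by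
      rw [lintegral_add_left measurable_const, setLIntegral_const]
      refine ENNReal.add_ne_top.2 ⟨ENNReal.mul_ne_top hcne (by simp), ?_⟩
      exact ne_top_of_le_ne_top hdata2.2.2.ne (lintegral_mono_set Ioo_subset_Icc_self)
    refine (hU.tendsto_eLpNorm_sub hΦ hfin ht).congr' ?_
    filter_upwards [self_mem_nhdsWithin] with τ hτ
    exact eLpNorm_congr_ae ((huU τ hτ).symm.sub (huU t ht).symm)

lemma MemC.sub {T : ℝ} {u w : ℝ → (Fin d → ℝ) → ℝ} (hu : MemC T 2 u) (hw : MemC T 2 w) :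
    MemC T 2 (fun t => u t - w t) := by
  refine ⟨fun t ht => (hu.1 t ht).sub (hw.1 t ht), fun t ht => ?_⟩
  have h := (hu.2 t ht).add (hw.2 t ht)
  rw [add_zero] at h
  refine tendsto_of_tendsto_of_tendsto_of_le_of_le' tendsto_const_nhds h
    (Eventually.of_forall fun _ => zero_le) ?_
  filter_upwards [self_mem_nhdsWithin] with τ hτ
  rw [show u τ - w τ - (u t - w t) = (u τ - u t) - (w τ - w t) by abel]
  exact eLpNorm_sub_le ((hu.1 τ hτ).sub (hu.1 t ht)).1 ((hw.1 τ hτ).sub (hw.1 t ht)).1 one_le_two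

namespace Mesh

variable {n : ℕ} {M : Mesh d n}

lemma IsSemidiscreteSolution.memC {p : ℝ} {T : ℝ} {B : (Fin d → Fin n) → (Fin d → Fin n) → ℝ}
    {b : ℝ → (Fin d → Fin n) → ℝ} {a : (Fin d → Fin n) → ℝ} {v : ℝ → (Fin d → Fin n) → ℝ}
    (hv : M.IsSemidiscreteSolution p T B b a v) : MemC T 2 (fun t => M.inj (v t)) := by
  refine ⟨fun t _ => M.memLp_inj (v t) 2, fun t ht => ?_⟩
  have hT : 0 ≤ T := ht.1.trans ht.2
  have hc : Tendsto (fun τ => ‖v τ - v t‖ₑ) (𝓝[Icc 0 T] t) (𝓝 0) := by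
    have h := hv.1.continuousOn
    rw [uIcc_of_le hT] at h
    have h1 : Tendsto (fun τ => ‖v τ - v t‖ₑ) (𝓝[Icc 0 T] t) (𝓝 ‖v t - v t‖ₑ) :=
      ((h t ht).tendsto.sub tendsto_const_nhds).enorm
    simpa using h1
  refine tendsto_of_tendsto_of_tendsto_of_le_of_le tendsto_const_nhds hc (fun _ => zero_le)
    fun τ => ?_
  have hsub : M.inj (v τ) - M.inj (v t) = M.inj (v τ - v t) := by
    funext x
    simp only [inj, Pi.sub_apply, ← Finset.sum_sub_distrib]
    refine Finset.sum_congr rfl fun i _ => ?_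
    by_cases hx : x ∈ M.cell i <;> simp [hx]
  have h := eLpNorm_le_of_ae_bound (p := 2) (M.norm_inj_le (v τ - v t))
  rw [measure_univ, ENNReal.one_rpow, one_mul, ofReal_norm] at h
  change eLpNorm (M.inj (v τ) - M.inj (v t)) 2 (μΩ d) ≤ _
  rwa [hsub]

/-- Comparison of the semi-discrete and the continuum solution. -/
lemma IsSemidiscreteSolution.normC_sub_le {p : ℝ} (hp : 1 < p) {T : ℝ} (hT : 0 ≤ T)
    {K : (Fin d → ℝ) → (Fin d → ℝ) → ℝ} (hK : IsKernel d K) {f : ℝ → (Fin d → ℝ) → ℝ}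
    {g : (Fin d → ℝ) → ℝ} (hdata : DataIn (Icc 0 T) (ENNReal.ofReal (dataExp p)) f g)
    {u : ℝ → (Fin d → ℝ) → ℝ} (hu : IsSolution p T K f g u) {v : ℝ → (Fin d → Fin n) → ℝ}
    (hv : M.IsSemidiscreteSolution p T (M.proj₂ K) (fun t => M.proj (f t)) (M.proj g) v)
    {c : ℝ≥0∞} (hc : ∀ t ∈ Icc 0 T,
      eLpNorm (nonlocalOp (μΩ d) (Psi p) (M.inj₂ (M.proj₂ K) - K) (u t)) 2 (μΩ d) ≤ c) :
    normC T 2 (fun t => M.inj (v t) - u t) ≤ eLpNorm (M.inj (M.proj g) - g) 2 (μΩ d)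
      + normL1Lq (Icc 0 T) 2 (fun t => M.inj (M.proj (f t)) - f t) + ENNReal.ofReal T * c := by
  have hA : AEStronglyMeasurable (Function.uncurry (M.inj₂ (M.proj₂ K) - K))
      ((μΩ d).prod (μΩ d)) := (M.measurable_inj₂ _).aestronglyMeasurable.sub hK.measurable
  have hKn := M.symmKernel_inj₂ (M.proj₂_nonneg hK) (M.proj₂_symm hK)
  obtain ⟨U, huU, hU, hU0⟩ := (isSolution_iff hT).1 hu
  have hr0 : 0 < dataExp p := by linarith [two_le_dataExp p]
  have hint : ∀ t ∈ Icc 0 T,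
      Integrable (integrand (Psi p) (M.inj₂ (M.proj₂ K)) (U t)) ((μΩ d).prod (μΩ d)) := by
    refine fun t ht => hKn.integrable_integrand_of_growth (flux_Psi hp).continuous hr0 zero_le_one
      (abs_Psi_le_growth hp (by linarith [le_dataExp p]))
      ⟨(L1.integrable_coeFn _).1, ?_⟩
    rw [← eLpNorm_congr_ae (huU t ht)]
    exact (hu.eLpNorm_le hp hK (by linarith [two_le_dataExp p]) ht).trans_lt
      (ENNReal.add_lt_top.2 ⟨hdata.1.2, hdata.2.2⟩)
  -- The defect of `u` in the projected problem. The operators are compared at `u`, so no bound on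
  -- the semi-discrete solution is needed.
  have hΦ : ∀ᵐ t ∂(volume.restrict (Ioo 0 T)), eLpNorm (fun x =>
      (nonlocalOp (μΩ d) (Psi p) (M.inj₂ (M.proj₂ K)) (U t) x - nonlocalOp (μΩ d) (Psi p) K (U t) x)
        + (M.inj (M.proj (f t)) x - f t x)) (ENNReal.ofReal 2) (μΩ d)
      ≤ c + eLpNorm (M.inj (M.proj (f t)) - f t) 2 (μΩ d) := by
    filter_upwards [hU.eq, ae_restrict_mem measurableSet_Ioo,
      ae_mono (Measure.restrict_mono Ioo_subset_Icc_self le_rfl) hdata.ae_aestronglyMeasurable]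
      with t ht hmem hft
    have hmem' := Ioo_subset_Icc_self hmem
    rw [ENNReal.ofReal_ofNat]
    have h1 := hint t hmem'
    refine (eLpNorm_add_le (h1.integral_prod_left.1.sub ht.1.integral_prod_left.1)
      ((M.measurable_inj _).aestronglyMeasurable.sub hft) one_le_two).trans
      (add_le_add (le_trans (le_of_eq (eLpNorm_congr_ae ?_)) (hc t hmem')) le_rfl)
    refine EventuallyEq.trans ?_ (nonlocalOp_congr (huU t hmem')).symm
    filter_upwards [h1.prod_right_ae, ht.1.prod_right_ae] with x hx1 hx2
    refine (integral_sub hx1 hx2).symm.trans (integral_congr_ae (ae_of_all _ fun y => ?_))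
    simp [integrand, sub_mul]
  refine iSup₂_le fun t ht => ?_
  have h := (hv.isCurveSolution hp).eLpNorm_sub_le one_le_two hKn (flux_Psi hp) hU
    (ae_restrict_of_forall_mem measurableSet_Ioo fun t ht => hint t (Ioo_subset_Icc_self ht)) hΦ ht
  rw [ENNReal.ofReal_ofNat] at h
  have h1 : ∀ s ∈ Icc 0 T, eLpNorm (fun x => M.injL (v s) x - U s x) 2 (μΩ d)
      = eLpNorm (M.inj (v s) - u s) 2 (μΩ d) := fun s hs =>
    eLpNorm_congr_ae ((M.coeFn_injL (v s)).sub (huU s hs).symm)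
  have h2 : eLpNorm (M.inj (v 0) - u 0) 2 (μΩ d) = eLpNorm (M.inj (M.proj g) - g) 2 (μΩ d) := by
    rw [hv.2.1]
    exact eLpNorm_congr_ae (EventuallyEq.rfl.sub ((huU 0 ⟨le_rfl, hT⟩).trans hU0))
  rw [h1 t ht, h1 0 ⟨le_rfl, hT⟩, h2, lintegral_add_left measurable_const, setLIntegral_const,
    Real.volume_Ioo, sub_zero] at h
  refine h.trans ?_
  rw [add_assoc, add_comm (normL1Lq _ _ _), mul_comm c]
  gcongr
  · exact ht.2
  · exact lintegral_mono_set ((Ioo_subset_Ioo_right ht.2).trans Ioo_subset_Icc_self)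

end Mesh

/-- The error estimate in terms of the projection errors. -/
theorem exists_error_bound {p : ℝ} (hp : 1 < p) {T₀ : ℝ≥0∞} {g : (Fin d → ℝ) → ℝ}
    {f : ℝ → (Fin d → ℝ) → ℝ} (hdata : CondAB p (timeSet T₀) f g ∨ CondC (timeSet T₀) f g) :
    ∃ C : ℝ, 0 < C ∧
      ∀ T : ℝ, 0 < T → ENNReal.ofReal T ≤ T₀ → ∀ K, IsKernel d K →
      ∀ u, IsSolution p T K f g u →
      ∀ (n : ℕ) (M : Mesh d n) (v : ℝ → (Fin d → Fin n) → ℝ),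
        M.IsSemidiscreteSolution p T (M.proj₂ K) (fun t => M.proj (f t)) (M.proj g) v →
        MemC T 2 (fun t => M.inj (v t) - u t) ∧
        (CondAB p (timeSet T₀) f g →
          normC T 2 (fun t => M.inj (v t) - u t) ≤
            eLpNorm (M.inj (M.proj g) - g) 2 (μΩ d)
              + normL1Lq (Icc 0 T) 2 (fun t => M.inj (M.proj (f t)) - f t)
              + ENNReal.ofReal (C * T) * normLinfLq d 2 (M.inj₂ (M.proj₂ K) - K)) ∧
        (CondC (timeSet T₀) f g →
          normC T 2 (fun t => M.inj (v t) - u t) ≤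
            eLpNorm (M.inj (M.proj g) - g) 2 (μΩ d)
              + normL1Lq (Icc 0 T) 2 (fun t => M.inj (M.proj (f t)) - f t)
              + ENNReal.ofReal (C * T) * normLqSq d 2 (M.inj₂ (M.proj₂ K) - K)) := by
  have hd := dataIn_of_condAB_or_condC hdata
  set R := eLpNorm g (ENNReal.ofReal (dataExp p)) (μΩ d)
    + normL1Lq (timeSet T₀) (ENNReal.ofReal (dataExp p)) f with hRdef
  -- Both bounds use the whole time set, which makes `C` independent of `T`. Outside case (c) `R'`
  -- may be infinite; its `toReal` is then `0`, and only the estimate for case (c) relies on this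
  -- term.
  set R' := eLpNorm g ∞ (μΩ d) + normL1Lq (timeSet T₀) ∞ f with hRdef'
  have hR : R ≠ ∞ := ENNReal.add_ne_top.2 ⟨hd.1.2.ne, hd.2.2.ne⟩
  have hc₁ : 0 ≤ 2 ^ p * R.toReal ^ (p - 1) := by positivity
  have hc₂ : 0 ≤ (2 * R'.toReal) ^ (p - 1) := by positivity
  refine ⟨2 ^ p * R.toReal ^ (p - 1) + (2 * R'.toReal) ^ (p - 1) + 1, by positivity, ?_⟩
  set C := 2 ^ p * R.toReal ^ (p - 1) + (2 * R'.toReal) ^ (p - 1) + 1 with hC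
  intro T hT hT₀ K hK u hu n M v hv
  have hsub := Icc_subset_timeSet hT₀
  have hdT := hd.mono_set hsub
  have hA : AEStronglyMeasurable (Function.uncurry (M.inj₂ (M.proj₂ K) - K))
      ((μΩ d).prod (μΩ d)) := (M.measurable_inj₂ _).aestronglyMeasurable.sub hK.measurable
  have hCT : ∀ κ : ℝ≥0∞, ENNReal.ofReal (C * T) * κ = ENNReal.ofReal T * (ENNReal.ofReal C * κ) :=
    fun κ => by rw [mul_comm C, ENNReal.ofReal_mul hT.le, mul_assoc]
  refine ⟨hv.memC.sub (hu.memC hp hK hdT), fun _ => ?_, fun hc => ?_⟩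
  · by_cases hκ : normLinfLq d 2 (M.inj₂ (M.proj₂ K) - K) = ∞
    · have hC0 : 0 < C * T := by positivity
      rw [hκ, ENNReal.mul_top (by simpa using hC0), add_top]
      exact le_top
    rw [hCT]
    refine hv.normC_sub_le hp hT.le hK hdT hu fun t ht => ?_
    refine (eLpNorm_nonlocalOp_le_normLinfLq hp hA hκ (hu.aestronglyMeasurable ht) hR
      ((hu.eLpNorm_le hp hK (by linarith [two_le_dataExp p]) ht).trans ?_)).trans ?_
    · exact add_le_add le_rfl (normL1Lq_mono_set hsub)
    · gcongr
      linarith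
  · rw [hCT]
    have hR' : R' ≠ ∞ := ENNReal.add_ne_top.2 ⟨hc.1.2.ne, hc.2.2.ne⟩
    refine hv.normC_sub_le hp hT.le hK hdT hu fun t ht => ?_
    refine (eLpNorm_nonlocalOp_le_normLqSq hp hA hR'
      ((hu.eLpNorm_top_le hp hK (DataIn.mono_set hsub hc) ht).trans ?_)).trans ?_
    · exact add_le_add le_rfl (normL1Lq_mono_set hsub)
    · gcongr
      linarith

/-- The rate of convergence for data in Lipschitz spaces. -/
theorem exists_rate (hd : 1 ≤ d) {p : ℝ} (hp : 1 < p) {T₀ : ℝ≥0∞} {g : (Fin d → ℝ) → ℝ}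
    {f : ℝ → (Fin d → ℝ) → ℝ} {s : ℝ} (hs1 : s ≤ 1) (hc : CondC (timeSet T₀) f g)
    (hg : MemLip s 2 (cube (Fin d)) g)
    (hf : (∫⁻ t in timeSet T₀, lipSeminorm s 2 (cube (Fin d)) (f t)) < ∞)
    {K : (Fin d → ℝ) → (Fin d → ℝ) → ℝ} (hK : IsKernel d K)
    (hKs : MemLip s 2 (cube (Fin d ⊕ Fin d)) (joined K)) :
    ∃ C : ℝ, 0 < C ∧
      ∀ T : ℝ, 0 < T → ENNReal.ofReal T ≤ T₀ →
      ∀ u, IsSolution p T K f g u →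
      ∀ (n : ℕ) (M : Mesh d n) (v : ℝ → (Fin d → Fin n) → ℝ),
        M.IsSemidiscreteSolution p T (M.proj₂ K) (fun t => M.proj (f t)) (M.proj g) v →
        normC T 2 (fun t => M.inj (v t) - u t) ≤
          ENNReal.ofReal (C * (1 + T) * M.size ^ s) := by
  obtain ⟨C, hC, h⟩ := exists_error_bound hp (Or.inr hc)
  set G := lipSeminorm s 2 (cube (Fin d)) g with hG
  set F := ∫⁻ t in timeSet T₀, lipSeminorm s 2 (cube (Fin d)) (f t) with hF
  set L := lipSeminorm s 2 (cube (Fin d ⊕ Fin d)) (joined K) with hL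
  set a : ℝ := 2 ^ d * (d + 1) with ha
  set b : ℝ := 2 ^ (d + d) * ((d + d : ℕ) + 1) with hb
  have hG' : ENNReal.ofReal G.toReal = G := ENNReal.ofReal_toReal hg.2.ne
  have hF' : ENNReal.ofReal F.toReal = F := ENNReal.ofReal_toReal hf.ne
  have hL' : ENNReal.ofReal L.toReal = L := ENNReal.ofReal_toReal hKs.2.ne
  have ha0 : 0 < a := by positivity
  have hb0 : 0 < b := by positivity
  have hG0 : 0 ≤ G.toReal := ENNReal.toReal_nonneg
  have hF0 : 0 ≤ F.toReal := ENNReal.toReal_nonneg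
  have hL0 : 0 ≤ L.toReal := ENNReal.toReal_nonneg
  -- The factors `a` and `b` are the projection constants in dimensions `d` and `2d`, and `C` comes
  -- from the error bound; the last `1` ensures positivity.
  refine ⟨a * G.toReal + a * F.toReal + C * b * L.toReal + 1, by positivity, ?_⟩
  intro T hT hT₀ u hu n M v hv
  have hsub := Icc_subset_timeSet hT₀
  have hσ : 0 < M.size ^ s := Real.rpow_pos_of_pos (M.size_pos hd) s
  set σ := M.size ^ s with hσdef
  have h1 : eLpNorm (M.inj (M.proj g) - g) 2 (μΩ d) ≤ ENNReal.ofReal (a * σ * G.toReal) := by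
    rw [ENNReal.ofReal_mul (by positivity), hG']
    exact M.eLpNorm_inj_proj_sub_le hd hg.1 hs1
  have h2 : normL1Lq (Icc 0 T) 2 (fun t => M.inj (M.proj (f t)) - f t)
      ≤ ENNReal.ofReal (a * σ * F.toReal) := by
    rw [ENNReal.ofReal_mul (by positivity), hF']
    refine (lintegral_mono_set hsub).trans ?_
    rw [← lintegral_const_mul' _ _ ENNReal.ofReal_ne_top]
    refine lintegral_mono_ae ?_
    filter_upwards [(DataIn.mono_exponent le_top hc).ae_memLp_two] with t ht
    exact M.eLpNorm_inj_proj_sub_le hd ht hs1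
  have h3 : ENNReal.ofReal (C * T) * normLqSq d 2 (M.inj₂ (M.proj₂ K) - K)
      ≤ ENNReal.ofReal (C * T * (b * σ * L.toReal)) := by
    rw [ENNReal.ofReal_mul (by positivity : 0 ≤ C * T)]
    gcongr
    rw [ENNReal.ofReal_mul (by positivity), hL']
    exact M.normLqSq_inj₂_proj₂_sub_le hd hKs.1 hs1
  refine ((h T hT hT₀ K hK u hu n M v hv).2.2 hc).trans ((add_le_add (add_le_add h1 h2) h3).trans ?_)
  rw [← ENNReal.ofReal_add (by positivity) (by positivity),
    ← ENNReal.ofReal_add (by positivity) (by positivity)]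
  refine ENNReal.ofReal_le_ofReal ?_
  -- Multiplied by `σ`, this is exactly the difference of the two sides.
  have h4 : 0 ≤ (a * G.toReal + a * F.toReal) * T + C * b * L.toReal + 1 + T := by positivity
  have h5 := mul_nonneg h4 hσ.le
  nlinarith [h5]

end

end NonlocalPLaplacian

end

/-- Well-posedness and error bounds for the space semi-discretization of the nonlocal
`p`-Laplacian evolution problem, `1 < p < ∞`. The source `f` is given on `[0,T₀]`
(on `[0,∞[` if `T₀ = ∞`), and the constants do not depend on the time `T ≤ T₀`. -/
theorem mainTheorem5 (d : ℕ) (hd : 1 ≤ d) (p : ℝ) (hp : 1 < p) (T₀ : ℝ≥0∞)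
    (g : (Fin d → ℝ) → ℝ) (f : ℝ → (Fin d → ℝ) → ℝ)
    (hdata : CondAB p (timeSet T₀) f g ∨ CondC (timeSet T₀) f g) :
    -- (i) existence and uniqueness; the extension of the discrete solution solves the
    -- continuum problem with the projected kernel and data
    (∀ T : ℝ, 0 < T → ENNReal.ofReal T ≤ T₀ → ∀ K, IsKernel d K →
      (∃ u, IsSolution p T K f g u) ∧
      (∀ u, IsSolution p T K f g u → IsUniqueSolution p T K f g u) ∧
      ∀ (n : ℕ) (M : Mesh d n),
        (∃ v, M.IsSemidiscreteSolution p T (M.proj₂ K) (fun t => M.proj (f t)) (M.proj g) v) ∧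
        ∀ v, M.IsSemidiscreteSolution p T (M.proj₂ K) (fun t => M.proj (f t)) (M.proj g) v →
          IsUniqueSolution p T (M.inj₂ (M.proj₂ K)) (fun t => M.inj (M.proj (f t)))
            (M.inj (M.proj g)) (fun t => M.inj (v t))) ∧
    -- (ii) the error estimate, with a constant that depends on `p`, `g` and `f` only
    (∃ C : ℝ, 0 < C ∧
      ∀ T : ℝ, 0 < T → ENNReal.ofReal T ≤ T₀ → ∀ K, IsKernel d K →
      ∀ u, IsSolution p T K f g u →
      ∀ (n : ℕ) (M : Mesh d n) (v : ℝ → (Fin d → Fin n) → ℝ),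
        M.IsSemidiscreteSolution p T (M.proj₂ K) (fun t => M.proj (f t)) (M.proj g) v →
        MemC T 2 (fun t => M.inj (v t) - u t) ∧
        (CondAB p (timeSet T₀) f g →
          normC T 2 (fun t => M.inj (v t) - u t) ≤
            eLpNorm (M.inj (M.proj g) - g) 2 (μΩ d)
              + normL1Lq (Icc 0 T) 2 (fun t => M.inj (M.proj (f t)) - f t)
              + ENNReal.ofReal (C * T) * normLinfLq d 2 (M.inj₂ (M.proj₂ K) - K)) ∧
        (CondC (timeSet T₀) f g →
          normC T 2 (fun t => M.inj (v t) - u t) ≤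
            eLpNorm (M.inj (M.proj g) - g) 2 (μΩ d)
              + normL1Lq (Icc 0 T) 2 (fun t => M.inj (M.proj (f t)) - f t)
              + ENNReal.ofReal (C * T) * normLqSq d 2 (M.inj₂ (M.proj₂ K) - K))) ∧
    -- (iii) the rate, with a constant that depends on `p`, `g`, `f`, `K` and `s` only
    (∀ s : ℝ, 0 < s → s ≤ 1 →
      CondC (timeSet T₀) f g →
      MemLip s 2 (cube (Fin d)) g →
      (∫⁻ t in timeSet T₀, lipSeminorm s 2 (cube (Fin d)) (f t)) < ∞ →
      ∀ K, IsKernel d K → MemLip s 2 (cube (Fin d ⊕ Fin d)) (joined K) →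
      ∃ C : ℝ, 0 < C ∧
        ∀ T : ℝ, 0 < T → ENNReal.ofReal T ≤ T₀ →
        ∀ u, IsSolution p T K f g u →
        ∀ (n : ℕ) (M : Mesh d n) (v : ℝ → (Fin d → Fin n) → ℝ),
          M.IsSemidiscreteSolution p T (M.proj₂ K) (fun t => M.proj (f t)) (M.proj g) v →
          normC T 2 (fun t => M.inj (v t) - u t) ≤
            ENNReal.ofReal (C * (1 + T) * M.size ^ s)) := by
  have hd0 := dataIn_of_condAB_or_condC hdata
  refine ⟨fun T hT hT₀ K hK => ?_, exists_error_bound hp hdata,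
    fun s _ hs1 hc hg hf K hK hKs => exists_rate hd hp hs1 hc hg hf hK hKs⟩
  have hdT := hd0.mono_set (Icc_subset_timeSet hT₀)
  refine ⟨exists_isSolution hp hT.le hK hdT, fun u hu => hu.isUniqueSolution hp hT.le hK.symmKernel,
    fun n M => ⟨M.exists_isSemidiscreteSolution_proj hp hT.le hK
      (hdT.mono_exponent (one_le_two.trans (two_le_ofReal_dataExp p))), fun v hv => ?_⟩⟩
  exact (hv.isSolution hp hT.le).isUniqueSolution hp hT.le
    (M.symmKernel_inj₂ (M.proj₂_nonneg hK) (M.proj₂_symm hK))
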